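/- Let $d\ge 1$ and let $\|\cdot\|$ be the Euclidean norm of $\mathbb R^d$. The Zygmund class $\Lambda_*(\mathbb R^d)$ is the space of bounded continuous functions $f\colon\mathbb R^d\to\mathbb R$ with $$\sup\Big\{\frac{|f(x+h)+f(x-h)-2f(x)|}{\|h\|} : x,h\in\mathbb R^d,\ h\neq 0\Big\}<\infty ,$$ and the small Zygmund class $\lambda_*(\mathbb R^d)$ is the subspace of those $f\in\Lambda_*(\mathbb R^d)$ with $$\lim_{\|h\|\to 0}\ \sup_{x\in\mathbb R^d}\frac{|f(x+h)+f(x-h)-2f(x)|}{\|h\|}=0 .$$ There exists a function $f\in\lambda_*(\mathbb R^d)$ such that the set $$E(f)=\Big\{x\in\mathbb R^d : \limsup_{\|h\|\to 0}\frac{|f(x+h)-f(x)|}{\|h\|}<\infty\Big\}$$ has Hausdorff dimension exactly $1$. -/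

import Mathlib

open Filter Topology

/-- The Euclidean space `ℝ^d` (with the Euclidean norm). -/
abbrev RSpace (d : ℕ) : Type := EuclideanSpace ℝ (Fin d)

/-- The second difference `f(x+h) + f(x-h) - 2 f(x)`. -/
noncomputable def secondDiff {d : ℕ} (f : RSpace d → ℝ) (x h : RSpace d) : ℝ :=
  f (x + h) + f (x - h) - 2 * f x

/-- The Zygmund class `Λ_*(ℝ^d)`: the bounded continuous functions `f : ℝ^d → ℝ` for which the
quotients `|f(x+h) + f(x-h) - 2 f(x)| / ‖h‖` are bounded, uniformly in `x` and `h ≠ 0`. -/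
structure IsZygmund {d : ℕ} (f : RSpace d → ℝ) : Prop where
  continuous : Continuous f
  bounded : ∃ B : ℝ, ∀ x, |f x| ≤ B
  zygmund : ∃ C : ℝ, ∀ x h, |secondDiff f x h| ≤ C * ‖h‖

/-- The small Zygmund class `λ_*(ℝ^d)`: the functions `f` in `Λ_*(ℝ^d)` for which
`sup_x |f(x+h) + f(x-h) - 2 f(x)| / ‖h‖` tends to `0` as `‖h‖ → 0`. -/
structure IsSmallZygmund {d : ℕ} (f : RSpace d → ℝ) : Prop extends IsZygmund f where
  small : ∀ ε : ℝ, 0 < ε → ∃ δ : ℝ, 0 < δ ∧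
    ∀ h : RSpace d, ‖h‖ < δ → ∀ x, |secondDiff f x h| ≤ ε * ‖h‖

/-- The set `E(f)` of the points `x` at which the divided differences of `f` are bounded:
`limsup_{h → 0, h ≠ 0} |f(x+h) - f(x)| / ‖h‖ < ∞`, the upper limit being taken in `[0, ∞]`. -/
noncomputable def boundedDiffSet {d : ℕ} (f : RSpace d → ℝ) : Set (RSpace d) :=
  {x | limsup (fun h : RSpace d => ENNReal.ofReal (|f (x + h) - f x| / ‖h‖)) (𝓝[≠] 0) < ⊤}

/-! Write d = e + 1. The heart is a function F = `limitFn e m` in the small Zygmund class with dim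
E(F) ≤ 1. The answer is f = wF, where the smooth weight w = `lineWeight` vanishes exactly on
countably many parallel lines. On such a line f(x+h) - f(x) = F(x+h)(w(x+h) - w(x)) = O(‖h‖), so
E(f) contains lines and has dimension at least 1. Off the lines one divides by w(x), so E(f) lies in
E(F) together with the lines. For e = 0 the weight is an empty sum and f = 0.

F is the limit of f_{n+1} = f_n + `stepFn`, where f_n has gradient p_n and Taylor remainder Ω_n
‖h‖². A step adds oscillations of gradient size ε_n, at scales far below 1/Ω_n. At any scale only
one step matters for second differences: earlier ones are smooth there, later ones are uniformly
tiny. Hence ε_n → 0 gives the small Zygmund condition (`abs_secondDiff_limitFn_le`).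

Points of E(F) have bounded p_n (`gradient_bounded_of_mem`). The function L(p) = p_0 + Σ √(1 + p_j²)
(`lyap`) is then bounded along the sequence. Inside thin slabs orthogonal to e_0, the step adds e
triangular waves, the j-th moving the gradient along e_j - s_j e_0 with s_j close to p_j/√(1 +
p_j²), that is, tangentially to the level set of L. The first variation is therefore nearly zero and
strict convexity makes L grow by at least c ε_n², except where all e waves are simultaneously at a
kink of width δ_n. At slab boundaries the waves are cut off, and there a sawtooth of slope 3 raises
L; it is paid for by a slope of order -1/a_n elsewhere (`lyap_step_ge`, `lyap_step_ge_of_notMem`).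
As ε_n² = 1/√(n+1), a point with bounded gradients misses only O(√n) of the first n kink sets
(`freeSteps_le`).

A kink set imposes e conditions, so it is a thin neighbourhood of curves: a piece of diameter 1/Ω_n
meets it in about 1/δ_n pieces of diameter 1/Ω_{n+1} = δ_n/(a_n^7 Ω_n), up to powers of a_n
(`cover_kink`). An exceptional step costs a further δ_n^{-e}. With a_n = 2^{n+m} and δ_n =
2^{-(n+m)²}, the logarithm of 1/Ω_n is of order -n³, the powers of a contribute order n², and the
exceptional steps order n² √n. Both are negligible, so the dimension is at most 1
(`cover_freeSteps`, `dimH_boundedGradSet_inter_le`). -/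

/-! ### Calculus of first order expansions with quadratic remainder. -/

/-- First order Taylor expansion with a quadratic remainder, for a function of one variable. -/
def HasTaylor (u u' : ℝ → ℝ) (B : ℝ) : Prop :=
  ∀ s t, |u (s + t) - u s - u' s * t| ≤ B * t ^ 2

theorem HasTaylor.of_deriv {u u' u'' : ℝ → ℝ} {B : ℝ} (h1 : ∀ s, HasDerivAt u (u' s) s)
    (h2 : ∀ s, HasDerivAt u' (u'' s) s) (hB : ∀ s, |u'' s| ≤ B) : HasTaylor u u' B := by
  have lip : ∀ s t, |u' (s + t) - u' s| ≤ B * |t| := by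
    intro s t
    have := Convex.norm_image_sub_le_of_norm_hasDerivWithin_le (f := u') (f' := u'') (s := Set.univ)
      (C := B) (x := s) (y := s + t) (fun x _ => (h2 x).hasDerivWithinAt) (fun x _ => hB x)
      convex_univ (Set.mem_univ _) (Set.mem_univ _)
    simpa [Real.norm_eq_abs] using this
  intro s t
  have hB0 : 0 ≤ B := (abs_nonneg _).trans (hB 0)
  have := Convex.norm_image_sub_le_of_norm_hasDerivWithin_le
      (f := fun τ => u (s + τ) - u s - u' s * τ)
      (f' := fun τ => u' (s + τ) - u' s) (s := Set.uIcc 0 t)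
      (C := B * |t|) (x := 0) (y := t) (fun x _ => by
        have h := ((h1 (s + x)).comp_const_add s x).sub_const (u s)
        have h' := h.sub ((hasDerivAt_id x).const_mul (u' s))
        rw [mul_one] at h'
        exact h'.hasDerivWithinAt)
      (fun x hx => by
        refine (lip s x).trans ?_
        have : |x| ≤ |t| := by
          rcases Set.mem_uIcc.1 hx with h | h
          · rw [abs_of_nonneg h.1, abs_of_nonneg (h.1.trans h.2)]; exact h.2
          · rw [abs_of_nonpos h.2, abs_of_nonpos (h.1.trans h.2)]; linarith [h.1]
        gcongr)
      (convex_uIcc 0 t) Set.left_mem_uIcc Set.right_mem_uIcc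
  simp only [Real.norm_eq_abs, add_zero, sub_self, mul_zero, sub_zero] at this
  rw [mul_assoc, abs_mul_abs_self] at this
  nlinarith [this]

theorem HasTaylor.hasDerivAt_of_local {u : ℝ → ℝ} {c s B τ : ℝ} (hτ : 0 < τ)
    (h : ∀ t, |t| ≤ τ → |u (s + t) - u s - c * t| ≤ B * t ^ 2) : HasDerivAt u c s := by
  rw [hasDerivAt_iff_isLittleO_nhds_zero]
  have h1 : (fun t => u (s + t) - u s - t • c) =O[𝓝 0] fun t : ℝ => t ^ 2 := by
    refine Asymptotics.IsBigO.of_bound B ?_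
    filter_upwards [Metric.closedBall_mem_nhds (0 : ℝ) hτ] with t ht
    have ht' : |t| ≤ τ := by simpa using ht
    have := h t ht'
    simpa [mul_comm c t] using this
  refine h1.trans_isLittleO ?_
  simpa using (Asymptotics.isLittleO_pow_pow (𝕜 := ℝ) (m := 1) (n := 2) (by norm_num))

theorem HasTaylor.lipschitz {u u' : ℝ → ℝ} {B D : ℝ} (h : HasTaylor u u' B) (hD : ∀ s, |u' s| ≤ D)
    (s t : ℝ) : |u (s + t) - u s| ≤ D * |t| := by
  have := Convex.norm_image_sub_le_of_norm_hasDerivWithin_le (f := u) (f' := u') (s := Set.univ)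
      (C := D) (x := s) (y := s + t)
      (fun x _ => (HasTaylor.hasDerivAt_of_local one_pos (fun t _ => h x t)).hasDerivWithinAt)
      (fun x _ => hD x) convex_univ (Set.mem_univ _) (Set.mem_univ _)
  simpa [Real.norm_eq_abs] using this

/-- Product rule for first order expansions with quadratic remainders. -/
theorem mul_taylor_bound {u0 u1 v0 v1 lu lv U W Bu Bv Au Av H : ℝ}
    (hU : |u0| ≤ U) (hW : |v0| ≤ W) (hBu : |u1 - u0 - lu| ≤ Bu * H ^ 2)
    (hBv : |v1 - v0 - lv| ≤ Bv * H ^ 2) (hAu : |u1 - u0| ≤ Au * H) (hAv : |v1 - v0| ≤ Av * H) :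
    |u1 * v1 - u0 * v0 - (u0 * lv + v0 * lu)| ≤ (U * Bv + W * Bu + Au * Av) * H ^ 2 := by
  have e : u1 * v1 - u0 * v0 - (u0 * lv + v0 * lu)
      = u0 * (v1 - v0 - lv) + v0 * (u1 - u0 - lu) + (u1 - u0) * (v1 - v0) := by ring
  rw [e]
  have h1 : |u0 * (v1 - v0 - lv)| ≤ U * (Bv * H ^ 2) := by
    rw [abs_mul]; exact mul_le_mul hU hBv (abs_nonneg _) ((abs_nonneg _).trans hU)
  have h2 : |v0 * (u1 - u0 - lu)| ≤ W * (Bu * H ^ 2) := by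
    rw [abs_mul]; exact mul_le_mul hW hBu (abs_nonneg _) ((abs_nonneg _).trans hW)
  have h3 : |(u1 - u0) * (v1 - v0)| ≤ (Au * H) * (Av * H) := by
    rw [abs_mul]; exact mul_le_mul hAu hAv (abs_nonneg _) ((abs_nonneg _).trans hAu)
  refine (abs_add_three _ _ _).trans ?_
  nlinarith

/-- Lipschitz bound for a product. -/
theorem mul_lip_bound {u0 u1 v0 v1 U W Au Av H : ℝ}
    (hU : |u0| ≤ U) (hW : |v1| ≤ W) (hAu : |u1 - u0| ≤ Au * H) (hAv : |v1 - v0| ≤ Av * H) :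
    |u1 * v1 - u0 * v0| ≤ (U * Av + W * Au) * H := by
  have e : u1 * v1 - u0 * v0 = u0 * (v1 - v0) + v1 * (u1 - u0) := by ring
  rw [e]
  have h1 : |u0 * (v1 - v0)| ≤ U * (Av * H) := by
    rw [abs_mul]; exact mul_le_mul hU hAv (abs_nonneg _) ((abs_nonneg _).trans hU)
  have h2 : |v1 * (u1 - u0)| ≤ W * (Au * H) := by
    rw [abs_mul]; exact mul_le_mul hW hAu (abs_nonneg _) ((abs_nonneg _).trans hW)
  refine (abs_add_le _ _).trans ?_
  nlinarith

/-- Chain rule for first order expansions with quadratic remainders. -/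
theorem HasTaylor.comp_bound {φ φ' : ℝ → ℝ} {Bφ D u0 u1 lu Bu Au H : ℝ} (hφ : HasTaylor φ φ' Bφ)
    (hφ0 : 0 ≤ Bφ) (hD : |φ' u0| ≤ D) (hBu : |u1 - u0 - lu| ≤ Bu * H ^ 2)
    (hAu : |u1 - u0| ≤ Au * H) :
    |φ u1 - φ u0 - φ' u0 * lu| ≤ (D * Bu + Bφ * Au ^ 2) * H ^ 2 := by
  have h1 := hφ u0 (u1 - u0)
  rw [add_sub_cancel] at h1
  have e : φ u1 - φ u0 - φ' u0 * lu
      = (φ u1 - φ u0 - φ' u0 * (u1 - u0)) + φ' u0 * (u1 - u0 - lu) := by ring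
  rw [e]
  have h2 : |φ' u0 * (u1 - u0 - lu)| ≤ D * (Bu * H ^ 2) := by
    rw [abs_mul]; exact mul_le_mul hD hBu (abs_nonneg _) ((abs_nonneg _).trans hD)
  have h3 : (u1 - u0) ^ 2 ≤ (Au * H) ^ 2 := sq_le_sq' (by linarith [(abs_le.1 hAu).1]) (abs_le.1 hAu).2
  have h4 : Bφ * (u1 - u0) ^ 2 ≤ Bφ * (Au * H) ^ 2 := by gcongr
  refine (abs_add_le _ _).trans ?_
  nlinarith

/-! ### The square of the positive part and the cutoffs built from it -/

/-- `max v 0 ^ 2`. -/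
noncomputable def posSq (v : ℝ) : ℝ := (max v 0) ^ 2

theorem posSq_taylor : HasTaylor posSq (fun s => 2 * max s 0) 1 := by
  intro s t
  unfold posSq
  rw [abs_le]
  rcases le_total s 0 with hs | hs <;> rcases le_total (s + t) 0 with h | h <;>
    simp only [max_eq_left, max_eq_right, hs, h] <;> constructor <;> nlinarith

theorem posSq_of_nonpos {v : ℝ} (h : v ≤ 0) : posSq v = 0 := by simp [posSq, max_eq_right h]

theorem posSq_of_nonneg {v : ℝ} (h : 0 ≤ v) : posSq v = v ^ 2 := by simp [posSq, max_eq_left h]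

/-- A smooth step from `0` to `1` on `[0, 1]`. -/
noncomputable def rampFn (s : ℝ) : ℝ := 2 * (posSq s - 2 * posSq (s - 1 / 2) + posSq (s - 1))

/-- The derivative of `rampFn`. -/
noncomputable def rampDeriv (s : ℝ) : ℝ :=
  2 * (2 * max s 0 - 2 * (2 * max (s - 1 / 2) 0) + 2 * max (s - 1) 0)

theorem rampFn_taylor : HasTaylor rampFn rampDeriv 8 := by
  intro s t
  have h1 := abs_le.1 (posSq_taylor s t)
  have h2 := abs_le.1 (posSq_taylor (s - 1 / 2) t)
  have h3 := abs_le.1 (posSq_taylor (s - 1) t)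
  rw [show s - 1 / 2 + t = s + t - 1 / 2 by ring] at h2
  rw [show s - 1 + t = s + t - 1 by ring] at h3
  unfold rampFn rampDeriv
  rw [abs_le]
  constructor <;> linarith [h1.1, h1.2, h2.1, h2.2, h3.1, h3.2]

theorem rampFn_cases (s : ℝ) : (s ≤ 0 ∧ rampFn s = 0 ∧ rampDeriv s = 0) ∨
    (0 ≤ s ∧ s ≤ 1 / 2 ∧ rampFn s = 2 * s ^ 2 ∧ rampDeriv s = 4 * s) ∨
    (1 / 2 ≤ s ∧ s ≤ 1 ∧ rampFn s = 1 - 2 * (1 - s) ^ 2 ∧ rampDeriv s = 4 * (1 - s)) ∨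
    (1 ≤ s ∧ rampFn s = 1 ∧ rampDeriv s = 0) := by
  unfold rampFn rampDeriv posSq
  rcases le_total s 0 with h | h
  · left
    rw [max_eq_right h, max_eq_right (by linarith : s - 1 / 2 ≤ 0),
      max_eq_right (by linarith : s - 1 ≤ 0)]
    refine ⟨h, ?_, ?_⟩ <;> norm_num
  right
  rcases le_total s (1 / 2) with h' | h'
  · left
    rw [max_eq_left h, max_eq_right (by linarith : s - 1 / 2 ≤ 0),
      max_eq_right (by linarith : s - 1 ≤ 0)]
    refine ⟨h, h', ?_, ?_⟩ <;> ring
  right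
  rcases le_total s 1 with h'' | h''
  · left
    rw [max_eq_left h, max_eq_left (by linarith : 0 ≤ s - 1 / 2),
      max_eq_right (by linarith : s - 1 ≤ 0)]
    refine ⟨h', h'', ?_, ?_⟩ <;> ring
  right
  rw [max_eq_left h, max_eq_left (by linarith : 0 ≤ s - 1 / 2),
      max_eq_left (by linarith : 0 ≤ s - 1)]
  refine ⟨h'', ?_, ?_⟩ <;> ring

theorem rampFn_of_nonpos {s : ℝ} (h : s ≤ 0) : rampFn s = 0 := by
  rw [rampFn, posSq_of_nonpos h, posSq_of_nonpos (by linarith : s - 1 / 2 ≤ 0),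
    posSq_of_nonpos (by linarith : s - 1 ≤ 0)]
  norm_num

theorem rampFn_of_one_le {s : ℝ} (h : 1 ≤ s) : rampFn s = 1 := by
  rw [rampFn, posSq_of_nonneg (by linarith : 0 ≤ s), posSq_of_nonneg (by linarith : 0 ≤ s - 1 / 2),
    posSq_of_nonneg (by linarith : 0 ≤ s - 1)]
  ring

theorem rampFn_mem (s : ℝ) : 0 ≤ rampFn s ∧ rampFn s ≤ 1 := by
  rcases rampFn_cases s with ⟨_, h, _⟩ | ⟨_, _, h, _⟩ | ⟨_, _, h, _⟩ | ⟨_, h, _⟩ <;> rw [h] <;>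
    constructor <;> nlinarith

theorem abs_rampDeriv_le (s : ℝ) : |rampDeriv s| ≤ 2 := by
  rw [abs_le]
  rcases rampFn_cases s with ⟨_, _, h⟩ | ⟨_, _, _, h⟩ | ⟨_, _, _, h⟩ | ⟨_, _, h⟩ <;> rw [h] <;>
    constructor <;> linarith

/-- A cutoff function, equal to `0` outside `[1/a, 1-1/a]` and to `1` on `[2/a, 1-2/a]`. -/
noncomputable def cutFn (a v : ℝ) : ℝ := rampFn (a * v - 1) * rampFn (a * (1 - v) - 1)

/-- The derivative of `cutFn a`. -/
noncomputable def cutDeriv (a v : ℝ) : ℝ :=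
  rampFn (a * v - 1) * (-(a * rampDeriv (a * (1 - v) - 1)))
    + rampFn (a * (1 - v) - 1) * (a * rampDeriv (a * v - 1))

theorem cutFn_taylor {a : ℝ} (ha : 0 < a) : HasTaylor (cutFn a) (cutDeriv a) (20 * a ^ 2) := by
  intro s t
  have h1 := rampFn_taylor (a * s - 1) (a * t)
  have h2 := rampFn_taylor (a * (1 - s) - 1) (-(a * t))
  have l1 := rampFn_taylor.lipschitz abs_rampDeriv_le (a * s - 1) (a * t)
  have l2 := rampFn_taylor.lipschitz abs_rampDeriv_le (a * (1 - s) - 1) (-(a * t))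
  rw [show a * s - 1 + a * t = a * (s + t) - 1 by ring] at h1 l1
  rw [show a * (1 - s) - 1 + -(a * t) = a * (1 - (s + t)) - 1 by ring] at h2 l2
  rw [abs_neg] at l2
  rw [abs_mul, abs_of_pos ha] at l1 l2
  have := mul_taylor_bound (U := 1) (W := 1) (H := |t|) (Bu := 8 * a ^ 2) (Bv := 8 * a ^ 2)
    (Au := 2 * a) (Av := 2 * a)
    (u0 := rampFn (a * s - 1)) (u1 := rampFn (a * (s + t) - 1))
    (v0 := rampFn (a * (1 - s) - 1)) (v1 := rampFn (a * (1 - (s + t)) - 1))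
    (lu := rampDeriv (a * s - 1) * (a * t)) (lv := rampDeriv (a * (1 - s) - 1) * (-(a * t)))
    (abs_le.2 ⟨by linarith [(rampFn_mem (a * s - 1)).1], (rampFn_mem _).2⟩)
    (abs_le.2 ⟨by linarith [(rampFn_mem (a * (1 - s) - 1)).1], (rampFn_mem _).2⟩)
    (h1.trans (by rw [sq_abs]; nlinarith)) (h2.trans (by rw [sq_abs]; nlinarith))
    (by linarith) (by linarith)
  rw [sq_abs] at this
  unfold cutFn cutDeriv
  convert this using 1
  · congr 1; ring
  · ring

theorem cutFn_mem (a v : ℝ) : 0 ≤ cutFn a v ∧ cutFn a v ≤ 1 :=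
  ⟨mul_nonneg (rampFn_mem _).1 (rampFn_mem _).1,
    mul_le_one₀ (rampFn_mem _).2 (rampFn_mem _).1 (rampFn_mem _).2⟩

theorem abs_cutDeriv_le {a : ℝ} (ha : 0 < a) (v : ℝ) : |cutDeriv a v| ≤ 4 * a := by
  have hm : ∀ x y z : ℝ, 0 ≤ x → x ≤ 1 → |y| ≤ z → |x * y| ≤ z := by
    intro x y z h0 h1 hy
    rw [abs_mul, abs_of_nonneg h0]
    nlinarith [abs_nonneg y]
  unfold cutDeriv
  refine (abs_add_le _ _).trans ?_
  have h1 := hm (rampFn (a * v - 1)) (-(a * rampDeriv (a * (1 - v) - 1))) (2 * a)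
    (rampFn_mem _).1 (rampFn_mem _).2 (by
      rw [abs_neg, abs_mul, abs_of_pos ha]; nlinarith [abs_rampDeriv_le (a * (1 - v) - 1)])
  have h2 := hm (rampFn (a * (1 - v) - 1)) (a * rampDeriv (a * v - 1)) (2 * a)
    (rampFn_mem _).1 (rampFn_mem _).2 (by
      rw [abs_mul, abs_of_pos ha]; nlinarith [abs_rampDeriv_le (a * v - 1)])
  linarith

theorem cutFn_eq_zero_left {a v : ℝ} (h : a * v ≤ 1) : cutFn a v = 0 := by
  rw [cutFn, rampFn_of_nonpos (by linarith), zero_mul]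

theorem cutFn_eq_zero_right {a v : ℝ} (h : a * (1 - v) ≤ 1) : cutFn a v = 0 := by
  rw [cutFn, rampFn_of_nonpos (by linarith : a * (1 - v) - 1 ≤ 0), mul_zero]

theorem cutFn_eq_one {a v : ℝ} (h : 2 ≤ a * v) (h' : 2 ≤ a * (1 - v)) : cutFn a v = 1 := by
  rw [cutFn, rampFn_of_one_le (by linarith), rampFn_of_one_le (by linarith), mul_one]

/-! ### The sawtooth -/

/-- A sawtooth: slope `3` near the ends of `[0, 1]`, slope at least `-C / a` in between, and the
same value `0` at both ends. -/
noncomputable def sawFn (a v : ℝ) : ℝ :=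
  3 * v - 3 / (2 * (a - 7)) *
    (posSq (a * v - 3) - posSq (a * v - 4) - posSq (a * v - a + 4) + posSq (a * v - a + 3))

/-- The derivative of `sawFn a`. -/
noncomputable def sawDeriv (a v : ℝ) : ℝ :=
  3 - 3 * a / (a - 7) *
    (max (a * v - 3) 0 - max (a * v - 4) 0 - max (a * v - a + 4) 0 + max (a * v - a + 3) 0)

theorem sawFn_taylor {a : ℝ} (ha : 100 ≤ a) : HasTaylor (sawFn a) (sawDeriv a) (7 * a) := by
  intro s t
  have h1 := abs_le.1 (posSq_taylor (a * s - 3) (a * t))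
  have h2 := abs_le.1 (posSq_taylor (a * s - 4) (a * t))
  have h3 := abs_le.1 (posSq_taylor (a * s - a + 4) (a * t))
  have h4 := abs_le.1 (posSq_taylor (a * s - a + 3) (a * t))
  rw [show a * s - 3 + a * t = a * (s + t) - 3 by ring] at h1
  rw [show a * s - 4 + a * t = a * (s + t) - 4 by ring] at h2
  rw [show a * s - a + 4 + a * t = a * (s + t) - a + 4 by ring] at h3
  rw [show a * s - a + 3 + a * t = a * (s + t) - a + 3 by ring] at h4
  set P := (posSq (a * (s + t) - 3) - posSq (a * (s + t) - 4) - posSq (a * (s + t) - a + 4)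
      + posSq (a * (s + t) - a + 3)) -
    (posSq (a * s - 3) - posSq (a * s - 4) - posSq (a * s - a + 4) + posSq (a * s - a + 3)) -
    2 * (max (a * s - 3) 0 - max (a * s - 4) 0 - max (a * s - a + 4) 0 + max (a * s - a + 3) 0)
      * (a * t) with hP
  have hPb : |P| ≤ 4 * (a * t) ^ 2 := by
    rw [abs_le]; constructor <;> linarith [h1.1, h1.2, h2.1, h2.2, h3.1, h3.2, h4.1, h4.2]
  have e : sawFn a (s + t) - sawFn a s - sawDeriv a s * t = -(3 / (2 * (a - 7))) * P := by
    rw [hP, sawFn, sawFn, sawDeriv]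
    have : a - 7 ≠ 0 := by linarith
    field_simp
    ring
  rw [e, abs_mul, abs_neg, abs_of_nonneg (div_nonneg (by norm_num) (by linarith))]
  have h7 : 3 / (2 * (a - 7)) ≤ 7 / (4 * a) := by
    rw [div_le_div_iff₀ (by linarith) (by linarith)]; linarith
  calc 3 / (2 * (a - 7)) * |P| ≤ 7 / (4 * a) * (4 * (a * t) ^ 2) := by
        have : 0 ≤ 7 / (4 * a) := by positivity
        gcongr
    _ = 7 * a * t ^ 2 := by field_simp

theorem sawFn_left {a v : ℝ} (ha : 100 ≤ a) (h : a * v ≤ 3) : sawFn a v = 3 * v := by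
  rw [sawFn, posSq_of_nonpos (by linarith), posSq_of_nonpos (by linarith),
    posSq_of_nonpos (by linarith), posSq_of_nonpos (by linarith)]
  ring

theorem sawFn_right {a v : ℝ} (ha : 100 ≤ a) (h : a - 3 ≤ a * v) : sawFn a v = 3 * (v - 1) := by
  rw [sawFn, posSq_of_nonneg (by linarith), posSq_of_nonneg (by linarith),
    posSq_of_nonneg (by linarith), posSq_of_nonneg (by linarith)]
  have : a - 7 ≠ 0 := by linarith
  field_simp
  ring

theorem sawDeriv_left {a v : ℝ} (ha : 100 ≤ a) (h : a * v ≤ 3) : sawDeriv a v = 3 := by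
  rw [sawDeriv, max_eq_right (by linarith), max_eq_right (by linarith),
    max_eq_right (by linarith), max_eq_right (by linarith)]
  ring

theorem sawDeriv_right {a v : ℝ} (ha : 100 ≤ a) (h : a - 3 ≤ a * v) : sawDeriv a v = 3 := by
  rw [sawDeriv, max_eq_left (by linarith), max_eq_left (by linarith),
    max_eq_left (by linarith), max_eq_left (by linarith)]
  ring

/-- The combination is a trapezoid: it climbs from 0 to 1 on [3, 4], stays at 1 up to a - 4 and is
back at 0 from a - 3 on. Its area a - 7 is the normalisation in `sawFn` that makes the total rise
over a period zero. -/
theorem saw_slope_mem {a : ℝ} (ha : 100 ≤ a) (w : ℝ) :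
    0 ≤ max (w - 3) 0 - max (w - 4) 0 - max (w - a + 4) 0 + max (w - a + 3) 0 ∧
    max (w - 3) 0 - max (w - 4) 0 - max (w - a + 4) 0 + max (w - a + 3) 0 ≤ 1 := by
  rcases max_cases (w - 3) 0 with h1 | h1 <;> rcases max_cases (w - 4) 0 with h2 | h2 <;>
  rcases max_cases (w - a + 4) 0 with h3 | h3 <;> rcases max_cases (w - a + 3) 0 with h4 | h4 <;>
  rw [h1.1, h2.1, h3.1, h4.1] <;> constructor <;> linarith [h1.2, h2.2, h3.2, h4.2]

theorem sawDeriv_le {a : ℝ} (ha : 100 ≤ a) (v : ℝ) : sawDeriv a v ≤ 3 := by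
  have h := (saw_slope_mem ha (a * v)).1
  have : 0 ≤ 3 * a / (a - 7) := div_nonneg (by linarith) (by linarith)
  rw [sawDeriv]
  nlinarith [mul_nonneg this h]

/-- The slope 3 occupies a proportion O(1/a) of the period, so compensating it costs only a slope
-21/(a - 7) elsewhere. This is the price of periodicity, and it is summable over the steps. -/
theorem le_sawDeriv {a : ℝ} (ha : 100 ≤ a) (v : ℝ) : -(30 / a) ≤ sawDeriv a v := by
  have h := (saw_slope_mem ha (a * v)).2
  have h0 : 0 ≤ 3 * a / (a - 7) := div_nonneg (by linarith) (by linarith)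
  have h1 : 3 * a / (a - 7) ≤ 3 + 30 / a := by
    rw [add_div' _ _ _ (by linarith : a ≠ 0), div_le_div_iff₀ (by linarith) (by linarith)]
    nlinarith
  rw [sawDeriv]
  nlinarith [mul_le_mul_of_nonneg_left h h0]

theorem abs_sawDeriv_le {a : ℝ} (ha : 100 ≤ a) (v : ℝ) : |sawDeriv a v| ≤ 3 := by
  have h : 30 / a ≤ 1 := by rw [div_le_one (by linarith)]; linarith
  exact abs_le.2 ⟨by linarith [le_sawDeriv ha v], sawDeriv_le ha v⟩

theorem abs_sawFn_le {a v : ℝ} (ha : 100 ≤ a) (h0 : 0 ≤ v) (h1 : v ≤ 1) : |sawFn a v| ≤ 3 := by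
  have h := (sawFn_taylor ha).lipschitz (abs_sawDeriv_le ha) 0 v
  rw [zero_add, sawFn_left (v := 0) ha (by linarith), mul_zero, sub_zero, abs_of_nonneg h0] at h
  linarith

/-! ### The strictly convex profile and the triangular wave -/

/-- The derivative `s / √(1 + s²)` of the strictly convex function `√(1 + s²)`. -/
noncomputable def tiltFn (s : ℝ) : ℝ := s / √(1 + s ^ 2)

/-- The derivative of `tiltFn`. -/
noncomputable def tiltDeriv (s : ℝ) : ℝ := 1 / √(1 + s ^ 2) ^ 3

theorem one_le_sqrt_one_add_sq (s : ℝ) : 1 ≤ √(1 + s ^ 2) := by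
  rw [Real.one_le_sqrt]; nlinarith [sq_nonneg s]

theorem abs_le_sqrt_one_add_sq (s : ℝ) : |s| ≤ √(1 + s ^ 2) :=
  Real.abs_le_sqrt (by linarith)

theorem sq_sqrt_one_add_sq (s : ℝ) : √(1 + s ^ 2) ^ 2 = 1 + s ^ 2 :=
  Real.sq_sqrt (by positivity)

theorem hasDerivAt_sqrt_one_add_sq (s : ℝ) : HasDerivAt (fun s : ℝ => √(1 + s ^ 2)) (tiltFn s) s := by
  have h := ((hasDerivAt_pow 2 s).const_add 1).sqrt (by positivity)
  convert h using 1
  rw [tiltFn]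
  field_simp
  simp [mul_comm]

theorem hasDerivAt_tiltFn (s : ℝ) : HasDerivAt tiltFn (tiltDeriv s) s := by
  have h1 := one_le_sqrt_one_add_sq s
  have h := (hasDerivAt_id s).div (hasDerivAt_sqrt_one_add_sq s) (by positivity)
  refine h.congr_deriv ?_
  rw [tiltFn, tiltDeriv]
  have h0 : √(1 + s ^ 2) ≠ 0 := by positivity
  simp only [id]
  field_simp
  linarith [sq_sqrt_one_add_sq s]

theorem hasDerivAt_tiltDeriv (s : ℝ) :
    HasDerivAt tiltDeriv (-(3 * s / √(1 + s ^ 2) ^ 5)) s := by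
  have h1 := one_le_sqrt_one_add_sq s
  have h := (hasDerivAt_const s (1 : ℝ)).div ((hasDerivAt_sqrt_one_add_sq s).pow 3)
    (pow_ne_zero 3 (by linarith))
  refine h.congr_deriv ?_
  have h0 : √(1 + s ^ 2) ≠ 0 := by positivity
  rw [tiltFn]
  simp
  field_simp

theorem abs_tiltFn_le (s : ℝ) : |tiltFn s| ≤ 1 := by
  have h1 := one_le_sqrt_one_add_sq s
  rw [tiltFn, abs_div, abs_of_pos (by positivity : 0 < √(1 + s ^ 2)), div_le_one (by positivity)]
  exact abs_le_sqrt_one_add_sq s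

theorem abs_tiltDeriv_le (s : ℝ) : |tiltDeriv s| ≤ 1 := by
  have h1 := one_le_sqrt_one_add_sq s
  rw [tiltDeriv, abs_of_pos (by positivity), div_le_one (by positivity)]
  exact one_le_pow₀ h1

theorem tiltFn_taylor : HasTaylor tiltFn tiltDeriv 3 := by
  refine HasTaylor.of_deriv hasDerivAt_tiltFn hasDerivAt_tiltDeriv fun s => ?_
  have h1 := one_le_sqrt_one_add_sq s
  rw [abs_neg, abs_div, abs_mul, abs_of_pos (by positivity : 0 < √(1 + s ^ 2) ^ 5),
    abs_of_pos (by norm_num : (0:ℝ) < 3), div_le_iff₀ (by positivity)]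
  have : √(1 + s ^ 2) ≤ √(1 + s ^ 2) ^ 5 := le_self_pow₀ h1 (by norm_num)
  linarith [abs_le_sqrt_one_add_sq s]

theorem tiltFn_lipschitz (s t : ℝ) : |tiltFn t - tiltFn s| ≤ |t - s| := by
  have := tiltFn_taylor.lipschitz abs_tiltDeriv_le s (t - s)
  rwa [add_sub_cancel, one_mul] at this

/-- Quantitative strict convexity of `√(1 + s²)` on `[-M, M]`. -/
theorem sqrt_one_add_sq_convex {M a b : ℝ} (hM : 0 ≤ M) (ha : |a| ≤ M) (hb : |b| ≤ M) :
    (b - a) ^ 2 / (2 * (1 + M) ^ 3) ≤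
      √(1 + b ^ 2) - √(1 + a ^ 2) - tiltFn a * (b - a) := by
  have h1 := one_le_sqrt_one_add_sq a
  have h2 := one_le_sqrt_one_add_sq b
  have hle : ∀ c : ℝ, |c| ≤ M → √(1 + c ^ 2) ≤ 1 + M := by
    intro c hc
    rw [Real.sqrt_le_left (by linarith)]
    have := sq_le_sq' (by linarith [(abs_le.1 hc).1]) (abs_le.1 hc).2
    nlinarith
  set A := √(1 + a ^ 2) with hA
  set B := √(1 + b ^ 2) with hB
  have hA2 : A ^ 2 = 1 + a ^ 2 := sq_sqrt_one_add_sq a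
  have hB2 : B ^ 2 = 1 + b ^ 2 := sq_sqrt_one_add_sq b
  -- The convexity defect equals (AB - (1 + ab))/A, and this form of Lagrange's identity turns its
  -- numerator into (b - a)² divided by a bounded quantity.
  have key : (A * B - (1 + a * b)) * (A * B + (1 + a * b)) = (b - a) ^ 2 := by
    have : (A * B) ^ 2 = (1 + a ^ 2) * (1 + b ^ 2) := by rw [mul_pow, hA2, hB2]
    nlinarith
  have hAb : |a * b| ≤ A * B := by
    rw [abs_mul]
    exact mul_le_mul (abs_le_sqrt_one_add_sq a) (abs_le_sqrt_one_add_sq b) (abs_nonneg _)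
      (by linarith)
  have hpos : 0 < A * B + (1 + a * b) := by linarith [(abs_le.1 hAb).1]
  have hMA := hle a ha
  have hMB := hle b hb
  rw [← hA] at hMA
  rw [← hB] at hMB
  have hAB : A * B ≤ (1 + M) ^ 2 := by nlinarith
  have hup : A * B + (1 + a * b) ≤ 2 * (1 + M) ^ 2 := by
    have h3 : |a * b| ≤ M * M := by
      rw [abs_mul]; exact mul_le_mul ha hb (abs_nonneg _) hM
    nlinarith [(abs_le.1 h3).2]
  have e : B - A - tiltFn a * (b - a) = (A * B - (1 + a * b)) / A := by
    rw [tiltFn, ← hA]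
    field_simp
    nlinarith
  rw [e, div_le_div_iff₀ (by positivity) (by linarith), ← key]
  have hnn : 0 ≤ A * B - (1 + a * b) := by
    have := sq_nonneg (b - a)
    rw [← key] at this
    exact nonneg_of_mul_nonneg_left this hpos
  have : (A * B + (1 + a * b)) * A ≤ 2 * (1 + M) ^ 3 := by
    calc _ ≤ (2 * (1 + M) ^ 2) * (1 + M) := by
          apply mul_le_mul hup hMA (by linarith) (by positivity)
      _ = _ := by ring
  calc _ = (A * B - (1 + a * b)) * ((A * B + (1 + a * b)) * A) := by ring
    _ ≤ _ := by gcongr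

theorem sqrt_one_add_sq_tangent (a b : ℝ) :
    0 ≤ √(1 + b ^ 2) - √(1 + a ^ 2) - tiltFn a * (b - a) := by
  have := sqrt_one_add_sq_convex (M := |a| + |b|) (a := a) (b := b) (by positivity)
    (by linarith [abs_nonneg b]) (by linarith [abs_nonneg a])
  exact le_trans (by positivity) this

/-- A smooth triangular wave, with kinks of width `δ`. -/
noncomputable def waveFn (δ θ : ℝ) : ℝ := Real.arcsin (Real.cos θ / √(1 + δ ^ 2))

/-- The derivative of `waveFn δ`. -/
noncomputable def waveDeriv (δ θ : ℝ) : ℝ := -tiltFn (Real.sin θ / δ)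

/-- With R² = 1 + δ² one has 1 - cos²θ/R² = (δ² + sin²θ)/R², so the slope is -sin θ/√(δ² + sin²θ): a
square wave of values ±1 smoothed where |sin θ| is of order δ. -/
theorem hasDerivAt_waveFn {δ : ℝ} (hδ : 0 < δ) (θ : ℝ) :
    HasDerivAt (waveFn δ) (waveDeriv δ θ) θ := by
  set R := √(1 + δ ^ 2) with hR
  have hR1 : 1 < R := by
    rw [hR, Real.lt_sqrt (by norm_num)]; nlinarith [pow_pos hδ 2]
  have hR2 : R ^ 2 = 1 + δ ^ 2 := sq_sqrt_one_add_sq δ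
  have hc : |Real.cos θ / R| < 1 := by
    rw [abs_div, abs_of_pos (by linarith : 0 < R), div_lt_one (by linarith)]
    linarith [Real.abs_cos_le_one θ]
  have h := (Real.hasDerivAt_arcsin (x := Real.cos θ / R) (by linarith [(abs_lt.1 hc).1])
    (by linarith [(abs_lt.1 hc).2])).comp θ ((Real.hasDerivAt_cos θ).div_const R)
  refine h.congr_deriv ?_
  rw [waveDeriv, tiltFn]
  have e1 : 1 - (Real.cos θ / R) ^ 2 = (δ ^ 2 + Real.sin θ ^ 2) / R ^ 2 := by
    rw [div_pow, eq_div_iff (by positivity), sub_mul, div_mul_cancel₀ _ (by positivity), hR2]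
    nlinarith [Real.sin_sq_add_cos_sq θ]
  have e2 : 1 + (Real.sin θ / δ) ^ 2 = (δ ^ 2 + Real.sin θ ^ 2) / δ ^ 2 := by
    field_simp
  have hp : 0 < δ ^ 2 + Real.sin θ ^ 2 := by positivity
  rw [e1, e2, Real.sqrt_div hp.le, Real.sqrt_div hp.le, Real.sqrt_sq (by linarith),
    Real.sqrt_sq hδ.le]
  have := Real.sqrt_pos.2 hp
  field_simp

theorem waveFn_taylor {δ : ℝ} (hδ : 0 < δ) : HasTaylor (waveFn δ) (waveDeriv δ) (1 / δ) := by
  refine HasTaylor.of_deriv (hasDerivAt_waveFn hδ)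
    (u'' := fun θ => -(tiltDeriv (Real.sin θ / δ) * (Real.cos θ / δ))) (fun θ => ?_) fun θ => ?_
  · exact ((hasDerivAt_tiltFn _).comp θ ((Real.hasDerivAt_sin θ).div_const δ)).neg
  · rw [abs_neg, abs_mul, abs_div, abs_of_pos hδ]
    calc _ ≤ 1 * (1 / δ) := by
          gcongr
          · exact abs_tiltDeriv_le _
          · exact Real.abs_cos_le_one θ
      _ = _ := one_mul _

theorem abs_waveFn_le (δ θ : ℝ) : |waveFn δ θ| ≤ 2 := by
  rw [abs_le]
  have := Real.neg_pi_div_two_le_arcsin (Real.cos θ / √(1 + δ ^ 2))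
  have := Real.arcsin_le_pi_div_two (Real.cos θ / √(1 + δ ^ 2))
  have := Real.pi_le_four
  unfold waveFn
  constructor <;> linarith

theorem abs_waveDeriv_le (δ θ : ℝ) : |waveDeriv δ θ| ≤ 1 := by
  rw [waveDeriv, abs_neg]; exact abs_tiltFn_le _

/-- Away from the kinks the argument of `tiltFn` is at least 1 in absolute value, so the slope is at
least 1/√2 > 2/3. -/
theorem le_abs_waveDeriv {δ θ : ℝ} (hδ : 0 < δ) (h : δ ≤ |Real.sin θ|) :
    2 / 3 ≤ |waveDeriv δ θ| := by
  set y := Real.sin θ / δ with hy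
  have h1 : 1 ≤ |y| := by
    rw [hy, abs_div, abs_of_pos hδ, le_div_iff₀ hδ]; linarith
  have hp := one_le_sqrt_one_add_sq y
  rw [waveDeriv, abs_neg, tiltFn, abs_div, abs_of_pos (by linarith : 0 < √(1 + y ^ 2)),
    div_le_div_iff₀ (by norm_num) (by linarith)]
  have : 2 * √(1 + y ^ 2) ≤ 3 * |y| := by
    refine (sq_le_sq₀ (by positivity) (by positivity)).1 ?_
    rw [mul_pow, sq_sqrt_one_add_sq, mul_pow, sq_abs]
    nlinarith [sq_abs y]
  linarith

/-! ### Linear forms and functions with Lipschitz gradient. -/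

/-- The linear form with coefficients `p`. -/
def linForm {n : ℕ} (p : Fin n → ℝ) (h : RSpace n) : ℝ := ∑ i, p i * h i

theorem abs_apply_le_norm {n : ℕ} (h : RSpace n) (i : Fin n) : |h i| ≤ ‖h‖ := by
  simpa using PiLp.norm_apply_le h i

theorem norm_le_sum_abs {n : ℕ} (h : RSpace n) : ‖h‖ ≤ ∑ i, |h i| := by
  rw [EuclideanSpace.norm_eq]
  refine Real.sqrt_le_iff.2 ⟨Finset.sum_nonneg fun _ _ => abs_nonneg _, ?_⟩
  simpa using Finset.sum_sq_le_sq_sum_of_nonneg (s := Finset.univ) (f := fun i => |h i|)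
    (fun _ _ => abs_nonneg _)

theorem linForm_add_left {n : ℕ} (p q : Fin n → ℝ) (h : RSpace n) :
    linForm (p + q) h = linForm p h + linForm q h := by
  simp [linForm, add_mul, Finset.sum_add_distrib]

theorem linForm_smul_left {n : ℕ} (c : ℝ) (p : Fin n → ℝ) (h : RSpace n) :
    linForm (c • p) h = c * linForm p h := by
  simp [linForm, mul_assoc, Finset.mul_sum]

theorem linForm_sub_left {n : ℕ} (p q : Fin n → ℝ) (h : RSpace n) :
    linForm (p - q) h = linForm p h - linForm q h := by
  simp [linForm, sub_mul, Finset.sum_sub_distrib]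

theorem linForm_sum_left {n : ℕ} {ι : Type*} (s : Finset ι) (p : ι → Fin n → ℝ) (h : RSpace n) :
    linForm (∑ j ∈ s, p j) h = ∑ j ∈ s, linForm (p j) h := by
  simp only [linForm, Finset.sum_apply, Finset.sum_mul]
  exact Finset.sum_comm

theorem linForm_single_left {n : ℕ} (i : Fin n) (c : ℝ) (h : RSpace n) :
    linForm (Pi.single i c) h = c * h i := by
  simp [linForm, Pi.single_apply, ite_mul]

theorem linForm_smul_right {n : ℕ} (c : ℝ) (p : Fin n → ℝ) (h : RSpace n) :
    linForm p (c • h) = c * linForm p h := by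
  simp only [linForm, PiLp.smul_apply, smul_eq_mul, Finset.mul_sum]
  exact Finset.sum_congr rfl fun _ _ => by ring

theorem linForm_single_right {n : ℕ} (p : Fin n → ℝ) (i : Fin n) (c : ℝ) :
    linForm p (EuclideanSpace.single i c) = p i * c := by
  simp [linForm]

theorem abs_linForm_le {n : ℕ} {p : Fin n → ℝ} {A : ℝ} (hp : ∀ i, |p i| ≤ A) (h : RSpace n) :
    |linForm p h| ≤ n * A * ‖h‖ := by
  calc |linForm p h| ≤ ∑ i, |p i * h i| := Finset.abs_sum_le_sum_abs _ _
    _ ≤ ∑ _i : Fin n, A * ‖h‖ := by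
        refine Finset.sum_le_sum fun i _ => ?_
        rw [abs_mul]
        exact mul_le_mul (hp i) (abs_apply_le_norm h i) (abs_nonneg _) ((abs_nonneg _).trans (hp i))
    _ = n * A * ‖h‖ := by simp [mul_assoc]

/-- `p` is the gradient of `u`, bounded by `A` in each coordinate, and the first order Taylor
expansion of `u` has a remainder bounded by `B ‖h‖ ^ 2`. -/
structure IsJet {n : ℕ} (u : RSpace n → ℝ) (p : RSpace n → Fin n → ℝ) (A B : ℝ) : Prop where
  bound : ∀ x i, |p x i| ≤ A
  taylor : ∀ x h, |u (x + h) - u x - linForm (p x) h| ≤ B * ‖h‖ ^ 2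

theorem lipschitz_of_local_taylor {n : ℕ} {u : RSpace n → ℝ} {p : RSpace n → Fin n → ℝ}
    {A B τ : ℝ} (hτ : 0 < τ) (hA : ∀ x i, |p x i| ≤ A)
    (hT : ∀ x h, ‖h‖ ≤ τ → |u (x + h) - u x - linForm (p x) h| ≤ B * ‖h‖ ^ 2) (x h : RSpace n) :
    |u (x + h) - u x| ≤ n * A * ‖h‖ := by
  rcases eq_or_ne h 0 with rfl | hh
  · simp
  have hpos : 0 < ‖h‖ := norm_pos_iff.2 hh
  have hd : ∀ t : ℝ, HasDerivAt (fun t : ℝ => u (x + t • h)) (linForm (p (x + t • h)) h) t := by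
    intro t
    refine HasTaylor.hasDerivAt_of_local (B := B * ‖h‖ ^ 2) (τ := τ / ‖h‖) (by positivity) ?_
    intro s hs
    have := hT (x + t • h) (s • h) (by
      rw [norm_smul, Real.norm_eq_abs]
      rwa [le_div_iff₀ hpos] at hs)
    rw [linForm_smul_right, norm_smul, Real.norm_eq_abs, mul_pow, sq_abs, add_assoc,
      ← add_smul, mul_comm s] at this
    linarith
  have := Convex.norm_image_sub_le_of_norm_hasDerivWithin_le (f := fun t : ℝ => u (x + t • h))
      (f' := fun t => linForm (p (x + t • h)) h) (s := Set.univ)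
      (C := n * A * ‖h‖) (x := 0) (y := 1) (fun t _ => (hd t).hasDerivWithinAt)
      (fun t _ => abs_linForm_le (hA _) h) convex_univ (Set.mem_univ _) (Set.mem_univ _)
  simpa [Real.norm_eq_abs] using this

theorem IsJet.lipschitz {n : ℕ} {u : RSpace n → ℝ} {p : RSpace n → Fin n → ℝ} {A B : ℝ}
    (hu : IsJet u p A B) (x h : RSpace n) : |u (x + h) - u x| ≤ n * A * ‖h‖ :=
  lipschitz_of_local_taylor one_pos hu.bound (fun x h _ => hu.taylor x h) x h

/-- Beyond the radius τ the crude Lipschitz bound 2nA‖h‖ is already at most Bτ‖h‖ ≤ B‖h‖². A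
periodised function thus needs expanding only over distances short compared with its period. -/
theorem IsJet.of_local {n : ℕ} {u : RSpace n → ℝ} {p : RSpace n → Fin n → ℝ}
    {A B τ : ℝ} (hτ : 0 < τ) (hA0 : 0 ≤ A) (hA : ∀ x i, |p x i| ≤ A)
    (hT : ∀ x h, ‖h‖ ≤ τ → |u (x + h) - u x - linForm (p x) h| ≤ B * ‖h‖ ^ 2)
    (hB : 2 * n * A ≤ B * τ) : IsJet u p A B := by
  refine ⟨hA, fun x h => ?_⟩
  rcases le_total ‖h‖ τ with hh | hh
  · exact hT x h hh
  have h1 := lipschitz_of_local_taylor hτ hA hT x h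
  have h2 := abs_linForm_le (hA x) h
  have hB0 : 0 ≤ B := by
    have : 0 ≤ 2 * n * A := by positivity
    exact nonneg_of_mul_nonneg_left (this.trans hB) hτ
  calc |u (x + h) - u x - linForm (p x) h| ≤ |u (x + h) - u x| + |linForm (p x) h| := abs_sub _ _
    _ ≤ 2 * n * A * ‖h‖ := by linarith
    _ ≤ B * τ * ‖h‖ := by gcongr
    _ ≤ B * ‖h‖ * ‖h‖ := by gcongr
    _ = B * ‖h‖ ^ 2 := by ring

theorem IsJet.add {n : ℕ} {u v : RSpace n → ℝ} {p q : RSpace n → Fin n → ℝ} {A B A' B' : ℝ}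
    (hu : IsJet u p A B) (hv : IsJet v q A' B') :
    IsJet (fun x => u x + v x) (fun x => p x + q x) (A + A') (B + B') := by
  refine ⟨fun x i => (abs_add_le _ _).trans (add_le_add (hu.bound x i) (hv.bound x i)),
    fun x h => ?_⟩
  rw [linForm_add_left]
  have h1 := abs_le.1 (hu.taylor x h)
  have h2 := abs_le.1 (hv.taylor x h)
  rw [abs_le]
  constructor <;> linarith [h1.1, h1.2, h2.1, h2.2]

theorem IsJet.mono {n : ℕ} {u : RSpace n → ℝ} {p : RSpace n → Fin n → ℝ} {A B A' B' : ℝ}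
    (hu : IsJet u p A B) (hA : A ≤ A') (hB : B ≤ B') : IsJet u p A' B' :=
  ⟨fun x i => (hu.bound x i).trans hA, fun x h => (hu.taylor x h).trans (by gcongr)⟩

theorem IsJet.secondDiff_le {n : ℕ} {u : RSpace n → ℝ} {p : RSpace n → Fin n → ℝ} {A B : ℝ}
    (hu : IsJet u p A B) (x h : RSpace n) : |secondDiff u x h| ≤ 2 * B * ‖h‖ ^ 2 := by
  have h1 := abs_le.1 (hu.taylor x h)
  have h2 := abs_le.1 (hu.taylor x (-h))
  have e : linForm (p x) (-h) = -linForm (p x) h := by simp [linForm]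
  rw [e, norm_neg, ← sub_eq_add_neg] at h2
  rw [secondDiff, abs_le]
  constructor <;> linarith [h1.1, h1.2, h2.1, h2.2]

/-! ### Difference quotients and tilts -/

/-- The difference quotient of `f` with step `r` in the direction of the coordinate `j`. -/
noncomputable def slopeFn {n : ℕ} (f : RSpace n → ℝ) (r : ℝ) (j : Fin n) (x : RSpace n) : ℝ :=
  (f (x + EuclideanSpace.single j r) - f x) / r

/-- The gradient of `slopeFn f r j`, when `p` is the gradient of `f`. -/
noncomputable def slopeGrad {n : ℕ} (p : RSpace n → Fin n → ℝ) (r : ℝ) (j : Fin n)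
    (x : RSpace n) : Fin n → ℝ :=
  (1 / r) • (p (x + EuclideanSpace.single j r) - p x)

/-- A partial derivative of f is only Lipschitz and has no jet of its own. Its difference quotient
has one, at the cost of a factor 2/r, which is why the tilts are built from difference quotients. -/
theorem IsJet.slope {n : ℕ} {f : RSpace n → ℝ} {p : RSpace n → Fin n → ℝ} {A B r : ℝ}
    (hf : IsJet f p A B) (hr : 0 < r) (j : Fin n) :
    IsJet (slopeFn f r j) (slopeGrad p r j) (2 * A / r) (2 * B / r) := by
  refine ⟨fun x i => ?_, fun x h => ?_⟩
  · have h1 := hf.bound (x + EuclideanSpace.single j r) i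
    have h2 := hf.bound x i
    simp only [slopeGrad, Pi.smul_apply, Pi.sub_apply, smul_eq_mul, abs_mul, abs_div, abs_one,
      abs_of_pos hr]
    rw [one_div, inv_mul_eq_div]
    gcongr
    exact (abs_sub _ _).trans (by linarith)
  · have h1 := abs_le.1 (hf.taylor (x + EuclideanSpace.single j r) h)
    have h2 := abs_le.1 (hf.taylor x h)
    rw [add_right_comm] at h1
    have e : slopeFn f r j (x + h) - slopeFn f r j x - linForm (slopeGrad p r j x) h
        = ((f (x + h + EuclideanSpace.single j r) - f (x + EuclideanSpace.single j r)
            - linForm (p (x + EuclideanSpace.single j r)) h)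
          - (f (x + h) - f x - linForm (p x) h)) / r := by
      rw [slopeGrad, linForm_smul_left, linForm_sub_left, slopeFn, slopeFn]
      field_simp
      ring
    rw [e, abs_div, abs_of_pos hr, div_mul_eq_mul_div]
    gcongr
    rw [abs_le]
    constructor <;> linarith [h1.1, h1.2, h2.1, h2.2]

theorem IsJet.abs_slope_sub_le {n : ℕ} {f : RSpace n → ℝ} {p : RSpace n → Fin n → ℝ} {A B r : ℝ}
    (hf : IsJet f p A B) (hr : 0 < r) (j : Fin n) (x : RSpace n) :
    |slopeFn f r j x - p x j| ≤ B * r := by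
  have h := hf.taylor x (EuclideanSpace.single j r)
  rw [linForm_single_right] at h
  have e : slopeFn f r j x - p x j
      = (f (x + EuclideanSpace.single j r) - f x - p x j * r) / r := by
    rw [slopeFn]; field_simp
  rw [e, abs_div, abs_of_pos hr, div_le_iff₀ hr]
  refine h.trans (le_of_eq ?_)
  simp
  ring

theorem HasTaylor.comp_jet {n : ℕ} {u : RSpace n → ℝ} {p : RSpace n → Fin n → ℝ} {A B : ℝ}
    {φ φ' : ℝ → ℝ} {C : ℝ} (hφ : HasTaylor φ φ' C) (hC : 0 ≤ C) (hD : ∀ s, |φ' s| ≤ 1)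
    (hu : IsJet u p A B) :
    IsJet (fun x => φ (u x)) (fun x => φ' (u x) • p x) A (B + C * (n * A) ^ 2) := by
  refine ⟨fun x i => ?_, fun x h => ?_⟩
  · rw [Pi.smul_apply, smul_eq_mul, abs_mul]
    nlinarith [hu.bound x i, hD (u x), abs_nonneg (p x i), abs_nonneg (φ' (u x))]
  · rw [linForm_smul_left]
    have := hφ.comp_bound hC (hD (u x)) (hu.taylor x h) (hu.lipschitz x h)
    rwa [one_mul] at this

/-! ### One step of the construction -/

/-- The tilt of the `j`-th wave: a regularised value of `tiltFn (∂_j f)`. -/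
noncomputable def tiltAt {e : ℕ} (f : RSpace (e + 1) → ℝ) (a Ω : ℝ) (j : Fin e)
    (x : RSpace (e + 1)) : ℝ :=
  tiltFn (slopeFn f (1 / (a * Ω)) j.succ x)

/-- The gradient of `tiltAt f a Ω j`. -/
noncomputable def tiltGrad {e : ℕ} (f : RSpace (e + 1) → ℝ) (p : RSpace (e + 1) → Fin (e + 1) → ℝ)
    (a Ω : ℝ) (j : Fin e) (x : RSpace (e + 1)) : Fin (e + 1) → ℝ :=
  tiltDeriv (slopeFn f (1 / (a * Ω)) j.succ x) • slopeGrad p (1 / (a * Ω)) j.succ x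

/-- The phase of the `j`-th wave, `v` being the position inside a slab. -/
noncomputable def phaseAt {e : ℕ} (f : RSpace (e + 1) → ℝ) (a Ω v : ℝ) (j : Fin e)
    (x : RSpace (e + 1)) : ℝ :=
  a ^ 3 * (a ^ 3 * Ω * x j.succ - tiltAt f a Ω j x * v)

/-- The superposition of the waves. -/
noncomputable def waveSum {e : ℕ} (f : RSpace (e + 1) → ℝ) (a Ω δ v : ℝ)
    (x : RSpace (e + 1)) : ℝ :=
  ∑ j : Fin e, waveFn δ (phaseAt f a Ω v j x)

/-- The profile of the perturbation inside a slab. -/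
noncomputable def blockFn {e : ℕ} (f : RSpace (e + 1) → ℝ) (a Ω δ v : ℝ)
    (x : RSpace (e + 1)) : ℝ :=
  sawFn a v + cutFn a v * waveSum f a Ω δ v x / a ^ 3

/-- The perturbation added to `f`. -/
noncomputable def stepFn {e : ℕ} (f : RSpace (e + 1) → ℝ) (a Ω ε δ : ℝ)
    (x : RSpace (e + 1)) : ℝ :=
  ε / (a ^ 3 * Ω) * blockFn f a Ω δ (Int.fract (a ^ 3 * Ω * x 0)) x

/-- The gradient of `stepFn f a Ω ε δ`. -/
noncomputable def stepGrad {e : ℕ} (f : RSpace (e + 1) → ℝ) (p : RSpace (e + 1) → Fin (e + 1) → ℝ)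
    (a Ω ε δ : ℝ) (x : RSpace (e + 1)) : Fin (e + 1) → ℝ :=
  ε • (Pi.single 0 (sawDeriv a (Int.fract (a ^ 3 * Ω * x 0)) +
        cutDeriv a (Int.fract (a ^ 3 * Ω * x 0)) *
          waveSum f a Ω δ (Int.fract (a ^ 3 * Ω * x 0)) x / a ^ 3) +
      cutFn a (Int.fract (a ^ 3 * Ω * x 0)) •
        ∑ j : Fin e, waveDeriv δ (phaseAt f a Ω (Int.fract (a ^ 3 * Ω * x 0)) j x) •
          (Pi.single j.succ 1 - Pi.single 0 (tiltAt f a Ω j x) -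
            (Int.fract (a ^ 3 * Ω * x 0) / (a ^ 3 * Ω)) • tiltGrad f p a Ω j x))

/-- The hypotheses on the parameters of a step. -/
structure StepHyp {e : ℕ} (f : RSpace (e + 1) → ℝ) (p : RSpace (e + 1) → Fin (e + 1) → ℝ)
    (a Ω ε δ : ℝ) : Prop where
  large : 1000 * ((e : ℝ) + 1) ^ 2 ≤ a
  omega_pos : 0 < Ω
  eps_nonneg : 0 ≤ ε
  eps_le : ε ≤ 1
  delta_pos : 0 < δ
  delta_le : δ ≤ 1
  jet : IsJet f p a Ω

/-! ### Size and smoothness of the perturbation. -/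

namespace StepHyp

variable {e : ℕ} {f : RSpace (e + 1) → ℝ} {p : RSpace (e + 1) → Fin (e + 1) → ℝ} {a Ω ε δ : ℝ}

theorem large' (H : StepHyp f p a Ω ε δ) : 1000 * ((e : ℝ) + 1) ≤ a := by
  have h := H.large
  have : (0 : ℝ) ≤ e := Nat.cast_nonneg e
  nlinarith

theorem thousand_le (H : StepHyp f p a Ω ε δ) : 1000 ≤ a := by
  have h := H.large'
  have : (0 : ℝ) ≤ e := Nat.cast_nonneg e
  linarith

theorem a_pos (H : StepHyp f p a Ω ε δ) : 0 < a := by linarith [H.thousand_le]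

/-- The quotient step r = 1/(aΩ) balances two demands: the error Ωr = 1/a in the tilt is small, and
the gradient bound 2a/r = 2a²Ω stays a factor of order a below the slab frequency a³Ω, so the tilt
is almost constant across a slab. -/
theorem tilt_jet (H : StepHyp f p a Ω ε δ) (j : Fin e) :
    IsJet (tiltAt f a Ω j) (tiltGrad f p a Ω j) (2 * a ^ 2 * Ω) (a ^ 6 * Ω ^ 2 / 2) := by
  have ha := H.a_pos
  have hΩ := H.omega_pos
  have h1 := H.jet.slope (r := 1 / (a * Ω)) (by positivity) j.succ
  have h2 := tiltFn_taylor.comp_jet (by norm_num) abs_tiltDeriv_le h1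
  refine h2.mono (le_of_eq (by field_simp)) ?_
  have e1 : 2 * Ω / (1 / (a * Ω)) + 3 * (((e + 1 : ℕ) : ℝ) * (2 * a / (1 / (a * Ω)))) ^ 2
      = (2 * a + 12 * ((e : ℝ) + 1) ^ 2 * a ^ 4) * Ω ^ 2 := by
    push_cast
    field_simp
    ring
  rw [e1, mul_div_right_comm]
  refine mul_le_mul_of_nonneg_right ?_ (by positivity)
  have h1000 := H.thousand_le
  have b1 : 12 * ((e : ℝ) + 1) ^ 2 * a ^ 4 ≤ a * a ^ 4 := by
    refine mul_le_mul_of_nonneg_right ?_ (by positivity)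
    have := H.large
    nlinarith [sq_nonneg ((e : ℝ) + 1)]
  have b2 : 2 * a ≤ a ^ 5 := by
    have : a ^ 1 ≤ a ^ 4 := pow_le_pow_right₀ (by linarith) (by norm_num)
    nlinarith [pow_pos ha 4]
  have b3 : 1000 * a ^ 5 ≤ a ^ 6 := by
    rw [pow_succ a 5, mul_comm]
    exact mul_le_mul_of_nonneg_left h1000 (by positivity)
  nlinarith [pow_pos ha 5]

theorem tilt_lipschitz (H : StepHyp f p a Ω ε δ) (j : Fin e) (x h : RSpace (e + 1)) :
    |tiltAt f a Ω j (x + h) - tiltAt f a Ω j x| ≤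
      2 * ((e : ℝ) + 1) / a * (a ^ 3 * Ω * ‖h‖) := by
  have ha := H.a_pos
  refine ((H.tilt_jet j).lipschitz x h).trans (le_of_eq ?_)
  push_cast
  field_simp

theorem tilt_lipschitz' (H : StepHyp f p a Ω ε δ) (j : Fin e) (x h : RSpace (e + 1)) :
    |tiltAt f a Ω j (x + h) - tiltAt f a Ω j x| ≤ 1 * (a ^ 3 * Ω * ‖h‖) := by
  have ha := H.a_pos
  have hΩ := H.omega_pos
  refine (H.tilt_lipschitz j x h).trans (mul_le_mul_of_nonneg_right ?_ (by positivity))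
  rw [div_le_one ha]
  have h0 : (0 : ℝ) ≤ e := Nat.cast_nonneg e
  linarith [H.large']

theorem tilt_taylor (H : StepHyp f p a Ω ε δ) (j : Fin e) (x h : RSpace (e + 1)) :
    |tiltAt f a Ω j (x + h) - tiltAt f a Ω j x - linForm (tiltGrad f p a Ω j x) h| ≤
      1 * (a ^ 3 * Ω * ‖h‖) ^ 2 := by
  refine ((H.tilt_jet j).taylor x h).trans ?_
  have ha := H.a_pos
  have : 0 ≤ a ^ 6 * Ω ^ 2 * ‖h‖ ^ 2 := by positivity
  nlinarith

theorem abs_waveSum_le (f : RSpace (e + 1) → ℝ) (a Ω δ v : ℝ) (x : RSpace (e + 1)) :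
    |waveSum f a Ω δ v x| ≤ 2 * e := by
  refine (Finset.abs_sum_le_sum_abs _ _).trans ?_
  refine (Finset.sum_le_sum fun j _ => abs_waveFn_le _ _).trans (le_of_eq ?_)
  simp [mul_comm]

theorem linForm_stepGrad (f : RSpace (e + 1) → ℝ) (p : RSpace (e + 1) → Fin (e + 1) → ℝ)
    (a Ω ε δ v : ℝ) (x h : RSpace (e + 1)) (hv : v = Int.fract (a ^ 3 * Ω * x 0)) :
    linForm (stepGrad f p a Ω ε δ x) h =
      ε * ((sawDeriv a v + cutDeriv a v * waveSum f a Ω δ v x / a ^ 3) * h 0 +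
        cutFn a v * ∑ j : Fin e, waveDeriv δ (phaseAt f a Ω v j x) *
          (h j.succ - tiltAt f a Ω j x * h 0 -
            v / (a ^ 3 * Ω) * linForm (tiltGrad f p a Ω j x) h)) := by
  subst hv
  simp only [stepGrad, linForm_smul_left, linForm_add_left, linForm_sub_left, linForm_sum_left,
    linForm_single_left, one_mul]

theorem phase_taylor (H : StepHyp f p a Ω ε δ) (j : Fin e) {v : ℝ} (hv0 : 0 ≤ v) (hv1 : v ≤ 1)
    (x h : RSpace (e + 1)) (hh : a ^ 3 * Ω * ‖h‖ ≤ 1) :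
    |phaseAt f a Ω (v + a ^ 3 * Ω * h 0) j (x + h) - phaseAt f a Ω v j x -
      a ^ 3 * (a ^ 3 * Ω * h j.succ - (tiltAt f a Ω j x * (a ^ 3 * Ω * h 0) +
        v * linForm (tiltGrad f p a Ω j x) h))| ≤ 2 * a ^ 3 * (a ^ 3 * Ω * ‖h‖) ^ 2 ∧
    |phaseAt f a Ω (v + a ^ 3 * Ω * h 0) j (x + h) - phaseAt f a Ω v j x| ≤
      4 * a ^ 3 * (a ^ 3 * Ω * ‖h‖) := by
  have ha := H.a_pos
  have hΩ := H.omega_pos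
  have hκ : 0 < a ^ 3 * Ω := by positivity
  set κ := a ^ 3 * Ω with hκd
  have hh0 : ∀ i, |κ * h i| ≤ 1 * (κ * ‖h‖) := fun i => by
    rw [abs_mul, abs_of_pos hκ, one_mul]
    exact mul_le_mul_of_nonneg_left (abs_apply_le_norm h i) hκ.le
  have hv : |v| ≤ 1 := abs_le.2 ⟨by linarith, hv1⟩
  have hv' : |v + κ * h 0| ≤ 2 := by
    refine (abs_add_le _ _).trans ?_
    linarith [hh0 0]
  have T := mul_taylor_bound (H := κ * ‖h‖) (u0 := tiltAt f a Ω j x) (u1 := tiltAt f a Ω j (x + h))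
    (v0 := v) (v1 := v + κ * h 0) (lv := κ * h 0) (Bv := 0) (Au := 1) (Av := 1)
    (abs_tiltFn_le _) hv (H.tilt_taylor j x h) (by simp) (H.tilt_lipschitz' j x h)
    (by rw [add_sub_cancel_left]; exact hh0 0)
  have L := mul_lip_bound (H := κ * ‖h‖) (u0 := tiltAt f a Ω j x) (u1 := tiltAt f a Ω j (x + h))
    (v0 := v) (v1 := v + κ * h 0) (Au := 1) (Av := 1)
    (abs_tiltFn_le _) hv' (H.tilt_lipschitz' j x h)
    (by rw [add_sub_cancel_left]; exact hh0 0)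
  constructor
  · have e1 : phaseAt f a Ω (v + κ * h 0) j (x + h) - phaseAt f a Ω v j x -
      a ^ 3 * (κ * h j.succ - (tiltAt f a Ω j x * (κ * h 0) +
        v * linForm (tiltGrad f p a Ω j x) h)) =
      -(a ^ 3 * (tiltAt f a Ω j (x + h) * (v + κ * h 0) - tiltAt f a Ω j x * v -
        (tiltAt f a Ω j x * (κ * h 0) + v * linForm (tiltGrad f p a Ω j x) h))) := by
      simp only [phaseAt, PiLp.add_apply, ← hκd]
      ring
    rw [e1, abs_neg, abs_mul, abs_of_pos (by positivity : 0 < a ^ 3)]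
    calc _ ≤ a ^ 3 * ((1 * 0 + 1 * 1 + 1 * 1) * (κ * ‖h‖) ^ 2) := by gcongr
      _ = _ := by ring
  · have e1 : phaseAt f a Ω (v + κ * h 0) j (x + h) - phaseAt f a Ω v j x =
      a ^ 3 * (κ * h j.succ - (tiltAt f a Ω j (x + h) * (v + κ * h 0) - tiltAt f a Ω j x * v)) := by
      simp only [phaseAt, PiLp.add_apply, ← hκd]
      ring
    rw [e1, abs_mul, abs_of_pos (by positivity : 0 < a ^ 3)]
    have := abs_sub (κ * h j.succ) (tiltAt f a Ω j (x + h) * (v + κ * h 0) - tiltAt f a Ω j x * v)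
    have h2 := hh0 j.succ
    calc _ ≤ a ^ 3 * (4 * (κ * ‖h‖)) := by gcongr; linarith
      _ = _ := by ring

theorem waveSum_taylor (H : StepHyp f p a Ω ε δ) {v : ℝ} (hv0 : 0 ≤ v) (hv1 : v ≤ 1)
    (x h : RSpace (e + 1)) (hh : a ^ 3 * Ω * ‖h‖ ≤ 1) :
    |waveSum f a Ω δ (v + a ^ 3 * Ω * h 0) (x + h) - waveSum f a Ω δ v x -
      ∑ j : Fin e, waveDeriv δ (phaseAt f a Ω v j x) *
        (a ^ 3 * (a ^ 3 * Ω * h j.succ - (tiltAt f a Ω j x * (a ^ 3 * Ω * h 0) +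
        v * linForm (tiltGrad f p a Ω j x) h)))| ≤
      (e * (18 * a ^ 6 / δ)) * (a ^ 3 * Ω * ‖h‖) ^ 2 ∧
    |waveSum f a Ω δ (v + a ^ 3 * Ω * h 0) (x + h) - waveSum f a Ω δ v x| ≤
      (e * (4 * a ^ 3)) * (a ^ 3 * Ω * ‖h‖) := by
  have ha := H.a_pos
  have ha1 : 1 ≤ a := by linarith [H.thousand_le]
  have hδ := H.delta_pos
  have hΩ := H.omega_pos
  constructor
  · rw [waveSum, waveSum, ← Finset.sum_sub_distrib, ← Finset.sum_sub_distrib]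
    refine (Finset.abs_sum_le_sum_abs _ _).trans ?_
    have : ∀ j ∈ Finset.univ, _ ≤ 18 * a ^ 6 / δ * (a ^ 3 * Ω * ‖h‖) ^ 2 :=
      fun (j : Fin e) _ => by
        have h1 := H.phase_taylor j hv0 hv1 x h hh
        have h2 := (waveFn_taylor hδ).comp_bound (by positivity) (abs_waveDeriv_le δ _) h1.1 h1.2
        refine h2.trans (mul_le_mul_of_nonneg_right ?_ (by positivity))
        have h3 : a ^ 3 ≤ a ^ 6 / δ := by
          rw [le_div_iff₀ hδ]
          calc a ^ 3 * δ ≤ a ^ 3 * 1 := by gcongr; exact H.delta_le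
            _ ≤ a ^ 6 := by rw [mul_one]; exact pow_le_pow_right₀ ha1 (by norm_num)
        have h4 : 1 / δ * (4 * a ^ 3) ^ 2 = 16 * (a ^ 6 / δ) := by ring
        have h5 : 18 * a ^ 6 / δ = 18 * (a ^ 6 / δ) := by ring
        rw [h4, h5]
        linarith
    refine (Finset.sum_le_sum this).trans (le_of_eq ?_)
    simp only [Finset.sum_const, Finset.card_univ, Fintype.card_fin, nsmul_eq_mul]
    ring
  · rw [waveSum, waveSum, ← Finset.sum_sub_distrib]
    refine (Finset.abs_sum_le_sum_abs _ _).trans ?_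
    refine (Finset.sum_le_sum (g := fun _ => 4 * a ^ 3 * (a ^ 3 * Ω * ‖h‖))
      fun j _ => ?_).trans (le_of_eq ?_)
    · have h1 := (H.phase_taylor j hv0 hv1 x h hh).2
      have h2 := (waveFn_taylor hδ).lipschitz (abs_waveDeriv_le δ) (phaseAt f a Ω v j x)
        (phaseAt f a Ω (v + a ^ 3 * Ω * h 0) j (x + h) - phaseAt f a Ω v j x)
      rw [add_sub_cancel, one_mul] at h2
      exact h2.trans h1
    simp only [Finset.sum_const, Finset.card_univ, Fintype.card_fin, nsmul_eq_mul]
    ring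

/-- Near a slab boundary the cutoff kills the waves, and the saw is 3v on one side and 3(v - 1) on
the other. The profile therefore continues across the boundary by the same formula, and the jump of
the fractional part is invisible. -/
theorem block_fract (ha : 100 ≤ a) (f : RSpace (e + 1) → ℝ) (Ω δ : ℝ) (x : RSpace (e + 1))
    {v : ℝ} (h0 : -1 ≤ a * v) (h1 : a * v ≤ a + 1) :
    blockFn f a Ω δ (Int.fract v) x = blockFn f a Ω δ v x := by
  rcases lt_or_ge v 0 with hv | hv
  · have : Int.fract v = v + 1 := by
      rw [Int.fract_eq_iff]
      exact ⟨by nlinarith, by linarith, -1, by push_cast; ring⟩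
    rw [this, blockFn, blockFn, cutFn_eq_zero_left (v := v) (by nlinarith),
      cutFn_eq_zero_right (v := v + 1) (by nlinarith), sawFn_left ha (v := v) (by nlinarith),
      sawFn_right ha (by nlinarith)]
    ring
  rcases lt_or_ge v 1 with hv1 | hv1
  · rw [Int.fract_eq_self.2 ⟨hv, hv1⟩]
  · have : Int.fract v = v - 1 := by
      rw [Int.fract_eq_iff]
      exact ⟨by nlinarith, by nlinarith, 1, by push_cast; ring⟩
    rw [this, blockFn, blockFn, cutFn_eq_zero_left (v := v - 1) (by nlinarith),
      cutFn_eq_zero_right (v := v) (by nlinarith), sawFn_left ha (v := v - 1) (by nlinarith),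
      sawFn_right ha (v := v) (by nlinarith)]
    ring

-- The restriction on h moves the slab coordinate by at most 1/a, so `block_fract` removes the
-- fractional part. The dominant term comes from the waves: amplitude 1/(a⁶Ω), frequency a⁶Ω and
-- kink curvature 1/δ give a⁶Ω/δ.
set_option maxHeartbeats 800000 in
theorem step_taylor_local (H : StepHyp f p a Ω ε δ) (x h : RSpace (e + 1))
    (hh : a ^ 4 * Ω * ‖h‖ ≤ 1) :
    |stepFn f a Ω ε δ (x + h) - stepFn f a Ω ε δ x - linForm (stepGrad f p a Ω ε δ x) h| ≤
      81 * (e + 1) * (a ^ 6 * Ω / δ) * ‖h‖ ^ 2 := by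
  have ha := H.a_pos
  have ha1 := H.thousand_le
  have hδ := H.delta_pos
  have hΩ := H.omega_pos
  have hκ : 0 < a ^ 3 * Ω := by positivity
  have hh' : a * (a ^ 3 * Ω * ‖h‖) ≤ 1 := by linarith
  have hh1 : a ^ 3 * Ω * ‖h‖ ≤ 1 := by
    have : 0 ≤ a ^ 3 * Ω * ‖h‖ := by positivity
    nlinarith
  have hh0 : |a ^ 3 * Ω * h 0| ≤ a ^ 3 * Ω * ‖h‖ := by
    rw [abs_mul, abs_of_pos hκ]
    exact mul_le_mul_of_nonneg_left (abs_apply_le_norm h 0) hκ.le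
  set v := Int.fract (a ^ 3 * Ω * x 0) with hv
  have hv0 : 0 ≤ v := Int.fract_nonneg _
  have hv1 : v < 1 := Int.fract_lt_one _
  have hfr : Int.fract (a ^ 3 * Ω * (x + h) 0) = Int.fract (v + a ^ 3 * Ω * h 0) := by
    rw [Int.fract_eq_fract]
    refine ⟨⌊a ^ 3 * Ω * x 0⌋, ?_⟩
    rw [PiLp.add_apply, hv, Int.fract]
    ring
  have hah : |a * (a ^ 3 * Ω * h 0)| ≤ 1 := by
    rw [abs_mul, abs_of_pos ha]
    exact (mul_le_mul_of_nonneg_left hh0 ha.le).trans hh'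
  have hblock : blockFn f a Ω δ (Int.fract (a ^ 3 * Ω * (x + h) 0)) (x + h)
      = blockFn f a Ω δ (v + a ^ 3 * Ω * h 0) (x + h) := by
    rw [hfr]
    refine block_fract (by linarith) f Ω δ (x + h) ?_ ?_
    · nlinarith [(abs_le.1 hah).1]
    · nlinarith [(abs_le.1 hah).2]
  rw [linForm_stepGrad f p a Ω ε δ v x h hv, stepFn, stepFn, hblock, ← hv]
  have hW := H.waveSum_taylor hv0 hv1.le x h hh1
  have hsaw := sawFn_taylor (by linarith : 100 ≤ a) v (a ^ 3 * Ω * h 0)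
  have hcutT := cutFn_taylor ha v (a ^ 3 * Ω * h 0)
  have hcutL := (cutFn_taylor ha).lipschitz (abs_cutDeriv_le ha) v (a ^ 3 * Ω * h 0)
  set Hh := a ^ 3 * Ω * ‖h‖ with hHh
  have hHn : 0 ≤ Hh := by positivity
  have hsq : (a ^ 3 * Ω * h 0) ^ 2 ≤ Hh ^ 2 := sq_le_sq' (by linarith [(abs_le.1 hh0).1]) (abs_le.1 hh0).2
  have hprod := mul_taylor_bound (H := Hh) (u0 := cutFn a v) (u1 := cutFn a (v + a ^ 3 * Ω * h 0))
    (v0 := waveSum f a Ω δ v x) (v1 := waveSum f a Ω δ (v + a ^ 3 * Ω * h 0) (x + h))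
    (U := 1) (W := 2 * e) (Bu := 20 * a ^ 2) (Au := 4 * a)
    (abs_le.2 ⟨by linarith [(cutFn_mem a v).1], (cutFn_mem a v).2⟩) (abs_waveSum_le f a Ω δ v x)
    (hcutT.trans (by gcongr)) hW.1 (hcutL.trans (by gcongr)) hW.2
  -- The three terms are the curvature of the waves, the curvature of the cutoff and the cross term:
  -- 18 + 40 + 16 = 74.
  have hpb : 1 * ((e : ℝ) * (18 * a ^ 6 / δ)) + 2 * e * (20 * a ^ 2) + 4 * a * (e * (4 * a ^ 3))
      ≤ 74 * e * (a ^ 6 / δ) := by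
    have h6 : ∀ k : ℕ, k ≤ 6 → a ^ k ≤ a ^ 6 / δ := fun k hk => by
      rw [le_div_iff₀ hδ]
      calc a ^ k * δ ≤ a ^ k * 1 := by gcongr; exact H.delta_le
        _ ≤ a ^ 6 := by rw [mul_one]; exact pow_le_pow_right₀ (by linarith) hk
    have he : (0 : ℝ) ≤ e := Nat.cast_nonneg e
    have h2 := mul_le_mul_of_nonneg_left (h6 2 (by norm_num)) he
    have h4 := mul_le_mul_of_nonneg_left (h6 4 (by norm_num)) he
    have : 18 * a ^ 6 / δ = 18 * (a ^ 6 / δ) := by ring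
    rw [this]
    nlinarith
  have hprod' := hprod.trans (mul_le_mul_of_nonneg_right hpb (by positivity))
  set S := ∑ j : Fin e, waveDeriv δ (phaseAt f a Ω v j x) *
        (a ^ 3 * (a ^ 3 * Ω * h j.succ - (tiltAt f a Ω j x * (a ^ 3 * Ω * h 0) +
        v * linForm (tiltGrad f p a Ω j x) h))) with hS
  have hS' : S = a ^ 3 * (a ^ 3 * Ω) * ∑ j : Fin e, waveDeriv δ (phaseAt f a Ω v j x) *
          (h j.succ - tiltAt f a Ω j x * h 0 -
            v / (a ^ 3 * Ω) * linForm (tiltGrad f p a Ω j x) h) := by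
    rw [hS, Finset.mul_sum]
    refine Finset.sum_congr rfl fun j _ => ?_
    field_simp
    ring
  set S' := ∑ j : Fin e, waveDeriv δ (phaseAt f a Ω v j x) *
          (h j.succ - tiltAt f a Ω j x * h 0 -
            v / (a ^ 3 * Ω) * linForm (tiltGrad f p a Ω j x) h)
  have key : ε / (a ^ 3 * Ω) * blockFn f a Ω δ (v + a ^ 3 * Ω * h 0) (x + h) -
        ε / (a ^ 3 * Ω) * blockFn f a Ω δ v x -
        ε * ((sawDeriv a v + cutDeriv a v * waveSum f a Ω δ v x / a ^ 3) * h 0 + cutFn a v * S') =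
      ε / (a ^ 3 * Ω) * ((sawFn a (v + a ^ 3 * Ω * h 0) - sawFn a v
          - sawDeriv a v * (a ^ 3 * Ω * h 0)) +
        (cutFn a (v + a ^ 3 * Ω * h 0) * waveSum f a Ω δ (v + a ^ 3 * Ω * h 0) (x + h)
          - cutFn a v * waveSum f a Ω δ v x
          - (cutFn a v * S + waveSum f a Ω δ v x * (cutDeriv a v * (a ^ 3 * Ω * h 0)))) / a ^ 3) := by
    rw [hS', blockFn, blockFn]
    field_simp
    ring
  rw [key, abs_mul, abs_of_nonneg (div_nonneg H.eps_nonneg hκ.le)]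
  have hin : |(sawFn a (v + a ^ 3 * Ω * h 0) - sawFn a v - sawDeriv a v * (a ^ 3 * Ω * h 0)) +
        (cutFn a (v + a ^ 3 * Ω * h 0) * waveSum f a Ω δ (v + a ^ 3 * Ω * h 0) (x + h)
          - cutFn a v * waveSum f a Ω δ v x
          - (cutFn a v * S + waveSum f a Ω δ v x * (cutDeriv a v * (a ^ 3 * Ω * h 0)))) / a ^ 3| ≤
      81 * (e + 1) * (a ^ 3 / δ) * Hh ^ 2 := by
    refine (abs_add_le _ _).trans ?_
    rw [abs_div, abs_of_pos (by positivity : 0 < a ^ 3)]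
    have b1 := hsaw.trans (mul_le_mul_of_nonneg_left hsq (by positivity))
    have b2 : 7 * a ≤ 7 * (a ^ 3 / δ) := by
      have : a ≤ a ^ 3 / δ := by
        rw [le_div_iff₀ hδ]
        calc a * δ ≤ a * 1 := by gcongr; exact H.delta_le
          _ ≤ a ^ 3 := by rw [mul_one]; exact le_self_pow₀ (by linarith) (by norm_num)
      linarith
    have b3 := b1.trans (mul_le_mul_of_nonneg_right b2 (by positivity))
    have b4 := div_le_div_of_nonneg_right hprod' (by positivity : 0 ≤ a ^ 3)
    have b5 : 74 * (e : ℝ) * (a ^ 6 / δ) * Hh ^ 2 / a ^ 3 = 74 * e * (a ^ 3 / δ) * Hh ^ 2 := by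
      field_simp
    rw [b5] at b4
    have b6 : 0 ≤ (a ^ 3 / δ) * Hh ^ 2 := by positivity
    have b7 : 0 ≤ (e : ℝ) * ((a ^ 3 / δ) * Hh ^ 2) := by positivity
    refine (add_le_add b3 b4).trans ?_
    have b8 : 81 * ((e : ℝ) + 1) * (a ^ 3 / δ) * Hh ^ 2 - (7 * (a ^ 3 / δ) * Hh ^ 2
        + 74 * (e : ℝ) * (a ^ 3 / δ) * Hh ^ 2)
        = 7 * ((e : ℝ) * ((a ^ 3 / δ) * Hh ^ 2)) + 74 * ((a ^ 3 / δ) * Hh ^ 2) := by ring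
    linarith
  calc _ ≤ ε / (a ^ 3 * Ω) * (81 * (e + 1) * (a ^ 3 / δ) * Hh ^ 2) :=
        mul_le_mul_of_nonneg_left hin (div_nonneg H.eps_nonneg hκ.le)
    _ = ε * (81 * (e + 1) * (a ^ 6 * Ω / δ) * ‖h‖ ^ 2) := by
        rw [hHh]; field_simp
    _ ≤ 1 * (81 * (e + 1) * (a ^ 6 * Ω / δ) * ‖h‖ ^ 2) := by
        have := H.eps_le
        gcongr
    _ = _ := one_mul _

end StepHyp

/-! ### Growth of the Lyapunov function in one step. -/

/-- The Lyapunov function of the construction. -/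
noncomputable def lyap {e : ℕ} (p : Fin (e + 1) → ℝ) : ℝ := p 0 + ∑ j : Fin e, √(1 + p j.succ ^ 2)

namespace StepHyp

variable {e : ℕ} {f : RSpace (e + 1) → ℝ} {p : RSpace (e + 1) → Fin (e + 1) → ℝ} {a Ω ε δ : ℝ}

/-- This is the part of the phase gradient due to the variation of the tilt; it is an error of
relative size 1/a. -/
theorem abs_tiltGrad_le (H : StepHyp f p a Ω ε δ) (j : Fin e) (x : RSpace (e + 1))
    (i : Fin (e + 1)) {v : ℝ} (hv0 : 0 ≤ v) (hv1 : v ≤ 1) :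
    |v / (a ^ 3 * Ω) * tiltGrad f p a Ω j x i| ≤ 2 / a := by
  have ha := H.a_pos
  have hΩ := H.omega_pos
  have h := (H.tilt_jet j).bound x i
  rw [abs_mul, abs_of_nonneg (by positivity)]
  calc _ ≤ 1 / (a ^ 3 * Ω) * (2 * a ^ 2 * Ω) := by gcongr
    _ = 2 / a := by field_simp

theorem stepGrad_zero (f : RSpace (e + 1) → ℝ) (p : RSpace (e + 1) → Fin (e + 1) → ℝ)
    (a Ω ε δ v : ℝ) (x : RSpace (e + 1)) (hv : v = Int.fract (a ^ 3 * Ω * x 0)) :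
    stepGrad f p a Ω ε δ x 0 = ε * ((sawDeriv a v + cutDeriv a v * waveSum f a Ω δ v x / a ^ 3) -
        cutFn a v * ∑ j : Fin e, waveDeriv δ (phaseAt f a Ω v j x) *
          (tiltAt f a Ω j x + v / (a ^ 3 * Ω) * tiltGrad f p a Ω j x 0)) := by
  have h := linForm_stepGrad f p a Ω ε δ v x (EuclideanSpace.single 0 1) hv
  rw [linForm_single_right, mul_one] at h
  rw [h]
  simp only [linForm_single_right, PiLp.single_apply, if_true, mul_one,
    Fin.succ_ne_zero, if_false, zero_sub]
  have e1 : ∀ j : Fin e, waveDeriv δ (phaseAt f a Ω v j x) *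
      (-tiltAt f a Ω j x - v / (a ^ 3 * Ω) * tiltGrad f p a Ω j x 0) =
      -(waveDeriv δ (phaseAt f a Ω v j x) *
      (tiltAt f a Ω j x + v / (a ^ 3 * Ω) * tiltGrad f p a Ω j x 0)) := fun j => by ring
  simp only [e1, Finset.sum_neg_distrib]
  ring

theorem stepGrad_succ (f : RSpace (e + 1) → ℝ) (p : RSpace (e + 1) → Fin (e + 1) → ℝ)
    (a Ω ε δ v : ℝ) (x : RSpace (e + 1)) (i : Fin e) (hv : v = Int.fract (a ^ 3 * Ω * x 0)) :
    stepGrad f p a Ω ε δ x i.succ = ε * (cutFn a v * (waveDeriv δ (phaseAt f a Ω v i x) -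
        ∑ j : Fin e, waveDeriv δ (phaseAt f a Ω v j x) *
          (v / (a ^ 3 * Ω) * tiltGrad f p a Ω j x i.succ))) := by
  have h := linForm_stepGrad f p a Ω ε δ v x (EuclideanSpace.single i.succ 1) hv
  rw [linForm_single_right, mul_one] at h
  rw [h]
  simp only [linForm_single_right, PiLp.single_apply, mul_one,
    (Fin.succ_ne_zero i).symm, if_false, mul_zero, zero_add, sub_zero, Fin.succ_inj, mul_sub,
    Finset.sum_sub_distrib, mul_ite, Finset.sum_ite_eq', Finset.mem_univ, if_true]

theorem abs_sum_wave_le {c : ℝ} {δ : ℝ} {θ : Fin e → ℝ} {y : Fin e → ℝ} (hy : ∀ j, |y j| ≤ c) :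
    |∑ j : Fin e, waveDeriv δ (θ j) * y j| ≤ e * c := by
  refine (Finset.abs_sum_le_sum_abs _ _).trans ?_
  refine (Finset.sum_le_sum (g := fun _ => c) fun j _ => ?_).trans (le_of_eq (by simp))
  rw [abs_mul]
  have := mul_le_mul (abs_waveDeriv_le δ (θ j)) (hy j) (abs_nonneg _) zero_le_one
  linarith

theorem abs_cut_wave_le (H : StepHyp f p a Ω ε δ) (v : ℝ) (x : RSpace (e + 1)) :
    |cutDeriv a v * waveSum f a Ω δ v x / a ^ 3| ≤ 8 * e / a := by
  have ha := H.a_pos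
  rw [abs_div, abs_mul, abs_of_pos (by positivity : 0 < a ^ 3)]
  calc _ ≤ (4 * a) * (2 * e) / a ^ 3 := by
        gcongr
        · exact abs_cutDeriv_le ha v
        · exact abs_waveSum_le f a Ω δ v x
    _ = 8 * e / a * (1 / a) := by field_simp; ring
    _ ≤ 8 * e / a * 1 := by
        gcongr
        rw [div_le_one ha]; linarith [H.thousand_le]
    _ = _ := mul_one _

theorem abs_cut_mul_le (a v y : ℝ) : |cutFn a v * y| ≤ |y| := by
  rw [abs_mul, abs_of_nonneg (cutFn_mem a v).1]
  exact mul_le_of_le_one_left (abs_nonneg _) (cutFn_mem a v).2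

theorem abs_stepGrad_le (H : StepHyp f p a Ω ε δ) (x : RSpace (e + 1)) (i : Fin (e + 1)) :
    |stepGrad f p a Ω ε δ x i| ≤ 6 * (e + 1) * ε := by
  have ha := H.a_pos
  have h1000 := H.thousand_le
  have he : (0 : ℝ) ≤ e := Nat.cast_nonneg e
  have hv0 := Int.fract_nonneg (a ^ 3 * Ω * x 0)
  have hv1 := (Int.fract_lt_one (a ^ 3 * Ω * x 0)).le
  have h2a : 2 / a ≤ 1 := by rw [div_le_one ha]; linarith
  have h8 : 8 * (e : ℝ) / a ≤ e := by rw [div_le_iff₀ ha]; nlinarith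
  refine Fin.cases ?_ (fun i => ?_) i
  · rw [stepGrad_zero f p a Ω ε δ _ x rfl, abs_mul, abs_of_nonneg H.eps_nonneg, mul_comm]
    refine mul_le_mul_of_nonneg_right ?_ H.eps_nonneg
    refine (abs_sub _ _).trans ?_
    have b1 := abs_add_le (sawDeriv a (Int.fract (a ^ 3 * Ω * x 0)))
      (cutDeriv a (Int.fract (a ^ 3 * Ω * x 0)) *
        waveSum f a Ω δ (Int.fract (a ^ 3 * Ω * x 0)) x / a ^ 3)
    have b2 := abs_sawDeriv_le (by linarith : 100 ≤ a) (Int.fract (a ^ 3 * Ω * x 0))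
    have b3 := H.abs_cut_wave_le (Int.fract (a ^ 3 * Ω * x 0)) x
    have b4 := abs_sum_wave_le (c := 2) (δ := δ)
      (θ := fun j => phaseAt f a Ω (Int.fract (a ^ 3 * Ω * x 0)) j x)
      (y := fun j => tiltAt f a Ω j x + Int.fract (a ^ 3 * Ω * x 0) / (a ^ 3 * Ω) *
        tiltGrad f p a Ω j x 0) (fun j => by
          refine (abs_add_le _ _).trans ?_
          have := H.abs_tiltGrad_le j x 0 hv0 hv1
          have h' : |tiltAt f a Ω j x| ≤ 1 := abs_tiltFn_le _
          linarith)
    have b5 := (abs_cut_mul_le a (Int.fract (a ^ 3 * Ω * x 0)) _).trans b4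
    linarith
  · rw [stepGrad_succ f p a Ω ε δ _ x i rfl, abs_mul, abs_of_nonneg H.eps_nonneg, mul_comm]
    refine mul_le_mul_of_nonneg_right ?_ H.eps_nonneg
    refine (abs_cut_mul_le _ _ _).trans ((abs_sub _ _).trans ?_)
    have b1 := abs_waveDeriv_le δ (phaseAt f a Ω (Int.fract (a ^ 3 * Ω * x 0)) i x)
    have b4 := abs_sum_wave_le (c := 1) (δ := δ)
      (θ := fun j => phaseAt f a Ω (Int.fract (a ^ 3 * Ω * x 0)) j x)
      (y := fun j => Int.fract (a ^ 3 * Ω * x 0) / (a ^ 3 * Ω) *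
        tiltGrad f p a Ω j x i.succ) (fun j => (H.abs_tiltGrad_le j x _ hv0 hv1).trans h2a)
    linarith

/-- Compared with `step_taylor_local`, one extra power of a absorbs the numerical constant. The
factor 1/2 leaves half of the next Ω for the jet of the previous approximation. -/
theorem step_jet (H : StepHyp f p a Ω ε δ) :
    IsJet (stepFn f a Ω ε δ) (stepGrad f p a Ω ε δ) (6 * (e + 1) * ε) (a ^ 7 * Ω / (2 * δ)) := by
  have ha := H.a_pos
  have hΩ := H.omega_pos
  have hδ := H.delta_pos
  have he : (0 : ℝ) ≤ e := Nat.cast_nonneg e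
  have heps := H.eps_nonneg
  refine IsJet.of_local (τ := 1 / (a ^ 4 * Ω)) (by positivity) (by positivity) H.abs_stepGrad_le
    (fun x h hh => ?_) ?_
  · refine (H.step_taylor_local x h ?_).trans ?_
    · rwa [le_div_iff₀ (by positivity), mul_comm] at hh
    · refine mul_le_mul_of_nonneg_right ?_ (by positivity)
      have : a ^ 7 * Ω / (2 * δ) = (a / 2) * (a ^ 6 * Ω / δ) := by field_simp
      rw [this]
      refine mul_le_mul_of_nonneg_right ?_ (by positivity)
      linarith [H.large']
  · have e1 : a ^ 7 * Ω / (2 * δ) * (1 / (a ^ 4 * Ω)) = a ^ 3 / (2 * δ) := by field_simp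
    rw [e1, le_div_iff₀ (by positivity)]
    have h1 : ε * δ ≤ 1 := mul_le_one₀ H.eps_le hδ.le H.delta_le
    have h2 : a ≤ a ^ 3 := le_self_pow₀ (by linarith [H.thousand_le]) (by norm_num)
    have h3 := H.large
    push_cast
    calc 2 * ((e : ℝ) + 1) * (6 * (e + 1) * ε) * (2 * δ) = 24 * (e + 1) ^ 2 * (ε * δ) := by ring
      _ ≤ 24 * (e + 1) ^ 2 * 1 := by gcongr
      _ ≤ a ^ 3 := by nlinarith [sq_nonneg ((e : ℝ) + 1)]

theorem abs_stepFn_le (H : StepHyp f p a Ω ε δ) (x : RSpace (e + 1)) :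
    |stepFn f a Ω ε δ x| ≤ 4 / (a ^ 3 * Ω) := by
  have ha := H.a_pos
  have hΩ := H.omega_pos
  have he : (0 : ℝ) ≤ e := Nat.cast_nonneg e
  have heps := H.eps_nonneg
  have hb : |blockFn f a Ω δ (Int.fract (a ^ 3 * Ω * x 0)) x| ≤ 4 := by
    rw [blockFn]
    refine (abs_add_le _ _).trans ?_
    have b1 := abs_sawFn_le (by linarith [H.thousand_le] : 100 ≤ a)
      (Int.fract_nonneg (a ^ 3 * Ω * x 0)) (Int.fract_lt_one (a ^ 3 * Ω * x 0)).le
    have b2 : |cutFn a (Int.fract (a ^ 3 * Ω * x 0)) *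
        waveSum f a Ω δ (Int.fract (a ^ 3 * Ω * x 0)) x / a ^ 3| ≤ 1 := by
      rw [abs_div, abs_of_pos (by positivity : 0 < a ^ 3), div_le_one (by positivity)]
      refine (abs_cut_mul_le _ _ _).trans ((abs_waveSum_le _ _ _ _ _ _).trans ?_)
      have : a ≤ a ^ 3 := le_self_pow₀ (by linarith [H.thousand_le]) (by norm_num)
      linarith [H.large']
    linarith
  rw [stepFn, abs_mul, abs_of_nonneg (by positivity), div_mul_eq_mul_div]
  gcongr
  have := H.eps_le
  nlinarith [abs_nonneg (blockFn f a Ω δ (Int.fract (a ^ 3 * Ω * x 0)) x)]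

/-- The first order variation of `lyap`, up to a small error. -/
theorem first_variation_ge (H : StepHyp f p a Ω ε δ) (x : RSpace (e + 1)) :
    ε * (sawDeriv a (Int.fract (a ^ 3 * Ω * x 0)) - 11 * (e + 1) ^ 2 / a) ≤
      stepGrad f p a Ω ε δ x 0 +
        ∑ i : Fin e, tiltFn (p x i.succ) * stepGrad f p a Ω ε δ x i.succ := by
  have ha := H.a_pos
  have hΩ := H.omega_pos
  have he : (0 : ℝ) ≤ e := Nat.cast_nonneg e
  set v := Int.fract (a ^ 3 * Ω * x 0) with hv
  have hv0 : 0 ≤ v := Int.fract_nonneg _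
  have hv1 : v ≤ 1 := (Int.fract_lt_one _).le
  -- Pairing the gradient of `lyap` with the j-th wave direction leaves only the difference between
  -- the exact and the regularised tilt. That difference is at most 1/a; the other remainders come
  -- from the gradient of the tilt and from the cutoff.
  have key : stepGrad f p a Ω ε δ x 0 +
        ∑ i : Fin e, tiltFn (p x i.succ) * stepGrad f p a Ω ε δ x i.succ =
      ε * (sawDeriv a v + cutDeriv a v * waveSum f a Ω δ v x / a ^ 3 +
        cutFn a v * ∑ j : Fin e, waveDeriv δ (phaseAt f a Ω v j x) *
          ((tiltFn (p x j.succ) - tiltAt f a Ω j x) -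
            (v / (a ^ 3 * Ω) * tiltGrad f p a Ω j x 0 +
              ∑ i : Fin e, tiltFn (p x i.succ) *
                (v / (a ^ 3 * Ω) * tiltGrad f p a Ω j x i.succ)))) := by
    rw [stepGrad_zero f p a Ω ε δ v x hv]
    simp only [fun i => stepGrad_succ f p a Ω ε δ v x i hv]
    have e1 : ∑ i : Fin e, tiltFn (p x i.succ) * (ε * (cutFn a v *
        (waveDeriv δ (phaseAt f a Ω v i x) - ∑ j : Fin e, waveDeriv δ (phaseAt f a Ω v j x) *
          (v / (a ^ 3 * Ω) * tiltGrad f p a Ω j x i.succ)))) =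
        ε * (cutFn a v * (∑ i : Fin e, waveDeriv δ (phaseAt f a Ω v i x) * tiltFn (p x i.succ) -
          ∑ j : Fin e, waveDeriv δ (phaseAt f a Ω v j x) * ∑ i : Fin e, tiltFn (p x i.succ) *
            (v / (a ^ 3 * Ω) * tiltGrad f p a Ω j x i.succ))) := by
      simp only [Finset.mul_sum, mul_sub, Finset.sum_sub_distrib]
      congr 1
      · exact Finset.sum_congr rfl fun i _ => by ring
      · rw [Finset.sum_comm]
        exact Finset.sum_congr rfl fun i _ => Finset.sum_congr rfl fun j _ => by ring
    rw [e1]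
    simp only [mul_sub, mul_add, Finset.sum_sub_distrib, Finset.sum_add_distrib]
    ring
  rw [key]
  refine mul_le_mul_of_nonneg_left ?_ H.eps_nonneg
  have b3 := (abs_le.1 (H.abs_cut_wave_le v x)).1
  have b4 := abs_sum_wave_le (c := 1 / a + (2 / a + e * (2 / a))) (δ := δ)
      (θ := fun j => phaseAt f a Ω v j x)
      (y := fun j => ((tiltFn (p x j.succ) - tiltAt f a Ω j x) -
            (v / (a ^ 3 * Ω) * tiltGrad f p a Ω j x 0 +
              ∑ i : Fin e, tiltFn (p x i.succ) *
                (v / (a ^ 3 * Ω) * tiltGrad f p a Ω j x i.succ)))) (fun j => by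
        refine (abs_sub _ _).trans (add_le_add ?_ ((abs_add_le _ _).trans (add_le_add ?_ ?_)))
        · refine (tiltFn_lipschitz _ _).trans ?_
          rw [abs_sub_comm]
          refine (H.jet.abs_slope_sub_le (by positivity) j.succ x).trans (le_of_eq ?_)
          field_simp
        · exact H.abs_tiltGrad_le j x 0 hv0 hv1
        · refine (Finset.abs_sum_le_sum_abs _ _).trans ?_
          refine (Finset.sum_le_sum (g := fun _ => 2 / a) fun i _ => ?_).trans
            (le_of_eq (by simp))
          rw [abs_mul]
          have := mul_le_mul (abs_tiltFn_le (p x i.succ)) (H.abs_tiltGrad_le j x i.succ hv0 hv1)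
            (abs_nonneg _) zero_le_one
          linarith)
  have b5 := (abs_le.1 ((abs_cut_mul_le a v _).trans b4)).1
  have b6 : 11 * ((e : ℝ) + 1) ^ 2 / a = 8 * e / a + e * (1 / a + (2 / a + e * (2 / a)))
      + (9 * e ^ 2 + 11 * e + 11) / a := by field_simp; ring
  have b7 : 0 ≤ (9 * (e : ℝ) ^ 2 + 11 * e + 11) / a := by positivity
  linarith

/-- The increment is the first variation at P plus one convexity defect for each coordinate other
than the zeroth; each defect is nonnegative. -/
theorem lyap_sub_eq (P Q : Fin (e + 1) → ℝ) :
    lyap (P + Q) - lyap P = (Q 0 + ∑ i : Fin e, tiltFn (P i.succ) * Q i.succ) +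
      ∑ i : Fin e, (√(1 + (P i.succ + Q i.succ) ^ 2) - √(1 + P i.succ ^ 2) -
        tiltFn (P i.succ) * (P i.succ + Q i.succ - P i.succ)) := by
  simp only [lyap, Pi.add_apply, Finset.sum_sub_distrib, add_sub_cancel_left]
  ring

/-- Convexity never hurts, so the loss is at most 30/a from the descending part of the saw plus 11(e
+ 1)²/a from the first variation. -/
theorem lyap_step_ge (H : StepHyp f p a Ω ε δ) (x : RSpace (e + 1)) :
    -(41 * (e + 1) ^ 2 / a) ≤ lyap (p x + stepGrad f p a Ω ε δ x) - lyap (p x) := by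
  have ha := H.a_pos
  have he : (0 : ℝ) ≤ e := Nat.cast_nonneg e
  have heps := H.eps_nonneg
  have h1 := H.first_variation_ge x
  have h2 := le_sawDeriv (by linarith [H.thousand_le] : 100 ≤ a) (Int.fract (a ^ 3 * Ω * x 0))
  rw [lyap_sub_eq]
  have h3 : 0 ≤ ∑ i : Fin e, (√(1 + (p x i.succ + stepGrad f p a Ω ε δ x i.succ) ^ 2)
      - √(1 + p x i.succ ^ 2) - tiltFn (p x i.succ) *
        (p x i.succ + stepGrad f p a Ω ε δ x i.succ - p x i.succ)) :=
    Finset.sum_nonneg fun i _ => sqrt_one_add_sq_tangent _ _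
  have h4 : -(41 * ((e : ℝ) + 1) ^ 2 / a) ≤ -(30 / a) - 11 * (e + 1) ^ 2 / a := by
    rw [← neg_div, ← neg_div, ← sub_div]
    gcongr
    nlinarith
  have h5 : 0 ≤ 41 * ((e : ℝ) + 1) ^ 2 / a := by positivity
  have h6 : -(41 * ((e : ℝ) + 1) ^ 2 / a) ≤
      ε * (sawDeriv a (Int.fract (a ^ 3 * Ω * x 0)) - 11 * (e + 1) ^ 2 / a) := by
    have h7 : -(41 * ((e : ℝ) + 1) ^ 2 / a) ≤
      sawDeriv a (Int.fract (a ^ 3 * Ω * x 0)) - 11 * (e + 1) ^ 2 / a := by linarith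
    have := mul_le_mul_of_nonneg_left h7 heps
    nlinarith [H.eps_le]
  linarith

/-- The points at which all the waves have a kink. -/
def kinkSet {e : ℕ} (f : RSpace (e + 1) → ℝ) (a Ω δ : ℝ) : Set (RSpace (e + 1)) :=
  {x | ∀ j : Fin e, |Real.sin (phaseAt f a Ω (Int.fract (a ^ 3 * Ω * x 0)) j x)| < δ}

/-- There are two sources of gain. In the core of a slab some wave moves one gradient coordinate by
at least ε/2, and the convexity defect is at least (ε/2)²/(2(1 + M)³). In the margins the saw has
slope 3 and the first variation alone gives ε. -/
theorem lyap_step_ge_of_notMem (H : StepHyp f p a Ω ε δ) {x : RSpace (e + 1)}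
    (hx : x ∉ kinkSet f a Ω δ) {M : ℝ} (hM : 0 ≤ M) (h1 : ∀ i, |p x i| ≤ M)
    (h2 : ∀ i, |(p x + stepGrad f p a Ω ε δ x) i| ≤ M) :
    ε ^ 2 / (8 * (1 + M) ^ 3) - 41 * (e + 1) ^ 2 / a ≤
      lyap (p x + stepGrad f p a Ω ε δ x) - lyap (p x) := by
  have ha := H.a_pos
  have h1000 := H.thousand_le
  have he : (0 : ℝ) ≤ e := Nat.cast_nonneg e
  have heps := H.eps_nonneg
  have heps1 := H.eps_le
  have hf := H.first_variation_ge x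
  have hs := le_sawDeriv (by linarith : 100 ≤ a) (Int.fract (a ^ 3 * Ω * x 0))
  have h11 : 11 * ((e : ℝ) + 1) ^ 2 / a ≤ 1 := by
    rw [div_le_one ha]; nlinarith [H.large, sq_nonneg ((e : ℝ) + 1)]
  have h5 : 0 ≤ 41 * ((e : ℝ) + 1) ^ 2 / a := by positivity
  have hM1 : 1 ≤ (1 + M) ^ 3 := one_le_pow₀ (by linarith)
  set v := Int.fract (a ^ 3 * Ω * x 0) with hv
  have hv0 : 0 ≤ v := Int.fract_nonneg _
  have hv1 : v ≤ 1 := (Int.fract_lt_one _).le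
  rw [lyap_sub_eq]
  have hnn : ∀ i ∈ (Finset.univ : Finset (Fin e)), 0 ≤ (√(1 + (p x i.succ + stepGrad f p a Ω ε δ x i.succ) ^ 2)
      - √(1 + p x i.succ ^ 2) - tiltFn (p x i.succ) *
        (p x i.succ + stepGrad f p a Ω ε δ x i.succ - p x i.succ)) :=
    fun i _ => sqrt_one_add_sq_tangent _ _
  by_cases hc : 2 ≤ a * v ∧ 2 ≤ a * (1 - v)
  · have hcut := cutFn_eq_one hc.1 hc.2
    obtain ⟨j, hj⟩ : ∃ j : Fin e, δ ≤ |Real.sin (phaseAt f a Ω v j x)| := by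
      by_contra! hcon
      exact hx hcon
    have hw := le_abs_waveDeriv H.delta_pos hj
    have hS := abs_sum_wave_le (c := 2 / a) (δ := δ)
      (θ := fun j => phaseAt f a Ω v j x)
      (y := fun k => v / (a ^ 3 * Ω) * tiltGrad f p a Ω k x j.succ)
      (fun k => H.abs_tiltGrad_le k x _ hv0 hv1)
    have hS' : (e : ℝ) * (2 / a) ≤ 1 / 6 := by
      rw [mul_div_assoc', div_le_iff₀ ha]; linarith [H.large']
    -- The j-th wave contributes at least 2/3 and the tilt variation of all the waves at most 1/6.
    have hge : ε / 2 ≤ |stepGrad f p a Ω ε δ x j.succ| := by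
      rw [stepGrad_succ f p a Ω ε δ v x j hv, hcut, one_mul, abs_mul, abs_of_nonneg heps]
      have := abs_sub_abs_le_abs_sub (waveDeriv δ (phaseAt f a Ω v j x))
        (∑ k : Fin e, waveDeriv δ (phaseAt f a Ω v k x) *
          (v / (a ^ 3 * Ω) * tiltGrad f p a Ω k x j.succ))
      have h3 : 1 / 2 ≤ |waveDeriv δ (phaseAt f a Ω v j x) -
        ∑ k : Fin e, waveDeriv δ (phaseAt f a Ω v k x) *
          (v / (a ^ 3 * Ω) * tiltGrad f p a Ω k x j.succ)| := by linarith
      have := mul_le_mul_of_nonneg_left h3 heps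
      linarith
    have hcv := sqrt_one_add_sq_convex hM (h1 j.succ) (h2 j.succ)
    rw [Pi.add_apply, add_sub_cancel_left] at hcv
    have hsq : (ε / 2) ^ 2 ≤ stepGrad f p a Ω ε δ x j.succ ^ 2 := by
      rw [← sq_abs (stepGrad f p a Ω ε δ x j.succ)]
      gcongr
    have hgain : ε ^ 2 / (8 * (1 + M) ^ 3) ≤
        stepGrad f p a Ω ε δ x j.succ ^ 2 / (2 * (1 + M) ^ 3) := by
      rw [div_le_div_iff₀ (by positivity) (by positivity)]
      nlinarith
    have hsum := Finset.single_le_sum hnn (Finset.mem_univ j)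
    rw [add_sub_cancel_left] at hsum
    have h6 : -(41 * ((e : ℝ) + 1) ^ 2 / a) ≤ ε * (sawDeriv a v - 11 * (e + 1) ^ 2 / a) := by
      have h4 : -(41 * ((e : ℝ) + 1) ^ 2 / a) ≤ -(30 / a) - 11 * (e + 1) ^ 2 / a := by
        rw [← neg_div, ← neg_div, ← sub_div]
        gcongr
        nlinarith
      have h7 : -(41 * ((e : ℝ) + 1) ^ 2 / a) ≤ sawDeriv a v - 11 * (e + 1) ^ 2 / a := by linarith
      have := mul_le_mul_of_nonneg_left h7 heps
      nlinarith
    simp only [add_sub_cancel_left] at hsum ⊢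
    linarith
  · have h3 : sawDeriv a v = 3 := by
      by_cases hl : a * v ≤ 3
      · exact sawDeriv_left (by linarith) hl
      · refine sawDeriv_right (by linarith) ?_
        by_contra hr
        exact hc ⟨by linarith, by nlinarith⟩
    have hsum := Finset.sum_nonneg hnn
    rw [h3] at hf
    have h4 : ε ≤ ε * (3 - 11 * ((e : ℝ) + 1) ^ 2 / a) := by nlinarith
    have h6 : ε ^ 2 / (8 * (1 + M) ^ 3) ≤ ε := by
      rw [div_le_iff₀ (by positivity)]
      nlinarith
    linarith

end StepHyp

/-! ### Coverings by small sets -/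

/-- `A` is covered by at most `M` sets in which all distances are at most `ρ`. -/
def CoverBy {n : ℕ} (A : Set (RSpace n)) (M ρ : ℝ) : Prop :=
  ∃ S : Finset (Set (RSpace n)), (S.card : ℝ) ≤ M ∧ A ⊆ ⋃₀ (S : Set (Set (RSpace n))) ∧
    ∀ s ∈ S, ∀ x ∈ s, ∀ y ∈ s, ‖x - y‖ ≤ ρ

namespace CoverBy

variable {n : ℕ} {A B : Set (RSpace n)} {M M' ρ ρ' : ℝ}

theorem nonneg (h : CoverBy A M ρ) : 0 ≤ M := by
  obtain ⟨S, hS, _⟩ := h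
  exact (Nat.cast_nonneg _).trans hS

theorem mono (h : CoverBy B M ρ) (hAB : A ⊆ B) (hM : M ≤ M') : CoverBy A M' ρ := by
  obtain ⟨S, h1, h2, h3⟩ := h
  exact ⟨S, h1.trans hM, hAB.trans h2, h3⟩

theorem single (h : ∀ x ∈ A, ∀ y ∈ A, ‖x - y‖ ≤ ρ) : CoverBy A 1 ρ :=
  ⟨{A}, by simp, by simp, by simpa using h⟩

theorem union (h : CoverBy A M ρ) (h' : CoverBy B M' ρ) : CoverBy (A ∪ B) (M + M') ρ := by
  classical
  obtain ⟨S, h1, h2, h3⟩ := h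
  obtain ⟨T, k1, k2, k3⟩ := h'
  refine ⟨S ∪ T, ?_, ?_, ?_⟩
  · have := Finset.card_union_le S T
    have : ((S ∪ T).card : ℝ) ≤ S.card + T.card := by exact_mod_cast this
    linarith
  · rw [Finset.coe_union, Set.sUnion_union]
    exact Set.union_subset_union h2 k2
  · intro s hs
    rcases Finset.mem_union.1 hs with hs | hs
    exacts [h3 s hs, k3 s hs]

theorem biUnion {ι : Type*} (T : Finset ι) (F : ι → Set (RSpace n)) (hM : ∀ i, CoverBy (F i) M ρ)
    (hA : A ⊆ ⋃ i ∈ T, F i) : CoverBy A (T.card * M) ρ := by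
  classical
  choose S h1 h2 h3 using hM
  refine ⟨T.biUnion S, ?_, ?_, ?_⟩
  · have : ((T.biUnion S).card : ℝ) ≤ ∑ i ∈ T, ((S i).card : ℝ) := by
      exact_mod_cast Finset.card_biUnion_le
    refine this.trans ((Finset.sum_le_sum fun i _ => h1 i).trans (le_of_eq ?_))
    simp
  · intro x hx
    obtain ⟨i, hi, hxi⟩ := Set.mem_iUnion₂.1 (hA hx)
    obtain ⟨s, hs, hxs⟩ := h2 i hxi
    exact ⟨s, Finset.mem_coe.2 (Finset.mem_biUnion.2 ⟨i, hi, hs⟩), hxs⟩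
  · intro s hs
    obtain ⟨i, _, hi⟩ := Finset.mem_biUnion.1 hs
    exact h3 i s hi

/-- Covering numbers multiply along scales. The sets of a covering may leave A, so each is first
intersected with A before it is subdivided. -/
theorem trans (h : CoverBy A M ρ) (hM' : 0 ≤ M')
    (h' : ∀ C ⊆ A, (∀ x ∈ C, ∀ y ∈ C, ‖x - y‖ ≤ ρ) → CoverBy C M' ρ') :
    CoverBy A (M * M') ρ' := by
  obtain ⟨S, h1, h2, h3⟩ := h
  have key : CoverBy A ((Finset.univ : Finset S).card * M') ρ' := by
    refine biUnion (Finset.univ : Finset S) (fun s => s.1 ∩ A) (fun s => ?_) ?_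
    · exact h' _ Set.inter_subset_right fun x hx y hy => h3 s.1 s.2 x hx.1 y hy.1
    · intro x hx
      obtain ⟨s, hs, hxs⟩ := h2 hx
      exact Set.mem_iUnion₂.2 ⟨⟨s, hs⟩, Finset.mem_univ _, hxs, hx⟩
  refine key.mono subset_rfl (mul_le_mul_of_nonneg_right ?_ hM')
  simpa using h1

/-- Covering by the fibres of the integral part of a real function. -/
theorem of_floor {W : ℝ} (hW0 : 0 ≤ W) (hM : 0 ≤ M) (z : RSpace n → ℝ)
    (hW : ∀ x ∈ A, ∀ y ∈ A, |z x - z y| ≤ W)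
    (h : ∀ k : ℤ, CoverBy {x ∈ A | ⌊z x⌋ = k} M ρ) : CoverBy A ((2 * W + 3) * M) ρ := by
  rcases A.eq_empty_or_nonempty with rfl | ⟨x0, hx0⟩
  · exact ⟨∅, by simp; positivity, by simp, by simp⟩
  have key := biUnion (A := A) (Finset.Icc ⌊z x0 - W⌋ ⌊z x0 + W⌋) (fun k => {x ∈ A | ⌊z x⌋ = k}) h
    (fun x hx => by
      refine Set.mem_iUnion₂.2 ⟨⌊z x⌋, Finset.mem_Icc.2 ⟨?_, ?_⟩, hx, rfl⟩ <;>
        apply Int.floor_mono <;> have := abs_le.1 (hW x hx x0 hx0)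
      · linarith [this.1]
      · linarith [this.2])
  refine key.mono subset_rfl (mul_le_mul_of_nonneg_right ?_ hM)
  rw [Int.card_Icc]
  have h1 := Int.floor_le (z x0 + W)
  have h2 := Int.lt_floor_add_one (z x0 - W)
  have h3 : ⌊z x0 - W⌋ ≤ ⌊z x0 + W⌋ := Int.floor_mono (by linarith)
  have h4 : (((⌊z x0 + W⌋ + 1 - ⌊z x0 - W⌋).toNat : ℤ) : ℝ) = ⌊z x0 + W⌋ + 1 - ⌊z x0 - W⌋ := by
    rw [Int.toNat_of_nonneg (by linarith)]; push_cast; ring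
  rw [Int.cast_natCast] at h4
  rw [h4]
  linarith

theorem of_floors {W : ℝ} (hW0 : 0 ≤ W) (hM : 0 ≤ M) {m : ℕ} (z : Fin m → RSpace n → ℝ)
    (hW : ∀ i, ∀ x ∈ A, ∀ y ∈ A, |z i x - z i y| ≤ W)
    (h : ∀ k : Fin m → ℤ, CoverBy {x ∈ A | ∀ i, ⌊z i x⌋ = k i} M ρ) :
    CoverBy A ((2 * W + 3) ^ m * M) ρ := by
  induction m generalizing A with
  | zero => exact (h Fin.elim0).mono (fun x hx => ⟨hx, fun i => i.elim0⟩) (by simp)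
  | succ m ih =>
    rw [pow_succ', mul_assoc]
    refine of_floor hW0 (by positivity) (z 0) (hW 0) fun k0 => ?_
    refine ih (fun i => z i.succ) (fun i x hx y hy => hW _ x hx.1 y hy.1) fun k => ?_
    refine (h (Fin.cons k0 k)).mono ?_ le_rfl
    rintro x ⟨⟨hx, h0⟩, hk⟩
    exact ⟨hx, fun i => Fin.cases (by simpa using h0) (fun i => by simpa using hk i) i⟩

theorem subdivide {R : ℝ} (hR : 0 ≤ R) (hρ : 0 < ρ) (hA : ∀ x ∈ A, ∀ y ∈ A, ‖x - y‖ ≤ R) :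
    CoverBy A ((2 * (n * R / ρ) + 3) ^ n) ρ := by
  rcases Nat.eq_zero_or_pos n with rfl | hn
  · refine (single fun x _ y _ => ?_).mono subset_rfl (by simp)
    rw [Subsingleton.elim x y]; simpa using hρ.le
  have hn' : (0 : ℝ) < n := Nat.cast_pos.2 hn
  have := of_floors (A := A) (M := 1) (ρ := ρ) (W := n * R / ρ) (by positivity) zero_le_one
    (fun i x => x i * (n / ρ)) (fun i x hx y hy => by
      rw [← sub_mul, abs_mul, abs_of_pos (by positivity : 0 < n / ρ)]
      have h1 := abs_apply_le_norm (x - y) i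
      rw [PiLp.sub_apply] at h1
      calc _ ≤ R * (n / ρ) := by gcongr; exact h1.trans (hA x hx y hy)
        _ = _ := by ring) (fun k => single fun x hx y hy => by
      refine (norm_le_sum_abs _).trans ?_
      refine (Finset.sum_le_sum (g := fun _ => ρ / n) fun i _ => ?_).trans (le_of_eq ?_)
      · have h1 := Int.abs_sub_lt_one_of_floor_eq_floor ((hx.2 i).trans (hy.2 i).symm)
        rw [← sub_mul, abs_mul, abs_of_pos (by positivity : 0 < n / ρ)] at h1
        rw [PiLp.sub_apply, le_div_iff₀ hn']
        rw [mul_div_assoc', div_lt_one hρ] at h1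
        exact h1.le
      · simp; field_simp)
  simpa using this

end CoverBy

/-! ### Covering numbers for one step, with and without the kink condition. -/

/-- The floor picks the multiple of π nearest to θ. Jordan's inequality then bounds the distance by
(π/2)|sin θ|, and π ≤ 4. -/
theorem abs_sub_le_of_abs_sin_lt {θ δ : ℝ} (h : |Real.sin θ| < δ) :
    |θ - ⌊θ / Real.pi + 1 / 2⌋ * Real.pi| ≤ 2 * δ := by
  set m := ⌊θ / Real.pi + 1 / 2⌋ with hm
  have hpi := Real.pi_pos
  have h1 := Int.floor_le (θ / Real.pi + 1 / 2)
  have h2 := Int.lt_floor_add_one (θ / Real.pi + 1 / 2)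
  rw [← hm] at h1 h2
  have hu : |θ - m * Real.pi| ≤ Real.pi / 2 := by
    have e : θ - m * Real.pi = (θ / Real.pi - m) * Real.pi := by field_simp
    have : |θ / Real.pi - m| ≤ 1 / 2 := abs_le.2 ⟨by linarith, by linarith⟩
    rw [e, abs_mul, abs_of_pos hpi]
    nlinarith
  have h3 := Real.mul_abs_le_abs_sin hu
  rw [Real.sin_sub_int_mul_pi, abs_mul, abs_zpow, abs_neg, abs_one, one_zpow, one_mul,
    div_mul_eq_mul_div, div_le_iff₀ hpi] at h3
  have := Real.pi_le_four
  nlinarith [abs_nonneg (Real.sin θ)]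

namespace StepHyp

variable {e : ℕ} {f : RSpace (e + 1) → ℝ} {p : RSpace (e + 1) → Fin (e + 1) → ℝ} {a Ω ε δ : ℝ}
  {A : Set (RSpace (e + 1))}

/-- Plain subdivision into cubes. The power of a is generous, so that the ratio to the bound in
`cover_kink` is exactly δ^{-e}. -/
theorem cover_all (H : StepHyp f p a Ω ε δ) (hA : ∀ x ∈ A, ∀ y ∈ A, ‖x - y‖ ≤ 1 / Ω) :
    CoverBy A (a ^ (14 * (e + 1)) / δ ^ (e + 1)) (δ / (a ^ 7 * Ω)) := by
  have ha := H.a_pos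
  have hΩ := H.omega_pos
  have hδ := H.delta_pos
  have h1000 := H.thousand_le
  refine (CoverBy.subdivide (by positivity) (by positivity) hA).mono subset_rfl ?_
  have e1 : ((e + 1 : ℕ) : ℝ) * (1 / Ω) / (δ / (a ^ 7 * Ω)) = (e + 1) * a ^ 7 / δ := by
    push_cast; field_simp
  rw [e1, pow_mul, ← div_pow]
  refine pow_le_pow_left₀ (by positivity) ?_ _
  rw [mul_div_assoc', div_add' _ _ _ hδ.ne']
  gcongr
  have h8 : a ^ 8 ≤ a ^ 14 := pow_le_pow_right₀ (by linarith) (by norm_num)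
  have h7 : 1 ≤ a ^ 7 := one_le_pow₀ (by linarith)
  have he : (0 : ℝ) ≤ e := Nat.cast_nonneg e
  have := H.delta_le
  calc 2 * (((e : ℝ) + 1) * a ^ 7) + 3 * δ ≤ 2 * (((e : ℝ) + 1) * a ^ 7) + 3 * a ^ 7 := by linarith
    _ = (2 * e + 5) * a ^ 7 := by ring
    _ ≤ a * a ^ 7 := by gcongr; linarith [H.large']
    _ = a ^ 8 := by ring
    _ ≤ a ^ 14 := h8

/-- Points at which the waves have the same kinks are close to each other. -/
theorem dist_le_of_same_kink (H : StepHyp f p a Ω ε δ) {x y : RSpace (e + 1)}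
    (hx : x ∈ kinkSet f a Ω δ) (hy : y ∈ kinkSet f a Ω δ)
    (hk : ⌊a ^ 3 * Ω * x 0⌋ = ⌊a ^ 3 * Ω * y 0⌋) (h0 : |x 0 - y 0| ≤ δ / (a ^ 6 * Ω))
    (hr : ∀ j : Fin e,
      ⌊phaseAt f a Ω (Int.fract (a ^ 3 * Ω * x 0)) j x / Real.pi + 1 / 2⌋ =
      ⌊phaseAt f a Ω (Int.fract (a ^ 3 * Ω * y 0)) j y / Real.pi + 1 / 2⌋) :
    ‖x - y‖ ≤ δ / (a ^ 5 * Ω) := by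
  have ha := H.a_pos
  have hΩ := H.omega_pos
  have hδ := H.delta_pos
  have he : (0 : ℝ) ≤ e := Nat.cast_nonneg e
  have hκ : 0 < a ^ 3 * Ω := by positivity
  set κ := a ^ 3 * Ω with hκd
  set v := Int.fract (κ * x 0) with hv
  set w := Int.fract (κ * y 0) with hw
  have hvw : v - w = κ * (x 0 - y 0) := by
    rw [hv, hw, Int.fract, Int.fract, hk]; ring
  have hw0 : |w| ≤ 1 := abs_le.2 ⟨by linarith [Int.fract_nonneg (κ * y 0)], (Int.fract_lt_one _).le⟩
  have hj : ∀ j : Fin e, |(x - y) j.succ| ≤ 5 * (δ / (a ^ 6 * Ω)) + 2 * (e + 1) / a * ‖x - y‖ := by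
    intro j
    have h1 := abs_sub_le_of_abs_sin_lt (hx j)
    have h2 := abs_sub_le_of_abs_sin_lt (hy j)
    rw [hr j] at h1
    have h3 : |phaseAt f a Ω v j x - phaseAt f a Ω w j y| ≤ 4 * δ := by
      have h1' := abs_le.1 h1
      have h2' := abs_le.1 h2
      rw [abs_le]
      constructor <;> linarith [h1'.1, h1'.2, h2'.1, h2'.2]
    have h4 := H.tilt_lipschitz j y (x - y)
    rw [add_sub_cancel] at h4
    -- The phase is solved for the coordinate j + 1: on a common kink that coordinate is determined
    -- by the zeroth one, up to O(δ) in phase and the slow variation of the tilt.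
    have e1 : κ * (x - y) j.succ = (phaseAt f a Ω v j x - phaseAt f a Ω w j y) / a ^ 3 +
        tiltAt f a Ω j x * (v - w) + (tiltAt f a Ω j x - tiltAt f a Ω j y) * w := by
      rw [phaseAt, phaseAt, PiLp.sub_apply, ← hκd]
      field_simp
      ring
    have h5 : |κ * (x - y) j.succ| ≤ 4 * δ / a ^ 3 + κ * (δ / (a ^ 6 * Ω)) +
        2 * (e + 1) / a * (κ * ‖x - y‖) := by
      rw [e1]
      refine (abs_add_three _ _ _).trans (add_le_add (add_le_add ?_ ?_) ?_)
      · rw [abs_div, abs_of_pos (by positivity : 0 < a ^ 3)]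
        gcongr
      · rw [abs_mul, hvw, abs_mul, abs_of_pos hκ]
        have : |tiltAt f a Ω j x| ≤ 1 := abs_tiltFn_le _
        calc _ ≤ 1 * (κ * |x 0 - y 0|) := by gcongr
          _ ≤ _ := by rw [one_mul]; gcongr
      · rw [abs_mul]
        calc _ ≤ 2 * (e + 1) / a * (κ * ‖x - y‖) * 1 := by gcongr
          _ = _ := mul_one _
    rw [abs_mul, abs_of_pos hκ] at h5
    have e2 : 4 * δ / a ^ 3 + κ * (δ / (a ^ 6 * Ω)) + 2 * (e + 1) / a * (κ * ‖x - y‖) =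
        κ * (5 * (δ / (a ^ 6 * Ω)) + 2 * (e + 1) / a * ‖x - y‖) := by
      rw [hκd]; field_simp; ring
    rw [e2] at h5
    exact le_of_mul_le_mul_left h5 hκ
  have hn := norm_le_sum_abs (x - y)
  rw [Fin.sum_univ_succ] at hn
  have hs := Finset.sum_le_sum (fun j (_ : j ∈ (Finset.univ : Finset (Fin e))) => hj j)
  simp only [Finset.sum_const, Finset.card_univ, Fintype.card_fin, nsmul_eq_mul] at hs
  rw [PiLp.sub_apply] at hn
  -- The tilts depend on all the coordinates, so ‖x - y‖ also occurs on the right; its total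
  -- coefficient is at most 1/2 and is absorbed. This is where a must dominate (e + 1)².
  have hsmall : (e : ℝ) * (2 * (e + 1) / a) ≤ 1 / 2 := by
    rw [mul_div_assoc', div_le_iff₀ ha]
    nlinarith [H.large]
  have hn0 := norm_nonneg (x - y)
  have h6 : ‖x - y‖ ≤ 2 * (5 * e + 1) * (δ / (a ^ 6 * Ω)) := by
    nlinarith [mul_le_mul_of_nonneg_right hsmall hn0]
  refine h6.trans ?_
  have e3 : δ / (a ^ 5 * Ω) = a * (δ / (a ^ 6 * Ω)) := by field_simp
  rw [e3]
  refine mul_le_mul_of_nonneg_right ?_ (by positivity)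
  linarith [H.large']

/-- This is where dimension one appears. A point of the kink set is located by its slab, a cell of
width δ/(a⁶Ω) for the zeroth coordinate, and the e integers numbering its kinks. Only the cells
bring in a factor 1/δ; all other counts are powers of a. -/
theorem cover_kink (H : StepHyp f p a Ω ε δ) (hA : ∀ x ∈ A, ∀ y ∈ A, ‖x - y‖ ≤ 1 / Ω) :
    CoverBy (A ∩ kinkSet f a Ω δ) (a ^ (14 * (e + 1)) / δ) (δ / (a ^ 7 * Ω)) := by
  have ha := H.a_pos
  have hΩ := H.omega_pos
  have hδ := H.delta_pos
  have h1000 := H.thousand_le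
  have he : (0 : ℝ) ≤ e := Nat.cast_nonneg e
  have hd1 := H.delta_le
  have hco : ∀ x ∈ A, ∀ y ∈ A, ∀ i, |x i - y i| ≤ 1 / Ω := fun x hx y hy i => by
    have := abs_apply_le_norm (x - y) i
    rw [PiLp.sub_apply] at this
    exact this.trans (hA x hx y hy)
  have hsub : ∀ C : Set (RSpace (e + 1)), (∀ x ∈ C, ∀ y ∈ C, ‖x - y‖ ≤ δ / (a ^ 5 * Ω)) →
      CoverBy C ((a ^ 3) ^ (e + 1)) (δ / (a ^ 7 * Ω)) := by
    intro C hC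
    refine (CoverBy.subdivide (by positivity) (by positivity) hC).mono subset_rfl ?_
    refine pow_le_pow_left₀ (by positivity) ?_ _
    have e1 : ((e + 1 : ℕ) : ℝ) * (δ / (a ^ 5 * Ω)) / (δ / (a ^ 7 * Ω)) = (e + 1) * a ^ 2 := by
      push_cast; field_simp
    rw [e1]
    have : 1 ≤ a ^ 2 := one_le_pow₀ (by linarith)
    calc 2 * (((e : ℝ) + 1) * a ^ 2) + 3 ≤ 2 * (((e : ℝ) + 1) * a ^ 2) + 3 * a ^ 2 := by linarith
      _ = (2 * e + 5) * a ^ 2 := by ring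
      _ ≤ a * a ^ 2 := by gcongr; linarith [H.large']
      _ = a ^ 3 := by ring
  have key : CoverBy (A ∩ kinkSet f a Ω δ) ((2 * a ^ 3 + 3) * ((2 * (a ^ 6 / δ) + 3) *
      ((2 * a ^ 6 + 3) ^ e * (a ^ 3) ^ (e + 1)))) (δ / (a ^ 7 * Ω)) := by
    refine CoverBy.of_floor (by positivity) (by positivity) (fun x => a ^ 3 * Ω * x 0)
      (fun x hx y hy => ?_) fun k => ?_
    · rw [← mul_sub, abs_mul, abs_of_pos (by positivity : 0 < a ^ 3 * Ω)]
      calc _ ≤ a ^ 3 * Ω * (1 / Ω) := by gcongr; exact hco x hx.1 y hy.1 0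
        _ = _ := by field_simp
    refine CoverBy.of_floor (by positivity) (by positivity) (fun x => x 0 * (a ^ 6 * Ω / δ))
      (fun x hx y hy => ?_) fun l => ?_
    · rw [← sub_mul, abs_mul, abs_of_pos (by positivity : 0 < a ^ 6 * Ω / δ)]
      calc _ ≤ 1 / Ω * (a ^ 6 * Ω / δ) := by gcongr; exact hco x hx.1.1 y hy.1.1 0
        _ = _ := by field_simp
    refine CoverBy.of_floors (by positivity) (by positivity)
      (fun j x => phaseAt f a Ω (Int.fract (a ^ 3 * Ω * x 0)) j x / Real.pi + 1 / 2)
      (fun j x hx y hy => ?_) fun m => ?_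
    · have hk : ⌊a ^ 3 * Ω * x 0⌋ = ⌊a ^ 3 * Ω * y 0⌋ := hx.1.2.trans hy.1.2.symm
      have hxA := hx.1.1.1
      have hyA := hy.1.1.1
      have hκ : 0 < a ^ 3 * Ω := by positivity
      have h4 := H.tilt_lipschitz' j y (x - y)
      rw [add_sub_cancel, one_mul] at h4
      set κ := a ^ 3 * Ω with hκd
      set v := Int.fract (κ * x 0) with hv
      set w := Int.fract (κ * y 0) with hw
      have hvw : v - w = κ * (x 0 - y 0) := by
        rw [hv, hw, Int.fract, Int.fract, hk]; ring
      have hw0 : |w| ≤ 1 :=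
        abs_le.2 ⟨by linarith [Int.fract_nonneg (κ * y 0)], (Int.fract_lt_one _).le⟩
      have hκΩ : κ * (1 / Ω) = a ^ 3 := by rw [hκd]; field_simp
      have hpi : 3 ≤ Real.pi := Real.pi_gt_three.le
      have e1 : phaseAt f a Ω v j x / Real.pi + 1 / 2 - (phaseAt f a Ω w j y / Real.pi + 1 / 2) =
          a ^ 3 * (κ * (x j.succ - y j.succ) - tiltAt f a Ω j x * (v - w) -
            (tiltAt f a Ω j x - tiltAt f a Ω j y) * w) / Real.pi := by
        rw [phaseAt, phaseAt, ← hκd]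
        ring
      rw [e1, abs_div, abs_of_pos Real.pi_pos, div_le_iff₀ Real.pi_pos, abs_mul,
        abs_of_pos (by positivity : 0 < a ^ 3)]
      have b1 : |κ * (x j.succ - y j.succ)| ≤ a ^ 3 := by
        rw [abs_mul, abs_of_pos hκ, ← hκΩ]
        gcongr
        exact hco x hxA y hyA _
      have b2 : |tiltAt f a Ω j x * (v - w)| ≤ a ^ 3 := by
        rw [abs_mul, hvw, abs_mul, abs_of_pos hκ, ← hκΩ]
        have : |tiltAt f a Ω j x| ≤ 1 := abs_tiltFn_le _
        calc _ ≤ 1 * (κ * (1 / Ω)) := by gcongr; exact hco x hxA y hyA _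
          _ = _ := one_mul _
      have b3 : |(tiltAt f a Ω j x - tiltAt f a Ω j y) * w| ≤ a ^ 3 := by
        rw [abs_mul, ← hκΩ]
        calc _ ≤ κ * ‖x - y‖ * 1 := by gcongr
          _ ≤ κ * (1 / Ω) := by rw [mul_one]; gcongr; exact hA x hxA y hyA
      have b4 := abs_sub (κ * (x j.succ - y j.succ) - tiltAt f a Ω j x * (v - w))
        ((tiltAt f a Ω j x - tiltAt f a Ω j y) * w)
      have b5 := abs_sub (κ * (x j.succ - y j.succ)) (tiltAt f a Ω j x * (v - w))
      calc _ ≤ a ^ 3 * (3 * a ^ 3) := by gcongr; linarith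
        _ = a ^ 6 * 3 := by ring
        _ ≤ a ^ 6 * Real.pi := by gcongr
    · refine hsub _ fun x hx y hy => ?_
      refine H.dist_le_of_same_kink hx.1.1.1.2 hy.1.1.1.2 (hx.1.1.2.trans hy.1.1.2.symm) ?_
        fun j => (hx.2 j).trans (hy.2 j).symm
      have h1 := Int.abs_sub_lt_one_of_floor_eq_floor (hx.1.2.trans hy.1.2.symm)
      rw [← sub_mul, abs_mul, abs_of_pos (by positivity : 0 < a ^ 6 * Ω / δ)] at h1
      rw [le_div_iff₀ (by positivity)]
      rw [mul_div_assoc', div_lt_one hδ] at h1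
      exact h1.le
  refine key.mono subset_rfl ?_
  have hp : ∀ k : ℕ, 2 * a ^ k + 3 ≤ a ^ (k + 1) := fun k => by
    have : 1 ≤ a ^ k := one_le_pow₀ (by linarith)
    rw [pow_succ]
    nlinarith
  have h6 : 2 * (a ^ 6 / δ) + 3 ≤ a ^ 7 / δ := by
    rw [mul_div_assoc', div_add' _ _ _ hδ.ne']
    gcongr
    linarith [show 2 * a ^ 6 + 3 ≤ a ^ 7 from hp 6]
  calc _ ≤ a ^ 4 * (a ^ 7 / δ * ((a ^ 7) ^ e * (a ^ 3) ^ (e + 1))) := by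
        gcongr
        · exact hp 3
        · exact hp 6
    -- The exponents are 4 for the slabs, 7 for the cells, 7e for the kinks and 3(e + 1) for the
    -- final subdivision.
    _ = a ^ (14 + 10 * e) / δ := by
        rw [← pow_mul, ← pow_mul, div_mul_eq_mul_div, mul_div_assoc', ← pow_add, ← pow_add,
          ← pow_add]
        congr 2
        ring
    _ ≤ a ^ (14 * (e + 1)) / δ := by
        gcongr
        · linarith
        · omega

end StepHyp

/-! ### The sequence of approximations -/

/-- The parameter `a` of the `n`-th step. -/
noncomputable def paramA (m n : ℕ) : ℝ := 2 ^ (n + m)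

/-- The parameter `δ` of the `n`-th step. -/
noncomputable def paramDelta (m n : ℕ) : ℝ := (1 / 2) ^ ((n + m) ^ 2)

/-- The parameter `ε` of the `n`-th step. -/
noncomputable def paramEps (n : ℕ) : ℝ := 1 / √√((n : ℝ) + 1)

/-- The bound `Ω` for the second differences of the `n`-th approximation. -/
noncomputable def paramOmega (m : ℕ) : ℕ → ℝ
  | 0 => 1
  | n + 1 => paramA m n ^ 7 * paramOmega m n / paramDelta m n

/-- The `n`-th approximation, together with its gradient. -/
noncomputable def approx (e m : ℕ) :
    ℕ → (RSpace (e + 1) → ℝ) × (RSpace (e + 1) → Fin (e + 1) → ℝ)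
  | 0 => (fun _ => 0, fun _ => 0)
  | n + 1 =>
    (fun x => (approx e m n).1 x +
        stepFn (approx e m n).1 (paramA m n) (paramOmega m n) (paramEps n) (paramDelta m n) x,
     fun x => (approx e m n).2 x +
        stepGrad (approx e m n).1 (approx e m n).2 (paramA m n) (paramOmega m n) (paramEps n)
          (paramDelta m n) x)

theorem paramDelta_pos (m n : ℕ) : 0 < paramDelta m n := by unfold paramDelta; positivity

theorem paramDelta_le_one (m n : ℕ) : paramDelta m n ≤ 1 :=
  pow_le_one₀ (by norm_num) (by norm_num)

theorem paramA_pos (m n : ℕ) : 0 < paramA m n := by unfold paramA; positivity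

theorem one_le_paramA (m n : ℕ) : 1 ≤ paramA m n := one_le_pow₀ (by norm_num)

theorem paramEps_pos (n : ℕ) : 0 < paramEps n := by unfold paramEps; positivity

theorem paramEps_le_one (n : ℕ) : paramEps n ≤ 1 := by
  have h0 : (0 : ℝ) ≤ n := Nat.cast_nonneg n
  have h : 1 ≤ √√((n : ℝ) + 1) := by
    rw [Real.one_le_sqrt, Real.one_le_sqrt]; linarith
  exact (div_le_one (by linarith)).2 h

theorem paramEps_sq (n : ℕ) : paramEps n ^ 2 = 1 / √((n : ℝ) + 1) := by
  rw [paramEps, div_pow, one_pow, Real.sq_sqrt (Real.sqrt_nonneg _)]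

theorem paramEps_antitone : Antitone paramEps := by
  intro n k h
  unfold paramEps
  gcongr

theorem one_le_paramOmega (m n : ℕ) : 1 ≤ paramOmega m n := by
  induction n with
  | zero => exact le_rfl
  | succ n ih =>
    rw [paramOmega, le_div_iff₀ (paramDelta_pos m n), one_mul]
    have h1 : 1 ≤ paramA m n ^ 7 := one_le_pow₀ (one_le_paramA m n)
    nlinarith [paramDelta_le_one m n]

theorem paramOmega_pos (m n : ℕ) : 0 < paramOmega m n := by linarith [one_le_paramOmega m n]

theorem paramOmega_succ_ge (m n : ℕ) : paramA m n ^ 7 * paramOmega m n ≤ paramOmega m (n + 1) := by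
  have h := paramDelta_pos m n
  rw [paramOmega, le_div_iff₀ h]
  have h1 : 0 < paramA m n ^ 7 * paramOmega m n :=
    mul_pos (pow_pos (paramA_pos m n) 7) (paramOmega_pos m n)
  nlinarith [paramDelta_le_one m n]

theorem paramOmega_le_succ (m n : ℕ) : paramOmega m n ≤ paramOmega m (n + 1) := by
  refine le_trans ?_ (paramOmega_succ_ge m n)
  have h1 : 1 ≤ paramA m n ^ 7 := one_le_pow₀ (one_le_paramA m n)
  nlinarith [paramOmega_pos m n]

theorem paramOmega_mono (m : ℕ) : Monotone (paramOmega m) :=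
  monotone_nat_of_le_succ (paramOmega_le_succ m)

theorem paramA_mono (m : ℕ) : Monotone (paramA m) := fun n k h =>
  pow_le_pow_right₀ (by norm_num) (by omega)

theorem le_paramA (m n : ℕ) : (n : ℝ) ≤ paramA m n := by
  have h : n < 2 ^ n := Nat.lt_two_pow_self
  have h2 : (n : ℝ) ≤ 2 ^ n := by exact_mod_cast h.le
  exact h2.trans (pow_le_pow_right₀ (by norm_num) (by omega))

theorem tendsto_paramA (m : ℕ) : Tendsto (paramA m) atTop atTop :=
  tendsto_atTop_mono (le_paramA m) tendsto_natCast_atTop_atTop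

theorem tendsto_paramOmega {m : ℕ} : Tendsto (paramOmega m) atTop atTop := by
  rw [← tendsto_add_atTop_iff_nat 1]
  refine tendsto_atTop_mono (fun n => ?_) (tendsto_paramA m)
  refine le_trans ?_ (paramOmega_succ_ge m n)
  have h0 := one_le_paramA m n
  have h1 : paramA m n ≤ paramA m n ^ 7 := le_self_pow₀ h0 (by norm_num)
  nlinarith [one_le_paramOmega m n]

theorem tendsto_paramEps : Tendsto paramEps atTop (𝓝 0) := by
  unfold paramEps
  simp only [one_div]
  refine Tendsto.inv_tendsto_atTop ?_
  refine Real.tendsto_sqrt_atTop.comp (Real.tendsto_sqrt_atTop.comp ?_)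
  exact tendsto_atTop_add_const_right _ _ tendsto_natCast_atTop_atTop

/-! ### Convergence of the approximations and the small Zygmund condition for the limit. -/

section approximations

variable {e m : ℕ}

theorem paramA_large (hm : 1000 * ((e : ℝ) + 1) ^ 2 ≤ 2 ^ m) (n : ℕ) :
    1000 * ((e : ℝ) + 1) ^ 2 * 2 ^ n ≤ paramA m n := by
  rw [paramA, pow_add, mul_comm]
  gcongr

/-- Both claims need each other in the induction. Since ε ≤ 1 the gradient grows at most linearly in
n, hence stays below the exponential parameter a required by `StepHyp`. The new remainder is exactly
half of the next Ω, and the old one fits in the other half. -/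
theorem approx_jet (hm : 1000 * ((e : ℝ) + 1) ^ 2 ≤ 2 ^ m) (n : ℕ) :
    IsJet (approx e m n).1 (approx e m n).2 (6 * (e + 1) * n) (paramOmega m n) ∧
    StepHyp (approx e m n).1 (approx e m n).2 (paramA m n) (paramOmega m n) (paramEps n)
      (paramDelta m n) := by
  have he : (0 : ℝ) ≤ e := Nat.cast_nonneg e
  have mk : ∀ n, IsJet (approx e m n).1 (approx e m n).2 (6 * (e + 1) * n) (paramOmega m n) →
      StepHyp (approx e m n).1 (approx e m n).2 (paramA m n) (paramOmega m n) (paramEps n)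
      (paramDelta m n) := fun n h => by
    have h2 := paramA_large hm n
    have h3 : (1 : ℝ) ≤ 2 ^ n := one_le_pow₀ (by norm_num)
    have h4 : (n : ℝ) ≤ 2 ^ n := by exact_mod_cast (Nat.lt_two_pow_self (n := n)).le
    refine ⟨?_, paramOmega_pos m n, (paramEps_pos n).le, paramEps_le_one n, paramDelta_pos m n,
      paramDelta_le_one m n, h.mono ?_ le_rfl⟩
    · nlinarith [sq_nonneg ((e : ℝ) + 1)]
    · calc 6 * ((e : ℝ) + 1) * n ≤ 1000 * ((e : ℝ) + 1) ^ 2 * 2 ^ n := by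
            have h5 : (e : ℝ) + 1 ≤ (e + 1) ^ 2 := le_self_pow₀ (by linarith) (by norm_num)
            have h6 : 0 ≤ ((e : ℝ) + 1) ^ 2 := sq_nonneg _
            gcongr
            linarith
        _ ≤ _ := h2
  suffices h : IsJet (approx e m n).1 (approx e m n).2 (6 * (e + 1) * n) (paramOmega m n) from
    ⟨h, mk n h⟩
  induction n with
  | zero => exact ⟨by simp [approx], by simp [approx, paramOmega, linForm]⟩
  | succ n ih =>
    have H := mk n ih
    refine (ih.add H.step_jet).mono ?_ ?_
    · push_cast
      nlinarith [paramEps_le_one n]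
    · have h1 := paramOmega_succ_ge m n
      have h2 := one_le_pow₀ (n := 7) (one_le_paramA m n)
      have h3 : (2 : ℝ) ≤ paramA m n ^ 7 := by
        have := le_self_pow₀ (n := 7) (one_le_paramA m n) (by norm_num)
        linarith [H.thousand_le]
      have h4 : paramA m n ^ 7 * paramOmega m n / (2 * paramDelta m n)
          = paramOmega m (n + 1) / 2 := by
        rw [paramOmega]; field_simp
      rw [h4]
      nlinarith [paramOmega_pos m n]

theorem approx_hyp (hm : 1000 * ((e : ℝ) + 1) ^ 2 ≤ 2 ^ m) (n : ℕ) :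
    StepHyp (approx e m n).1 (approx e m n).2 (paramA m n) (paramOmega m n) (paramEps n)
      (paramDelta m n) := (approx_jet hm n).2

/-- The limit of the approximations. -/
noncomputable def limitFn (e m : ℕ) (x : RSpace (e + 1)) : ℝ :=
  limUnder atTop fun n => (approx e m n).1 x

theorem abs_approx_succ_sub_le (hm : 1000 * ((e : ℝ) + 1) ^ 2 ≤ 2 ^ m) (n k : ℕ)
    (x : RSpace (e + 1)) :
    dist ((approx e m (n + k)).1 x) ((approx e m (n + (k + 1))).1 x) ≤
      4 / (paramA m n ^ 3 * paramOmega m n) * (1 / 2) ^ k := by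
  have h1 := (approx_hyp hm (n + k)).abs_stepFn_le x
  rw [dist_comm, Real.dist_eq, ← add_assoc n k 1]
  have e1 : (approx e m (n + k + 1)).1 x - (approx e m (n + k)).1 x =
      stepFn (approx e m (n + k)).1 (paramA m (n + k)) (paramOmega m (n + k)) (paramEps (n + k))
        (paramDelta m (n + k)) x := by
    simp [approx]
  rw [e1]
  refine h1.trans ?_
  rw [one_div, inv_pow, ← div_eq_mul_inv, div_div]
  have hA := paramA_pos m n
  have hO := paramOmega_pos m n
  refine div_le_div_of_nonneg_left (by norm_num) (by positivity) ?_
  have h2 : paramA m n ^ 3 * 2 ^ k ≤ paramA m (n + k) ^ 3 := by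
    have : paramA m (n + k) = paramA m n * 2 ^ k := by
      rw [paramA, paramA, ← pow_add]; congr 1; ring
    rw [this, mul_pow]
    gcongr
    exact le_self_pow₀ (one_le_pow₀ (by norm_num)) (by norm_num)
  have h3 := paramOmega_mono m (Nat.le_add_right n k)
  calc paramA m n ^ 3 * paramOmega m n * 2 ^ k = (paramA m n ^ 3 * 2 ^ k) * paramOmega m n := by ring
    _ ≤ _ := by gcongr; exact (pow_pos (paramA_pos m (n + k)) 3).le

theorem abs_limitFn_sub_le (hm : 1000 * ((e : ℝ) + 1) ^ 2 ≤ 2 ^ m) (n : ℕ) (x : RSpace (e + 1)) :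
    |limitFn e m x - (approx e m n).1 x| ≤ 8 / (paramA m n ^ 3 * paramOmega m n) := by
  have hc : CauchySeq fun k => (approx e m k).1 x := by
    refine cauchySeq_of_le_geometric (1 / 2) (4 / (paramA m 0 ^ 3 * paramOmega m 0))
      (by norm_num) fun k => ?_
    simpa only [zero_add] using abs_approx_succ_sub_le hm 0 k x
  have ht : Tendsto (fun k => (approx e m k).1 x) atTop (𝓝 (limitFn e m x)) :=
    hc.tendsto_limUnder
  have ht' : Tendsto (fun k => (approx e m (n + k)).1 x) atTop (𝓝 (limitFn e m x)) := by
    simp only [add_comm n]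
    exact (tendsto_add_atTop_iff_nat n).2 ht
  have := dist_le_of_le_geometric_of_tendsto₀ (1 / 2) _ (by norm_num)
    (fun k => abs_approx_succ_sub_le hm n k x) ht'
  rw [dist_comm, Real.dist_eq] at this
  refine this.trans (le_of_eq ?_)
  ring

theorem abs_limitFn_le (hm : 1000 * ((e : ℝ) + 1) ^ 2 ≤ 2 ^ m) (x : RSpace (e + 1)) :
    |limitFn e m x| ≤ 8 := by
  have h := abs_limitFn_sub_le hm 0 x
  simp only [approx, sub_zero, paramOmega, mul_one] at h
  refine h.trans ((div_le_self (by norm_num) ?_))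
  exact one_le_pow₀ (one_le_paramA m 0)

theorem abs_secondDiff_add_le {n : ℕ} {f g : RSpace n → ℝ} {c : ℝ} (h : ∀ x, |f x - g x| ≤ c)
    (x t : RSpace n) : |secondDiff f x t - secondDiff g x t| ≤ 4 * c := by
  have h1 := abs_le.1 (h (x + t))
  have h2 := abs_le.1 (h (x - t))
  have h3 := abs_le.1 (h x)
  rw [secondDiff, secondDiff, abs_le]
  constructor <;> linarith [h1.1, h1.2, h2.1, h2.2, h3.1, h3.2]

/-- The second differences of the limit at the scales of the `n`-th step. -/
theorem abs_secondDiff_limitFn_le (hm : 1000 * ((e : ℝ) + 1) ^ 2 ≤ 2 ^ m) (n : ℕ)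
    (x h : RSpace (e + 1)) (h1 : paramA m n * paramOmega m n * ‖h‖ ≤ 1)
    (h2 : 1 < paramA m (n + 1) * paramOmega m (n + 1) * ‖h‖) :
    |secondDiff (limitFn e m) x h| ≤
      (12 * ((e : ℝ) + 1) ^ 2 * paramEps n + 34 / paramA m n) * ‖h‖ := by
  have hA := paramA_pos m n
  have hO := paramOmega_pos m n
  have hA' := paramA_pos m (n + 1)
  have hO' := paramOmega_pos m (n + 1)
  have H := approx_hyp hm n
  have b1 := abs_secondDiff_add_le (abs_limitFn_sub_le hm (n + 1)) x h
  have b2 := H.jet.secondDiff_le x h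
  have l1 := H.step_jet.lipschitz x h
  have l2 := H.step_jet.lipschitz x (-h)
  rw [norm_neg, ← sub_eq_add_neg] at l2
  have e1 : secondDiff (approx e m (n + 1)).1 x h = secondDiff (approx e m n).1 x h +
      ((stepFn (approx e m n).1 (paramA m n) (paramOmega m n) (paramEps n) (paramDelta m n) (x + h)
        - stepFn (approx e m n).1 (paramA m n) (paramOmega m n) (paramEps n) (paramDelta m n) x) +
       (stepFn (approx e m n).1 (paramA m n) (paramOmega m n) (paramEps n) (paramDelta m n) (x - h)
        - stepFn (approx e m n).1 (paramA m n) (paramOmega m n) (paramEps n) (paramDelta m n) x)) := by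
    simp only [secondDiff, approx]
    ring
  have hn := norm_nonneg h
  have b3 : 2 * paramOmega m n * ‖h‖ ^ 2 ≤ 2 / paramA m n * ‖h‖ := by
    rw [div_mul_eq_mul_div, le_div_iff₀ hA]
    nlinarith
  -- The cube in the sup norm bound leaves two spare powers of a: at this scale one power of a and Ω
  -- are traded for ‖h‖.
  have b4 : 4 * (8 / (paramA m (n + 1) ^ 3 * paramOmega m (n + 1))) ≤ 32 / paramA m n * ‖h‖ := by
    have hle := paramA_mono m (Nat.le_succ n)
    have h1' : paramA m (n + 1) ≤ paramA m (n + 1) ^ 2 :=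
      le_self_pow₀ (one_le_paramA m _) (by norm_num)
    have h32 : 32 / paramA m (n + 1) ^ 2 ≤ 32 / paramA m n := by
      gcongr
      exact hle.trans h1'
    calc 4 * (8 / (paramA m (n + 1) ^ 3 * paramOmega m (n + 1)))
        = 32 / paramA m (n + 1) ^ 2 * (1 / (paramA m (n + 1) * paramOmega m (n + 1))) := by
          field_simp; norm_num
      _ ≤ 32 / paramA m n * ‖h‖ := by
          gcongr
          rw [div_le_iff₀ (by positivity)]
          linarith
  have e2 : 12 * ((e : ℝ) + 1) ^ 2 * paramEps n * ‖h‖ =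
      2 * (((e + 1 : ℕ) : ℝ) * (6 * (e + 1) * paramEps n) * ‖h‖) := by push_cast; ring
  have e3 : 34 / paramA m n = 2 / paramA m n + 32 / paramA m n := by ring
  rw [add_mul, e2, e3, add_mul]
  rw [e1] at b1
  have b1' := abs_le.1 b1
  have b2' := abs_le.1 (b2.trans b3)
  have l1' := abs_le.1 l1
  have l2' := abs_le.1 l2
  rw [abs_le]
  constructor <;> linarith [b1'.1, b1'.2, b2'.1, b2'.2, l1'.1, l1'.2, l2'.1, l2'.2]

theorem exists_scale (m n0 : ℕ) {t : ℝ} (ht : 0 < t) (h : paramA m n0 * paramOmega m n0 * t ≤ 1) :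
    ∃ n, n0 ≤ n ∧ paramA m n * paramOmega m n * t ≤ 1 ∧
      1 < paramA m (n + 1) * paramOmega m (n + 1) * t := by
  have hex : ∃ k, 1 < paramA m (n0 + k) * paramOmega m (n0 + k) * t := by
    have h1 := (tendsto_paramOmega (m := m)).eventually_gt_atTop (1 / t)
    obtain ⟨k, hk1, hk2⟩ := (h1.and (eventually_ge_atTop n0)).exists
    obtain ⟨k, rfl⟩ := Nat.exists_eq_add_of_le hk2
    refine ⟨k, ?_⟩
    rw [div_lt_iff₀ ht] at hk1
    have h2 := one_le_paramA m (n0 + k)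
    nlinarith [paramOmega_pos m (n0 + k)]
  classical
  have hpos : Nat.find hex ≠ 0 := by
    intro h0
    have := Nat.find_spec hex
    rw [h0, add_zero] at this
    linarith
  obtain ⟨k, hk⟩ := Nat.exists_eq_succ_of_ne_zero hpos
  refine ⟨n0 + k, Nat.le_add_right _ _, ?_, ?_⟩
  · exact not_lt.1 (Nat.find_min hex (m := k) (by omega))
  · have := Nat.find_spec hex
    rw [hk] at this
    exact this

theorem limitFn_small (hm : 1000 * ((e : ℝ) + 1) ^ 2 ≤ 2 ^ m) (ε : ℝ) (hε : 0 < ε) :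
    ∃ δ : ℝ, 0 < δ ∧
      ∀ h : RSpace (e + 1), ‖h‖ < δ → ∀ x, |secondDiff (limitFn e m) x h| ≤ ε * ‖h‖ := by
  have ht : Tendsto (fun n => 12 * ((e : ℝ) + 1) ^ 2 * paramEps n + 34 / paramA m n) atTop
      (𝓝 (12 * ((e : ℝ) + 1) ^ 2 * 0 + 0)) :=
    (tendsto_paramEps.const_mul _).add ((tendsto_paramA m).const_div_atTop 34)
  rw [mul_zero, add_zero] at ht
  obtain ⟨n0, hn0⟩ := eventually_atTop.1 (ht.eventually_le_const hε)
  have hp : 0 < paramA m n0 * paramOmega m n0 := mul_pos (paramA_pos m n0) (paramOmega_pos m n0)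
  refine ⟨1 / (paramA m n0 * paramOmega m n0), by positivity, fun h hh x => ?_⟩
  rcases eq_or_ne h 0 with rfl | h0
  · simp [secondDiff, two_mul]
  obtain ⟨n, hn, h1, h2⟩ := exists_scale m n0 (norm_pos_iff.2 h0) (by
    rw [lt_div_iff₀ hp] at hh; linarith)
  refine (abs_secondDiff_limitFn_le hm n x h h1 h2).trans ?_
  gcongr
  exact hn0 n hn

/-- The limit is uniformly continuous. -/
theorem limitFn_uniform (hm : 1000 * ((e : ℝ) + 1) ^ 2 ≤ 2 ^ m) (ε : ℝ) (hε : 0 < ε) :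
    ∃ δ : ℝ, 0 < δ ∧
      ∀ x h : RSpace (e + 1), ‖h‖ < δ → |limitFn e m (x + h) - limitFn e m x| ≤ ε := by
  have ht := (tendsto_paramOmega (m := m)).const_div_atTop 8
  obtain ⟨n, hn⟩ := (ht.eventually_le_const (by positivity : 0 < ε / 4)).exists
  have hc : 8 / (paramA m n ^ 3 * paramOmega m n) ≤ ε / 4 := by
    refine le_trans ?_ hn
    have hO := paramOmega_pos m n
    gcongr
    exact le_mul_of_one_le_left hO.le (one_le_pow₀ (one_le_paramA m n))
  have hJ := (approx_hyp hm n).jet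
  have hA := paramA_pos m n
  refine ⟨ε / (2 * (((e + 1 : ℕ) : ℝ) * paramA m n)), by positivity, fun x h hh => ?_⟩
  have h1 := abs_le.1 ((abs_limitFn_sub_le hm n (x + h)).trans hc)
  have h2 := abs_le.1 ((abs_limitFn_sub_le hm n x).trans hc)
  have h3 := hJ.lipschitz x h
  have h4 : ((e + 1 : ℕ) : ℝ) * paramA m n * ‖h‖ ≤ ε / 2 := by
    rw [lt_div_iff₀ (by positivity)] at hh
    linarith
  have h5 := abs_le.1 (h3.trans h4)
  rw [abs_le]
  constructor <;> linarith [h1.1, h1.2, h2.1, h2.2, h5.1, h5.2]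

end approximations

/-! ### From bounded difference quotients to bounded gradients. -/

theorem mem_boundedDiffSet_iff {n : ℕ} {f : RSpace n → ℝ} {x : RSpace n} :
    x ∈ boundedDiffSet f ↔
      ∃ M δ : ℝ, 0 < δ ∧ ∀ h, ‖h‖ < δ → |f (x + h) - f x| ≤ M * ‖h‖ := by
  constructor
  · intro hx
    obtain ⟨M, hM1, -⟩ := ENNReal.lt_iff_exists_nnreal_btwn.1 hx
    have h := Filter.eventually_lt_of_limsup_lt hM1
    rw [eventually_nhdsWithin_iff, Metric.eventually_nhds_iff] at h
    obtain ⟨δ, hδ, hh⟩ := h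
    refine ⟨M, δ, hδ, fun t ht => ?_⟩
    rcases eq_or_ne t 0 with rfl | h0
    · simp
    have := hh (by simpa using ht) h0
    rw [ENNReal.ofReal_lt_coe_iff (by positivity), div_lt_iff₀ (norm_pos_iff.2 h0)] at this
    exact this.le
  · rintro ⟨M, δ, hδ, h⟩
    refine lt_of_le_of_lt ?_ (ENNReal.ofReal_lt_top (r := M))
    refine Filter.limsup_le_of_le (by isBoundedDefault) ?_
    rw [eventually_nhdsWithin_iff, Metric.eventually_nhds_iff]
    refine ⟨δ, hδ, fun t ht h0 => ENNReal.ofReal_le_ofReal ?_⟩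
    rw [div_le_iff₀ (norm_pos_iff.2 h0)]
    exact h t (by simpa using ht)

/-- At the points of bounded difference quotients, the gradients of the approximations are
bounded. -/
theorem gradient_bounded_of_mem {e m : ℕ} (hm : 1000 * ((e : ℝ) + 1) ^ 2 ≤ 2 ^ m)
    {x : RSpace (e + 1)} (hx : x ∈ boundedDiffSet (limitFn e m)) :
    ∃ M n0 : ℕ, ∀ n, n0 ≤ n → ∀ i, |(approx e m n).2 x i| ≤ M := by
  obtain ⟨M, δ, hδ, h⟩ := mem_boundedDiffSet_iff.1 hx
  have ht := (tendsto_paramOmega (m := m)).const_div_atTop 1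
  obtain ⟨n0, hn0⟩ := eventually_atTop.1 (ht.eventually_lt_const hδ)
  -- At the scale t = 1/Ω_n the Taylor remainder is t and the distance to the limit is at most 8t at
  -- each of the two points: 1 + 8 + 8 = 17.
  obtain ⟨K, hK⟩ := exists_nat_ge (M + 17)
  refine ⟨K, n0, fun n hn i => le_trans ?_ hK⟩
  have hO := paramOmega_pos m n
  set t := 1 / paramOmega m n with htd
  have htp : 0 < t := by positivity
  have hs : ‖(EuclideanSpace.single i t : RSpace (e + 1))‖ = t := by
    simp [abs_of_pos htp]
  have h1 := h (EuclideanSpace.single i t) (by rw [hs]; exact hn0 n hn)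
  have h2 := (approx_hyp hm n).jet.taylor x (EuclideanSpace.single i t)
  have h3 := abs_limitFn_sub_le hm n x
  have h4 := abs_limitFn_sub_le hm n (x + EuclideanSpace.single i t)
  have h5 : 8 / (paramA m n ^ 3 * paramOmega m n) ≤ 8 * t := by
    rw [htd, ← div_eq_mul_one_div]
    gcongr
    exact le_mul_of_one_le_left hO.le (one_le_pow₀ (one_le_paramA m n))
  have h6 : paramOmega m n * t ^ 2 = t := by rw [htd]; field_simp
  rw [linForm_single_right, hs, h6] at h2
  rw [hs] at h1
  have h1' := abs_le.1 h1
  have h2' := abs_le.1 h2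
  have h3' := abs_le.1 (h3.trans h5)
  have h4' := abs_le.1 (h4.trans h5)
  have h7 : |(approx e m n).2 x i * t| ≤ (M + 17) * t := by
    rw [abs_le]
    constructor <;> linarith [h1'.1, h1'.2, h2'.1, h2'.2, h3'.1, h3'.2, h4'.1, h4'.2]
  rw [abs_mul, abs_of_pos htp] at h7
  exact le_of_mul_le_mul_right h7 htp

/-! ### The dimension of the set of bounded gradients -/

theorem dimH_le_of_coverBy {n : ℕ} {A : Set (RSpace n)} {s : ℝ} (hs : 0 < s) {M ρ : ℕ → ℝ}
    {C : ℝ} (hρ0 : ∀ k, 0 < ρ k) (hρ : Tendsto ρ atTop (𝓝 0))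
    (h : ∀ᶠ k in atTop, CoverBy A (M k) (ρ k)) (hC : ∀ᶠ k in atTop, M k * ρ k ^ s ≤ C) :
    dimH A ≤ ENNReal.ofReal s := by
  classical
  borelize (RSpace n)
  -- Coverings exist only eventually, whereas a family is needed for every k; the empty family is
  -- the default.
  have hS : ∀ k, ∃ S : Finset (Set (RSpace n)), CoverBy A (M k) (ρ k) → ((S.card : ℝ) ≤ M k ∧
      A ⊆ ⋃₀ (S : Set (Set (RSpace n))) ∧ ∀ s ∈ S, ∀ x ∈ s, ∀ y ∈ s, ‖x - y‖ ≤ ρ k) := by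
    intro k
    by_cases hk : CoverBy A (M k) (ρ k)
    · obtain ⟨S, h1⟩ := hk
      exact ⟨S, fun _ => h1⟩
    · exact ⟨∅, fun h => absurd h hk⟩
  choose S hS using hS
  have hdiam : ∀ᶠ k in atTop, ∀ i : S k, Metric.ediam i.1 ≤ ENNReal.ofReal (ρ k) := by
    filter_upwards [h] with k hk i
    refine Metric.ediam_le fun x hx y hy => ?_
    rw [edist_dist, dist_eq_norm]
    exact ENNReal.ofReal_le_ofReal ((hS k hk).2.2 i.1 i.2 x hx y hy)
  have key := MeasureTheory.Measure.hausdorffMeasure_le_liminf_sum (ι := fun k => S k) s A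
    (l := atTop) (fun k => ENNReal.ofReal (ρ k))
    (by simpa using ENNReal.tendsto_ofReal hρ) (fun k i => i.1) hdiam (by
      filter_upwards [h] with k hk x hx
      obtain ⟨t, ht, hxt⟩ := (hS k hk).2.1 hx
      exact Set.mem_iUnion.2 ⟨⟨t, ht⟩, hxt⟩)
  have hle : liminf (fun k => ∑ i : S k, Metric.ediam i.1 ^ s) atTop ≤ ENNReal.ofReal C := by
    refine liminf_le_of_frequently_le' (Eventually.frequently ?_)
    filter_upwards [h, hC, hdiam] with k hk hCk hd
    calc ∑ i : S k, Metric.ediam i.1 ^ s ≤ ∑ _i : S k, ENNReal.ofReal (ρ k ^ s) := by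
          refine Finset.sum_le_sum fun i _ => ?_
          rw [← ENNReal.ofReal_rpow_of_pos (hρ0 k)]
          exact ENNReal.rpow_le_rpow (hd i) hs.le
      _ = ENNReal.ofReal ((S k).card * ρ k ^ s) := by
          rw [ENNReal.ofReal_mul (Nat.cast_nonneg _), ENNReal.ofReal_natCast]
          simp
      _ ≤ ENNReal.ofReal C := by
          refine ENNReal.ofReal_le_ofReal (le_trans ?_ hCk)
          have := (hS k hk).1
          have := (Real.rpow_pos_of_pos (hρ0 k) s).le
          gcongr
  have hne : MeasureTheory.Measure.hausdorffMeasure s A ≠ ⊤ :=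
    ne_top_of_le_ne_top ENNReal.ofReal_ne_top (key.trans hle)
  have : (s.toNNReal : ℝ) = s := Real.coe_toNNReal s hs.le
  rw [← this] at hne
  exact dimH_le_of_hausdorffMeasure_ne_top hne

/-! ### Counting the steps outside the kink sets. -/

section counting

variable {e m : ℕ}

/-- The points at which the gradients of the approximations stay bounded by `M` from the index
`n0` on. -/
def boundedGradSet (e m n0 : ℕ) (M : ℝ) : Set (RSpace (e + 1)) :=
  {x | ∀ n, n0 ≤ n → ∀ i, |(approx e m n).2 x i| ≤ M}

/-- The kink set of the `n`-th step. -/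
noncomputable def stepKink (e m n : ℕ) : Set (RSpace (e + 1)) :=
  StepHyp.kinkSet (approx e m n).1 (paramA m n) (paramOmega m n) (paramDelta m n)

open Classical in
/-- The number of steps between `n0` and `n` for which `x` is not in the kink set. -/
noncomputable def freeSteps (e m n0 n : ℕ) (x : RSpace (e + 1)) : ℕ :=
  {i ∈ Finset.Ico n0 n | x ∉ stepKink e m i}.card

theorem freeSteps_self (e m n0 : ℕ) (x : RSpace (e + 1)) : freeSteps e m n0 n0 x = 0 := by
  simp [freeSteps]

theorem freeSteps_succ_of_mem {n0 n : ℕ} (h : n0 ≤ n) {x : RSpace (e + 1)}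
    (hx : x ∈ stepKink e m n) : freeSteps e m n0 (n + 1) x = freeSteps e m n0 n x := by
  classical
  rw [freeSteps, freeSteps, ← Finset.insert_Ico_right_eq_Ico_add_one h, Finset.filter_insert,
    if_neg (not_not.2 hx)]

theorem freeSteps_succ_of_notMem {n0 n : ℕ} (h : n0 ≤ n) {x : RSpace (e + 1)}
    (hx : x ∉ stepKink e m n) : freeSteps e m n0 (n + 1) x = freeSteps e m n0 n x + 1 := by
  classical
  rw [freeSteps, freeSteps, ← Finset.insert_Ico_right_eq_Ico_add_one h, Finset.filter_insert,
    if_pos hx, Finset.card_insert_of_notMem (by simp)]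

theorem abs_lyap_le {p : Fin (e + 1) → ℝ} {M : ℝ} (hM : 0 ≤ M) (h : ∀ i, |p i| ≤ M) :
    |lyap p| ≤ (e + 1) * (1 + M) := by
  have h1 : |∑ j : Fin e, √(1 + p j.succ ^ 2)| ≤ e * (1 + M) := by
    refine (Finset.abs_sum_le_sum_abs _ _).trans ?_
    refine (Finset.sum_le_sum (g := fun _ => 1 + M) fun j _ => ?_).trans (le_of_eq (by simp; ring))
    rw [abs_of_nonneg (Real.sqrt_nonneg _), Real.sqrt_le_left (by linarith)]
    have := sq_le_sq' (by linarith [(abs_le.1 (h j.succ)).1]) (abs_le.1 (h j.succ)).2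
    nlinarith
  refine (abs_add_le _ _).trans ?_
  linarith [h 0]

/-- A point of bounded gradients is in most of the kink sets. -/
theorem freeSteps_le (hm : 1000 * ((e : ℝ) + 1) ^ 2 ≤ 2 ^ m) {M : ℝ} (hM : 0 ≤ M) (n0 : ℕ) :
    ∃ C : ℝ, 0 ≤ C ∧ ∀ x ∈ boundedGradSet e m n0 M, ∀ n, n0 ≤ n →
      (freeSteps e m n0 n x : ℝ) ≤ C * √((n : ℝ) + 1) := by
  refine ⟨(2 * ((e + 1) * (1 + M)) + 2) * (8 * (1 + M) ^ 3), by positivity, fun x hx n hn => ?_⟩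
  -- The gain of each free step is bounded below by that of step n, the smallest one. The losses are
  -- at most (1/2)^k at step k, and their sum is tracked by 2(1 - (1/2)^k).
  have hstep : ∀ k, n0 ≤ k → k ≤ n →
      paramEps n ^ 2 / (8 * (1 + M) ^ 3) * freeSteps e m n0 k x - 2 * (1 - (1 / 2) ^ k) ≤
        lyap ((approx e m k).2 x) - lyap ((approx e m n0).2 x) := by
    intro k hk
    induction k, hk using Nat.le_induction with
    | base =>
      intro _
      rw [freeSteps_self]
      have : (1 / 2 : ℝ) ^ n0 ≤ 1 := pow_le_one₀ (by norm_num) (by norm_num)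
      rw [Nat.cast_zero, mul_zero, sub_self]
      linarith
    | succ k hk ih =>
      intro hkn
      have ih := ih (by omega)
      have H := approx_hyp hm k
      have herr : 41 * ((e : ℝ) + 1) ^ 2 / paramA m k ≤ (1 / 2) ^ k := by
        rw [div_le_iff₀ (paramA_pos m k), paramA, pow_add, ← mul_assoc, ← mul_pow]
        norm_num
        nlinarith [sq_nonneg ((e : ℝ) + 1)]
      have hpow : (1 / 2 : ℝ) ^ (k + 1) = (1 / 2) ^ k / 2 := by rw [pow_succ]; ring
      have hval : (approx e m (k + 1)).2 x = (approx e m k).2 x + stepGrad (approx e m k).1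
          (approx e m k).2 (paramA m k) (paramOmega m k) (paramEps k) (paramDelta m k) x := rfl
      by_cases hxk : x ∈ stepKink e m k
      · rw [freeSteps_succ_of_mem hk hxk, hpow, hval]
        have := H.lyap_step_ge x
        linarith
      · rw [freeSteps_succ_of_notMem hk hxk, hpow, hval]
        have h1 := H.lyap_step_ge_of_notMem hxk hM (hx k hk) (by
          rw [← hval]; exact hx (k + 1) (by omega))
        have h2 : paramEps n ^ 2 / (8 * (1 + M) ^ 3) ≤ paramEps k ^ 2 / (8 * (1 + M) ^ 3) := by
          have := (paramEps_pos n).le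
          have := paramEps_antitone (by omega : k ≤ n)
          gcongr
        push_cast
        linarith
  have h1 := hstep n hn le_rfl
  have h2 := abs_le.1 (abs_lyap_le hM (hx n hn))
  have h3 := abs_le.1 (abs_lyap_le hM (hx n0 le_rfl))
  have h4 : (0 : ℝ) ≤ (1 / 2) ^ n := by positivity
  have hs : 0 < √((n : ℝ) + 1) := Real.sqrt_pos.2 (by positivity)
  rw [paramEps_sq] at h1
  have h5 : 1 / √((n : ℝ) + 1) / (8 * (1 + M) ^ 3) * freeSteps e m n0 n x ≤
      2 * ((e + 1) * (1 + M)) + 2 := by linarith [h2.1, h2.2, h3.1, h3.2]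
  have e1 : (freeSteps e m n0 n x : ℝ) = (1 / √((n : ℝ) + 1) / (8 * (1 + M) ^ 3) *
      freeSteps e m n0 n x) * (8 * (1 + M) ^ 3) * √((n : ℝ) + 1) := by
    field_simp
  rw [e1]
  gcongr

/-- Covering the points with at most `k` free steps. -/
theorem cover_freeSteps (hm : 1000 * ((e : ℝ) + 1) ^ 2 ≤ 2 ^ m) {A : Set (RSpace (e + 1))} {n0 : ℕ}
    {C : ℝ} (hA : CoverBy A C (1 / paramOmega m n0)) {n : ℕ} (hn : n0 ≤ n) {D : ℝ}
    (hD1 : 1 ≤ D) (hD : ∀ i < n, 1 / paramDelta m i ^ e ≤ D) (k : ℕ) :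
    CoverBy {x ∈ A | freeSteps e m n0 n x ≤ k}
      (C * (∏ i ∈ Finset.Ico n0 n, 2 * (paramA m i ^ (14 * (e + 1)) / paramDelta m i)) * D ^ k)
      (1 / paramOmega m n) := by
  have hC := hA.nonneg
  induction n, hn using Nat.le_induction generalizing k with
  | base =>
    refine hA.mono (fun x hx => hx.1) ?_
    simp only [Finset.Ico_self, Finset.prod_empty, mul_one]
    exact le_mul_of_one_le_right hC (one_le_pow₀ hD1)
  | succ n hn ih =>
    have ih := ih fun i hi => hD i (by omega)
    have H := approx_hyp hm n
    have hδ := paramDelta_pos m n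
    have ha := paramA_pos m n
    have hΩ := paramOmega_pos m n
    set P := ∏ i ∈ Finset.Ico n0 n, 2 * (paramA m i ^ (14 * (e + 1)) / paramDelta m i) with hP
    have hP0 : 0 ≤ P := Finset.prod_nonneg fun i _ => by
      have := paramDelta_pos m i
      have := paramA_pos m i
      positivity
    set B := paramA m n ^ (14 * (e + 1)) / paramDelta m n with hB
    have hB0 : 0 ≤ B := by positivity
    have hD0 : 0 ≤ D := by linarith
    have hBD : paramA m n ^ (14 * (e + 1)) / paramDelta m n ^ (e + 1) =
        B * (1 / paramDelta m n ^ e) := by rw [hB, pow_succ]; field_simp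
    have hΩ' : 1 / paramOmega m (n + 1) = paramDelta m n / (paramA m n ^ 7 * paramOmega m n) := by
      rw [paramOmega, one_div_div]
    rw [← Finset.insert_Ico_right_eq_Ico_add_one hn, Finset.prod_insert (by simp), ← hP, ← hB, hΩ']
    clear_value P B
    have hkink : ∀ k, CoverBy ({x ∈ A | freeSteps e m n0 n x ≤ k} ∩ stepKink e m n)
        (C * P * D ^ k * B) (paramDelta m n / (paramA m n ^ 7 * paramOmega m n)) := fun k => by
      refine CoverBy.trans ((ih k).mono Set.inter_subset_left le_rfl) hB0 fun C' hC' hd => ?_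
      exact (H.cover_kink hd).mono (fun x hx => ⟨hx, (hC' hx).2⟩) hB.ge
    have hall : ∀ k, CoverBy {x ∈ A | freeSteps e m n0 n x ≤ k}
        (C * P * D ^ k * (B * D)) (paramDelta m n / (paramA m n ^ 7 * paramOmega m n)) := fun k => by
      refine CoverBy.trans (ih k) (mul_nonneg hB0 hD0) fun C' _ hd => ?_
      refine (H.cover_all hd).mono subset_rfl ?_
      calc paramA m n ^ (14 * (e + 1)) / paramDelta m n ^ (e + 1)
          = B * (1 / paramDelta m n ^ e) := hBD
        _ ≤ B * D := mul_le_mul_of_nonneg_left (hD n (by omega)) hB0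
    cases k with
    | zero =>
      refine (hkink 0).mono ?_ ?_
      · rintro x ⟨hxA, hx⟩
        by_cases hk : x ∈ stepKink e m n
        · rw [freeSteps_succ_of_mem hn hk] at hx
          exact ⟨⟨hxA, hx⟩, hk⟩
        · rw [freeSteps_succ_of_notMem hn hk] at hx
          omega
      · have : 0 ≤ C * P * B := mul_nonneg (mul_nonneg hC hP0) hB0
        simp only [pow_zero, mul_one]
        linarith
    | succ k =>
      -- Either the last step lies in the kink set and costs B, or it uses up one free step and
      -- costs BD. Both alternatives give the same count, hence the factor 2 per step in the
      -- product.
      refine ((hkink (k + 1)).union (hall k)).mono ?_ (le_of_eq ?_)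
      · rintro x ⟨hxA, hx⟩
        by_cases hk : x ∈ stepKink e m n
        · rw [freeSteps_succ_of_mem hn hk] at hx
          exact Or.inl ⟨⟨hxA, hx⟩, hk⟩
        · rw [freeSteps_succ_of_notMem hn hk] at hx
          exact Or.inr ⟨hxA, by omega⟩
      · ring

/-- The quadratic terms sum to about -t n³/3, which beats both the linear terms, of order n², and
the free steps, of order n² √n. -/
theorem eventually_growth {t c C : ℝ} (ht : 0 < t) (hC : 0 ≤ C) (e m n0 : ℕ) :
    ∀ᶠ n : ℕ in atTop, ∑ i ∈ Finset.Ico n0 n, (1 + c * (i + m : ℝ) - t * (i + m : ℝ) ^ 2) +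
      e * (n + m : ℝ) ^ 2 * (C * √((n : ℝ) + 1)) ≤ 0 := by
  set K := 1 + c ^ 2 / (2 * t) with hK
  have hK0 : 0 ≤ K := by positivity
  have hterm : ∀ i : ℕ, 1 + c * (i + m : ℝ) - t * (i + m : ℝ) ^ 2 ≤ K - t / 2 * (i : ℝ) ^ 2 := by
    intro i
    have h1 : c * (i + m : ℝ) ≤ c ^ 2 / (2 * t) + t / 2 * (i + m : ℝ) ^ 2 := by
      have e1 : c ^ 2 / (2 * t) + t / 2 * (i + m : ℝ) ^ 2 - c * (i + m : ℝ) =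
        (c - t * (i + m)) ^ 2 / (2 * t) := by field_simp; ring
      have : 0 ≤ (c - t * (i + m)) ^ 2 / (2 * t) := by positivity
      linarith
    have h2 : (i : ℝ) ^ 2 ≤ (i + m : ℝ) ^ 2 := by gcongr; linarith [Nat.cast_nonneg (α := ℝ) m]
    have := mul_le_mul_of_nonneg_left h2 (by positivity : 0 ≤ t / 2)
    rw [hK]
    linarith
  -- The sum of squares is compared with the telescoping differences of (n - 1)³, so no closed
  -- formula is needed.
  have hsum : ∀ n, n0 ≤ n → ∑ i ∈ Finset.Ico n0 n, (1 + c * (i + m : ℝ) - t * (i + m : ℝ) ^ 2) ≤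
      (K + t) * (n - n0) - t / 6 * ((n : ℝ) - 1) ^ 3 + t / 6 * ((n0 : ℝ) - 1) ^ 3 := by
    intro n hn
    induction n, hn using Nat.le_induction with
    | base => simp
    | succ n hn ih =>
      rw [Finset.sum_Ico_succ_top hn]
      have h1 := hterm n
      have h2 : (0 : ℝ) ≤ n := Nat.cast_nonneg n
      push_cast
      nlinarith [mul_nonneg ht.le h2]
  obtain ⟨T1, hT1⟩ := exists_nat_ge ((K + t + t * (n0 : ℝ) ^ 3) * 96 / t)
  obtain ⟨T2, hT2⟩ := exists_nat_ge (2 * (4 * e * C * 96 / t) ^ 2)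
  filter_upwards [eventually_ge_atTop T1, eventually_ge_atTop T2, eventually_ge_atTop n0,
    eventually_ge_atTop m, eventually_ge_atTop 2] with n h1 h2 h3 h4 h5
  have hn2 : (2 : ℝ) ≤ n := by exact_mod_cast h5
  have hnm : (m : ℝ) ≤ n := by exact_mod_cast h4
  have hn1 : (K + t + t * (n0 : ℝ) ^ 3) * 96 / t ≤ n := hT1.trans (by exact_mod_cast h1)
  have hn3 : 2 * (4 * e * C * 96 / t) ^ 2 ≤ n := hT2.trans (by exact_mod_cast h2)
  have hm0 : (0 : ℝ) ≤ m := Nat.cast_nonneg m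
  have hn00 : (0 : ℝ) ≤ n0 := Nat.cast_nonneg n0
  refine (add_le_add_left (hsum n h3) _).trans ?_
  have b1 : e * (n + m : ℝ) ^ 2 * (C * √((n : ℝ) + 1)) ≤ t / 96 * (n : ℝ) ^ 3 := by
    have hs : (4 * e * C * 96 / t) * √((n : ℝ) + 1) ≤ n := by
      refine (sq_le_sq₀ (by positivity) (by positivity)).1 ?_
      rw [mul_pow, Real.sq_sqrt (by positivity)]
      nlinarith [sq_nonneg (4 * e * C * 96 / t)]
    have hs' : 4 * e * C * √((n : ℝ) + 1) ≤ t / 96 * n := by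
      have e1 : 4 * e * C * √((n : ℝ) + 1) = t / 96 * ((4 * e * C * 96 / t) * √((n : ℝ) + 1)) := by
        field_simp
      rw [e1]
      gcongr
    have hsq : (n + m : ℝ) ^ 2 ≤ 4 * (n : ℝ) ^ 2 := by nlinarith
    calc e * (n + m : ℝ) ^ 2 * (C * √((n : ℝ) + 1))
        ≤ e * (4 * (n : ℝ) ^ 2) * (C * √((n : ℝ) + 1)) := by gcongr
      _ = (4 * e * C * √((n : ℝ) + 1)) * (n : ℝ) ^ 2 := by ring
      _ ≤ (t / 96 * n) * (n : ℝ) ^ 2 := by gcongr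
      _ = _ := by ring
  have b2 : (K + t) * (n - n0) + t / 6 * ((n0 : ℝ) - 1) ^ 3 ≤ t / 96 * (n : ℝ) ^ 3 := by
    rw [div_le_iff₀ ht] at hn1
    have h6 : t / 6 * ((n0 : ℝ) - 1) ^ 3 ≤ t * (n0 : ℝ) ^ 3 := by
      have : ((n0 : ℝ) - 1) ^ 3 ≤ (n0 : ℝ) ^ 3 := by nlinarith [sq_nonneg ((n0 : ℝ) - 1)]
      nlinarith [mul_le_mul_of_nonneg_left this ht.le, mul_nonneg ht.le (pow_nonneg hn00 3)]
    have h7 : (K + t + t * (n0 : ℝ) ^ 3) * n ≤ t / 96 * n * n := by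
      have : K + t + t * (n0 : ℝ) ^ 3 ≤ t / 96 * n := by linarith
      gcongr
    have h8 : t / 96 * n * n * 1 ≤ t / 96 * n * n * n := by gcongr; linarith
    have h9 : 0 ≤ (K + t) * n0 := by positivity
    have h10 : t * (n0 : ℝ) ^ 3 * 1 ≤ t * (n0 : ℝ) ^ 3 * n := by gcongr; linarith
    nlinarith
  have b3 : t / 48 * (n : ℝ) ^ 3 ≤ t / 6 * ((n : ℝ) - 1) ^ 3 := by
    have : (n / 2 : ℝ) ^ 3 ≤ (n - 1 : ℝ) ^ 3 := by gcongr; linarith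
    have := mul_le_mul_of_nonneg_left this (by positivity : 0 ≤ t / 6)
    nlinarith
  linarith

end counting

/-! ### The upper bound for the dimension. -/

section dimension

variable {e m : ℕ}

theorem paramA_eq_rpow (m n : ℕ) : paramA m n = (2 : ℝ) ^ ((n : ℝ) + m) := by
  rw [paramA, ← Nat.cast_add, Real.rpow_natCast]

theorem paramDelta_inv_eq_rpow (m n : ℕ) :
    1 / paramDelta m n = (2 : ℝ) ^ (((n : ℝ) + m) ^ 2) := by
  rw [paramDelta, ← Nat.cast_add, ← Nat.cast_pow, Real.rpow_natCast]
  simp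

theorem rpow_sum_le_paramOmega (m n0 n : ℕ) (h : n0 ≤ n) :
    (2 : ℝ) ^ (∑ i ∈ Finset.Ico n0 n, ((i : ℝ) + m) ^ 2) ≤ paramOmega m n := by
  induction n, h using Nat.le_induction with
  | base => simpa using one_le_paramOmega m n0
  | succ n hn ih =>
    rw [Finset.sum_Ico_succ_top hn, Real.rpow_add two_pos, ← paramDelta_inv_eq_rpow, paramOmega,
      div_eq_mul_one_div (paramA m n ^ 7 * paramOmega m n)]
    have h1 : 1 ≤ paramA m n ^ 7 := one_le_pow₀ (one_le_paramA m n)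
    have h2 := paramOmega_pos m n
    have h3 := paramDelta_pos m n
    gcongr
    nlinarith

theorem paramDelta_antitone (m : ℕ) : Antitone (paramDelta m) := fun n k h =>
  pow_le_pow_of_le_one (by norm_num) (by norm_num) (Nat.pow_le_pow_left (by omega) 2)

/-- All factors are written as powers of 2. The kink coverings contribute Σ (i + m)² up to linear
terms, the free steps at most e(n + m)² C√(n + 1), and the diameters to the power s at most -s Σ (i
+ m)². What remains is -(s - 1) Σ (i + m)² plus lower order. -/
theorem dimH_boundedGradSet_inter_le (hm : 1000 * ((e : ℝ) + 1) ^ 2 ≤ 2 ^ m) {M : ℝ} (hM : 0 ≤ M)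
    (n0 : ℕ) {R : ℝ} (hR : 0 ≤ R) {s : ℝ} (hs : 1 < s) :
    dimH (boundedGradSet e m n0 M ∩ Metric.closedBall 0 R) ≤ ENNReal.ofReal s := by
  obtain ⟨C, hC0, hC⟩ := freeSteps_le hm hM n0
  set A := boundedGradSet e m n0 M ∩ Metric.closedBall 0 R with hA
  have hΩ0 := paramOmega_pos m n0
  have hcov : CoverBy A _ (1 / paramOmega m n0) :=
    CoverBy.subdivide (R := 2 * R) (by positivity) (by positivity) fun x hx y hy => by
      have h1 : ‖x‖ ≤ R := by simpa using hx.2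
      have h2 : ‖y‖ ≤ R := by simpa using hy.2
      linarith [norm_sub_le x y]
  set C0 := (2 * (((e + 1 : ℕ) : ℝ) * (2 * R) / (1 / paramOmega m n0)) + 3) ^ (e + 1) with hC0d
  have hC00 : 0 ≤ C0 := hcov.nonneg
  clear_value C0
  refine dimH_le_of_coverBy (by linarith)
    (M := fun n => C0 * (∏ i ∈ Finset.Ico n0 n, 2 * (paramA m i ^ (14 * (e + 1)) / paramDelta m i)) *
      (1 / paramDelta m n ^ e) ^ ⌊C * √((n : ℝ) + 1)⌋₊)
    (ρ := fun n => 1 / paramOmega m n) (C := C0)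
    (fun k => by have := paramOmega_pos m k; positivity) (tendsto_paramOmega.const_div_atTop 1) ?_ ?_
  · filter_upwards [eventually_ge_atTop n0] with n hn
    refine (cover_freeSteps hm hcov hn (D := 1 / paramDelta m n ^ e) ?_ ?_
      ⌊C * √((n : ℝ) + 1)⌋₊).mono ?_ le_rfl
    · rw [one_le_div (pow_pos (paramDelta_pos m n) e)]
      exact pow_le_one₀ (paramDelta_pos m n).le (paramDelta_le_one m n)
    · intro i hi
      have h1 := paramDelta_pos m n
      have h2 := paramDelta_antitone m hi.le
      gcongr
    · intro x hx
      exact ⟨hx, Nat.le_floor (hC x hx.1 n hn)⟩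
  · filter_upwards [eventually_ge_atTop n0,
      eventually_growth (t := s - 1) (c := 14 * ((e : ℝ) + 1)) (by linarith) hC0 e m n0] with n hn hg
    have hprod : (∏ i ∈ Finset.Ico n0 n, 2 * (paramA m i ^ (14 * (e + 1)) / paramDelta m i)) =
        (2 : ℝ) ^ (∑ i ∈ Finset.Ico n0 n,
          (1 + 14 * ((e : ℝ) + 1) * ((i : ℝ) + m) + ((i : ℝ) + m) ^ 2)) := by
      rw [Real.rpow_sum_of_pos two_pos]
      refine Finset.prod_congr rfl fun i _ => ?_
      rw [Real.rpow_add two_pos, Real.rpow_add two_pos, Real.rpow_one, ← paramDelta_inv_eq_rpow,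
        mul_comm (14 * ((e : ℝ) + 1)), Real.rpow_mul two_pos.le, ← paramA_eq_rpow,
        ← Real.rpow_natCast]
      push_cast
      ring
    have hpow : (1 / paramDelta m n ^ e) ^ ⌊C * √((n : ℝ) + 1)⌋₊ ≤
        (2 : ℝ) ^ (e * ((n : ℝ) + m) ^ 2 * (C * √((n : ℝ) + 1))) := by
      rw [← one_div_pow, paramDelta_inv_eq_rpow, ← pow_mul, ← Real.rpow_natCast,
        ← Real.rpow_mul two_pos.le]
      refine Real.rpow_le_rpow_of_exponent_le one_le_two ?_
      push_cast
      have h1 := Nat.floor_le (by positivity : 0 ≤ C * √((n : ℝ) + 1))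
      calc _ = e * ((n : ℝ) + m) ^ 2 * (⌊C * √((n : ℝ) + 1)⌋₊ : ℝ) := by ring
        _ ≤ _ := by gcongr
    have hom : (1 / paramOmega m n) ^ s ≤
        (2 : ℝ) ^ (-(s * ∑ i ∈ Finset.Ico n0 n, ((i : ℝ) + m) ^ 2)) := by
      have h1 := rpow_sum_le_paramOmega m n0 n hn
      rw [Real.rpow_neg two_pos.le, mul_comm s, Real.rpow_mul two_pos.le, one_div,
        Real.inv_rpow (paramOmega_pos m n).le]
      gcongr
    have hd := paramDelta_pos m n
    have ho := paramOmega_pos m n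
    rw [hprod, mul_assoc, mul_assoc]
    calc _ ≤ C0 * ((2 : ℝ) ^ (∑ i ∈ Finset.Ico n0 n,
          (1 + 14 * ((e : ℝ) + 1) * ((i : ℝ) + m) + ((i : ℝ) + m) ^ 2)) *
          ((2 : ℝ) ^ (e * ((n : ℝ) + m) ^ 2 * (C * √((n : ℝ) + 1))) *
          (2 : ℝ) ^ (-(s * ∑ i ∈ Finset.Ico n0 n, ((i : ℝ) + m) ^ 2)))) := by
          gcongr
      _ = C0 * (2 : ℝ) ^ (∑ i ∈ Finset.Ico n0 n, (1 + 14 * ((e : ℝ) + 1) * (i + m : ℝ) -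
          (s - 1) * (i + m : ℝ) ^ 2) + e * (n + m : ℝ) ^ 2 * (C * √((n : ℝ) + 1))) := by
          rw [← Real.rpow_add two_pos, ← Real.rpow_add two_pos]
          congr 2
          simp only [Finset.sum_add_distrib, Finset.sum_sub_distrib, ← Finset.mul_sum]
          ring
      _ ≤ C0 * 1 := by
          gcongr
          exact Real.rpow_le_one_of_one_le_of_nonpos one_le_two hg
      _ = C0 := mul_one _

/-- The gradient bound, the starting index and the radius can all be taken to be natural numbers, so
countable stability of the Hausdorff dimension applies. -/
theorem dimH_boundedDiffSet_limitFn_le (hm : 1000 * ((e : ℝ) + 1) ^ 2 ≤ 2 ^ m) :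
    dimH (boundedDiffSet (limitFn e m)) ≤ 1 := by
  have hsub : boundedDiffSet (limitFn e m) ⊆ ⋃ M : ℕ, ⋃ n0 : ℕ, ⋃ R : ℕ,
      boundedGradSet e m n0 M ∩ Metric.closedBall 0 (R : ℝ) := by
    intro x hx
    obtain ⟨M, n0, h⟩ := gradient_bounded_of_mem hm hx
    obtain ⟨R, hR⟩ := exists_nat_ge ‖x‖
    simp only [Set.mem_iUnion]
    exact ⟨M, n0, R, h, by simpa using hR⟩
  refine (dimH_mono hsub).trans ?_
  simp only [dimH_iUnion, iSup_le_iff]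
  intro M n0 R
  refine ENNReal.le_of_forall_pos_le_add fun ε hε _ => ?_
  refine (dimH_boundedGradSet_inter_le hm (Nat.cast_nonneg M) n0 (Nat.cast_nonneg R)
    (s := 1 + ε) (by simpa using hε)).trans (le_of_eq ?_)
  rw [ENNReal.ofReal_add zero_le_one ε.coe_nonneg, ENNReal.ofReal_one, ENNReal.ofReal_coe_nnreal]

end dimension

/-! ### A weight vanishing on a family of lines -/

/-- A smooth bounded weight, vanishing on a countable family of parallel lines. -/
noncomputable def lineWeight {e : ℕ} (x : RSpace (e + 1)) : ℝ :=
  ∑ j : Fin e, (1 - Real.cos (x j.succ))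

theorem lineWeight_mem {e : ℕ} (x : RSpace (e + 1)) : |lineWeight x| ≤ 2 * e := by
  refine (Finset.abs_sum_le_sum_abs _ _).trans ?_
  refine (Finset.sum_le_sum (g := fun _ => 2) fun j _ => ?_).trans (le_of_eq (by simp [mul_comm]))
  rw [abs_le]
  constructor <;> linarith [Real.neg_one_le_cos (x j.succ), Real.cos_le_one (x j.succ)]

theorem lineWeight_lipschitz {e : ℕ} (x h : RSpace (e + 1)) :
    |lineWeight (x + h) - lineWeight x| ≤ e * ‖h‖ := by
  rw [lineWeight, lineWeight, ← Finset.sum_sub_distrib]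
  refine (Finset.abs_sum_le_sum_abs _ _).trans ?_
  refine (Finset.sum_le_sum (g := fun _ => ‖h‖) fun j _ => ?_).trans (le_of_eq (by simp))
  have h1 := Real.abs_cos_sub_cos_le (x j.succ) (x j.succ + h j.succ)
  have h2 := abs_apply_le_norm h j.succ
  rw [sub_sub_sub_cancel_left, PiLp.add_apply]
  refine h1.trans (le_trans (le_of_eq ?_) h2)
  rw [sub_add_cancel_left, abs_neg]

theorem lineWeight_secondDiff {e : ℕ} (x h : RSpace (e + 1)) :
    |secondDiff lineWeight x h| ≤ e * ‖h‖ ^ 2 := by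
  have e1 : secondDiff lineWeight x h =
      ∑ j : Fin e, 2 * Real.cos (x j.succ) * (1 - Real.cos (h j.succ)) := by
    simp only [secondDiff, lineWeight, Finset.mul_sum, ← Finset.sum_add_distrib,
      ← Finset.sum_sub_distrib]
    refine Finset.sum_congr rfl fun j _ => ?_
    rw [PiLp.add_apply, PiLp.sub_apply, Real.cos_add, Real.cos_sub]
    ring
  rw [e1]
  refine (Finset.abs_sum_le_sum_abs _ _).trans ?_
  refine (Finset.sum_le_sum (g := fun _ => ‖h‖ ^ 2) fun j _ => ?_).trans (le_of_eq (by simp))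
  have h1 := Real.abs_cos_le_one (x j.succ)
  have h2 := Real.one_sub_sq_div_two_le_cos (x := h j.succ)
  have h3 := Real.cos_le_one (h j.succ)
  have h4 : h j.succ ^ 2 ≤ ‖h‖ ^ 2 := by
    rw [← sq_abs]
    exact pow_le_pow_left₀ (abs_nonneg _) (abs_apply_le_norm h j.succ) 2
  rw [abs_mul, abs_mul, abs_of_nonneg (by linarith : 0 ≤ 1 - Real.cos (h j.succ)),
    abs_of_pos (by norm_num : (0 : ℝ) < 2)]
  calc 2 * |Real.cos (x j.succ)| * (1 - Real.cos (h j.succ)) ≤ 2 * 1 * (h j.succ ^ 2 / 2) := by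
        gcongr
        linarith
    _ ≤ _ := by linarith

/-- A line parallel to the first coordinate axis. -/
noncomputable def lineAt {e : ℕ} (k : Fin e → ℤ) (t : ℝ) : RSpace (e + 1) :=
  WithLp.toLp 2 (Fin.cons t fun j => (k j : ℝ) * (2 * Real.pi))

theorem isometry_lineAt {e : ℕ} (k : Fin e → ℤ) : Isometry (lineAt k) := by
  refine Isometry.of_dist_eq fun s t => ?_
  rw [EuclideanSpace.dist_eq, Fin.sum_univ_succ]
  simp [lineAt, Real.sqrt_sq_eq_abs, Real.dist_eq]

theorem lineWeight_eq_zero_iff {e : ℕ} {x : RSpace (e + 1)} :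
    lineWeight x = 0 ↔ ∃ k, x ∈ Set.range (lineAt k) := by
  rw [lineWeight, Finset.sum_eq_zero_iff_of_nonneg
    fun j _ => by linarith [Real.cos_le_one (x j.succ)]]
  constructor
  · intro h
    have h' : ∀ j : Fin e, ∃ n : ℤ, (n : ℝ) * (2 * Real.pi) = x j.succ := fun j =>
      (Real.cos_eq_one_iff _).1 (by linarith [h j (Finset.mem_univ j)])
    choose k hk using h'
    refine ⟨k, x 0, ?_⟩
    ext i
    refine Fin.cases ?_ (fun j => ?_) i
    · simp [lineAt]
    · simpa [lineAt] using hk j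
  · rintro ⟨k, t, rfl⟩ j -
    have : Real.cos ((lineAt k t) j.succ) = 1 := (Real.cos_eq_one_iff _).2 ⟨k j, by simp [lineAt]⟩
    rw [this, sub_self]

theorem dimH_range_lineAt {e : ℕ} (k : Fin e → ℤ) : dimH (Set.range (lineAt k)) = 1 := by
  rw [← Set.image_univ, (isometry_lineAt k).dimH_image, Real.dimH_univ]

/-! ### The weighted limit function. -/

theorem theorem2 (d : ℕ) (hd : 1 ≤ d) :
    ∃ f : EuclideanSpace ℝ (Fin d) → ℝ,
      IsSmallZygmund f ∧ dimH (boundedDiffSet f) = 1 := by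
  obtain ⟨e, rfl⟩ : ∃ e, d = e + 1 := ⟨d - 1, by omega⟩
  obtain ⟨m, hm'⟩ := pow_unbounded_of_one_lt (1000 * ((e : ℝ) + 1) ^ 2) (one_lt_two)
  have hm := hm'.le
  set F := limitFn e m with hF
  have hFb : ∀ x, |F x| ≤ 8 := abs_limitFn_le hm
  have he : (0 : ℝ) ≤ e := Nat.cast_nonneg e
  set f : RSpace (e + 1) → ℝ := fun x => lineWeight x * F x with hf
  have hfb : ∀ x, |f x| ≤ 16 * e := fun x => by
    rw [hf, abs_mul]
    calc _ ≤ 2 * (e : ℝ) * 8 := mul_le_mul (lineWeight_mem x) (hFb x) (abs_nonneg _) (by positivity)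
      _ = _ := by ring
  have hsmall : ∀ ε : ℝ, 0 < ε → ∃ δ : ℝ, 0 < δ ∧
      ∀ h : RSpace (e + 1), ‖h‖ < δ → ∀ x, |secondDiff f x h| ≤ ε * ‖h‖ := by
    intro ε hε
    -- The three terms of the product formula below cost 2e, 2e and e multiples of η‖h‖.
    set η := ε / (5 * (e + 1)) with hη
    have hη0 : 0 < η := by positivity
    obtain ⟨δ1, hδ1, h1⟩ := limitFn_small hm η hη0
    obtain ⟨δ2, hδ2, h2⟩ := limitFn_uniform hm η hη0
    refine ⟨min δ1 (min δ2 (η / 8)), by positivity, fun h hh x => ?_⟩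
    rw [lt_min_iff, lt_min_iff] at hh
    -- Leibniz rule for second differences. F is not Lipschitz, so the cross term is controlled by
    -- the Lipschitz weight times the uniform continuity of F.
    have e1 : secondDiff f x h = lineWeight x * secondDiff F x h +
        (lineWeight (x + h) - lineWeight x) * (F (x + h) - F (x - h)) +
        F (x - h) * secondDiff lineWeight x h := by
      simp only [secondDiff, hf]; ring
    have b0 : |F (x + h) - F (x - h)| ≤ 2 * η := by
      have c1 := abs_le.1 (h2 x h hh.2.1)
      have c2 := abs_le.1 (h2 x (-h) (by simpa using hh.2.1))
      rw [← sub_eq_add_neg] at c2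
      rw [abs_le]
      constructor <;> linarith [c1.1, c1.2, c2.1, c2.2]
    have b1 : |lineWeight x * secondDiff F x h| ≤ 2 * e * (η * ‖h‖) := by
      rw [abs_mul]
      exact mul_le_mul (lineWeight_mem x) (h1 h hh.1 x) (abs_nonneg _) (by positivity)
    have b2 : |(lineWeight (x + h) - lineWeight x) * (F (x + h) - F (x - h))| ≤
        e * ‖h‖ * (2 * η) := by
      rw [abs_mul]
      exact mul_le_mul (lineWeight_lipschitz x h) b0 (abs_nonneg _) (by positivity)
    have b3 : |F (x - h) * secondDiff lineWeight x h| ≤ 8 * (e * ‖h‖ ^ 2) := by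
      rw [abs_mul]
      exact mul_le_mul (hFb _) (lineWeight_secondDiff x h) (abs_nonneg _) (by norm_num)
    have b4 : 8 * ((e : ℝ) * ‖h‖ ^ 2) ≤ e * (η * ‖h‖) := by
      have : 8 * ‖h‖ ≤ η := by linarith [hh.2.2]
      calc 8 * ((e : ℝ) * ‖h‖ ^ 2) = e * ((8 * ‖h‖) * ‖h‖) := by ring
        _ ≤ _ := by gcongr
    rw [e1]
    refine (abs_add_three _ _ _).trans ?_
    calc _ ≤ 5 * e * (η * ‖h‖) := by linarith
      _ ≤ 5 * (e + 1) * (η * ‖h‖) := by gcongr; linarith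
      _ = ε * ‖h‖ := by rw [hη]; field_simp
  have hFc : Continuous F := by
    rw [Metric.continuous_iff]
    intro x ε hε
    obtain ⟨δ, hδ, h⟩ := limitFn_uniform hm (ε / 2) (by positivity)
    refine ⟨δ, hδ, fun y hy => ?_⟩
    have := h x (y - x) (by rwa [dist_eq_norm] at hy)
    rw [add_sub_cancel] at this
    rw [Real.dist_eq]
    exact this.trans_lt (by linarith)
  have hwc : Continuous (lineWeight (e := e)) := by
    unfold lineWeight
    fun_prop
  refine ⟨f, ⟨⟨hwc.mul hFc, ⟨16 * e, hfb⟩, ?_⟩, hsmall⟩, le_antisymm ?_ ?_⟩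
  -- Small steps are covered by the small Zygmund estimate with ε = 1; for steps of norm at least δ
  -- the bound 4 · 16e on the second difference suffices.
  · obtain ⟨δ, hδ, h⟩ := hsmall 1 one_pos
    refine ⟨1 + 64 * e / δ, fun x t => ?_⟩
    rcases lt_or_ge ‖t‖ δ with ht | ht
    · refine (h t ht x).trans ?_
      gcongr
      have : 0 ≤ 64 * e / δ := by positivity
      linarith
    · have h1 : |secondDiff f x t| ≤ 64 * e := by
        have c1 := abs_le.1 (hfb (x + t))
        have c2 := abs_le.1 (hfb (x - t))
        have c3 := abs_le.1 (hfb x)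
        rw [secondDiff, abs_le]
        constructor <;> linarith [c1.1, c1.2, c2.1, c2.2, c3.1, c3.2]
      have h2 : 64 * e ≤ 64 * e / δ * ‖t‖ := by
        rw [div_mul_eq_mul_div, le_div_iff₀ hδ]
        gcongr
      linarith [norm_nonneg t]
  · have hsub : boundedDiffSet f ⊆ (⋃ k : Fin e → ℤ, Set.range (lineAt k)) ∪ boundedDiffSet F := by
      intro x hx
      by_cases h0 : lineWeight x = 0
      · left
        obtain ⟨k, hk⟩ := lineWeight_eq_zero_iff.1 h0
        exact Set.mem_iUnion.2 ⟨k, hk⟩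
      right
      obtain ⟨M, δ, hδ, h⟩ := mem_boundedDiffSet_iff.1 hx
      refine mem_boundedDiffSet_iff.2 ⟨(M + 8 * e) / |lineWeight x|, δ, hδ, fun t ht => ?_⟩
      have h1 : |lineWeight x| * |F (x + t) - F x| ≤ (M + 8 * e) * ‖t‖ := by
        rw [← abs_mul]
        have e1 : lineWeight x * (F (x + t) - F x) =
            (f (x + t) - f x) - F (x + t) * (lineWeight (x + t) - lineWeight x) := by
          simp only [hf]; ring
        rw [e1]
        refine (abs_sub _ _).trans ?_
        have b1 := h t ht
        have b2 : |F (x + t) * (lineWeight (x + t) - lineWeight x)| ≤ 8 * (e * ‖t‖) := by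
          rw [abs_mul]
          exact mul_le_mul (hFb _) (lineWeight_lipschitz x t) (abs_nonneg _) (by norm_num)
        linarith
      rw [div_mul_eq_mul_div, le_div_iff₀ (abs_pos.2 h0)]
      linarith
    refine (dimH_mono hsub).trans ?_
    rw [dimH_union, dimH_iUnion]
    exact max_le (iSup_le fun k => (dimH_range_lineAt k).le) (dimH_boundedDiffSet_limitFn_le hm)
  -- One line in the zero set of the weight already gives dimension 1: there the increment of f is a
  -- bounded factor times the increment of a Lipschitz function.
  · rw [← dimH_range_lineAt (e := e) 0]
    refine dimH_mono fun x hx => ?_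
    have h0 : lineWeight x = 0 := lineWeight_eq_zero_iff.2 ⟨0, hx⟩
    refine mem_boundedDiffSet_iff.2 ⟨8 * e, 1, one_pos, fun t _ => ?_⟩
    have e1 : f (x + t) - f x = F (x + t) * (lineWeight (x + t) - lineWeight x) := by
      simp only [hf, h0]; ring
    rw [e1, abs_mul, mul_assoc]
    exact mul_le_mul (hFb _) (lineWeight_lipschitz x t) (abs_nonneg _) (by norm_num)
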